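/- Let $k$ be a commutative ring and $(U,A,s,t,\Delta,\epsilon)$ a left bialgebroid over $k$ (with $A$ a possibly noncommutative $k$-algebra and $\epsilon(1)=1$) which is both a left and a right Hopf algebroid, i.e. both Hopf–Galois maps $u\otimes v\mapsto u_{(1)}\otimes u_{(2)}v$ (on the quotient of $U\otimes_k U$ by $u\,t(a)\otimes v=u\otimes t(a)v$) and $u\otimes v\mapsto u_{(1)}v\otimes u_{(2)}$ (on the quotient by $u\,s(a)\otimes v=u\otimes s(a)v$), with values in the quotient $U\otimes_A U$ of $U\otimes_k U$ by $t(a)u\otimes v=u\otimes s(a)v$, are bijective. View $A$ as a left $U$-module by $u\cdot a=\epsilon(u\,s(a))$. On a right $U$-module $P$ put $a\blacktriangleright p\blacktriangleleft b=p\,t(a)s(b)$; tensor products $P\otimes_{A^{op}}M$ with a left $U$-module $M$ are balanced by $p\,t(a)\otimes m=p\otimes t(a)m$, and $\operatorname{Hom}_{A^{op}}(P,N)$ denotes the additive maps $\varphi$ between right $U$-modules with $\varphi(p\,s(b))=\varphi(p)s(b)$, with $A$ acting by $(\varphi\triangleleft a)(p)=\varphi(p\,t(a))$; evaluation maps on $P\otimes_{A^{op}}\operatorname{Hom}_{A^{op}}(P,N)$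 are balanced by $p\,t(a)\otimes\varphi=p\otimes(\varphi\triangleleft a)$. A right $U$-module $P$ is called dualising for $(U,A)$ if $P_{\blacktriangleleft}$ is finitely generated projective over $A^{op}$, the map $A\to\operatorname{Hom}_{A^{op}}(P,P)$, $a\mapsto(p\mapsto a\blacktriangleright p)$, is bijective, and the evaluation map $P\otimes_{A^{op}}\operatorname{Hom}_{A^{op}}(P,N)\to N$ is bijective for every right $U$-module $N$. Let $(U_h,A_h)$ be a quantisation of $(U,A)$: a left bialgebroid over $k[[h]]$ in the $h$-adic topological sense (its coproduct takes values in the Takeuchi product inside the $h$-adic completion $U_h\widehat\otimes_{A_h}U_h$), together with $k[[h]]$-linear isomorphisms $A_h\cong A[[h]]$, $U_h\cong U[[h]]$ which modulo $h$ induce an algebra isomorphism $A_h/hA_h\cong A$ and, over it, an isomorphism of left bialgebroids $U_h/hU_h\cong U$. Assume that $U$ and $A$ are left and right Noetherian and that there is an integer $d\ge 0$ such that $\operatorname{Ext}^i_U(A,U)=0$ for $i\ne d$, that $P=\operatorname{Ext}^d_U(A,U)$ (a right $U$-module via right multiplication on $U$) is a dualising module for $(U,A)$, and that ${}_{\blacktriangleright}P$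 is a finitely generated projective $A$-module. Put $P_h=\operatorname{Ext}^d_{U_h}(A_h,U_h)$. Then: 1. $P_h$ is a dualising module for $(U_h,A_h)$: $(P_h)_{\blacktriangleleft}$ is finitely generated projective over $A_h^{op}$ and ${}_{\blacktriangleright}P_h$ over $A_h$; the map $A_h\to\operatorname{Hom}_{A_h^{op}}(P_h,P_h)$, $a\mapsto(p\mapsto a\blacktriangleright p)$, is bijective; and the evaluation map $P_h\otimes_{A_h^{op}}\operatorname{Hom}_{A_h^{op}}(P_h,N_h)\to N_h$ is bijective for every right $U_h$-module $N_h$ that is ($h$-adically) complete and separated. 2. If $U_h\widehat\otimes_{A_h}U_h$ has no $h$-torsion, then $(U_h,A_h)$ is a topological left and right Hopf algebroid, i.e. both Hopf–Galois maps between the $h$-adically completed tensor products are well defined and bijective. 3. Whenever $(U_h,A_h)$ is a topological left and right Hopf algebroid, with translation maps $u\mapsto u_+\otimes u_-$ (the inverse image of $u\otimes1$ under the first Hopf–Galois map) and $u\mapsto u_{[+]}\otimes u_{[-]}$ (the inverse image of $1\otimes u$ under the second), the functor $M_h\mapsto P_h\otimes_{A_h^{op}}M_h$, with right action $(p\otimes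 m)u=\lim_n p\,u_{+,n}\otimes u_{-,n}m$, is an equivalence from the category of complete left $U_h$-modules to the category of complete right $U_h$-modules, with quasi-inverse $N_h\mapsto\operatorname{Hom}_{A_h^{op}}(P_h,N_h)$, with left action $(u\varphi)(p)=\lim_n\varphi(p\,u_{[+],n})u_{[-],n}$ (the limits being over algebraic tensors converging to $u_+\otimes u_-$, respectively $u_{[+]}\otimes u_{[-]}$). -/

import Mathlib

open CategoryTheory TensorProduct MulOpposite

universe v u

namespace Bialgd

noncomputable section

/-! ### Generalities on modules -/

/-- The relations `f a m ⊗ n = m ⊗ g a n` in `M ⊗[R] N`.  If `f` is a right action and `g` a left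
action of a (noncommutative) `R`-algebra, the quotient of `M ⊗[R] N` by this submodule is the
tensor product over that algebra. -/
def balancedRel (R : Type*) [CommRing R] {ι M N : Type*} [AddCommGroup M] [Module R M]
    [AddCommGroup N] [Module R N] (f : ι → M → M) (g : ι → N → N) : Submodule R (M ⊗[R] N) :=
  Submodule.span R {z | ∃ (a : ι) (m : M) (n : N), z = f a m ⊗ₜ[R] n - m ⊗ₜ[R] g a n}

/-- `M`, regarded as an `A`-module by restriction along `f : A → S`, is finitely generated
projective. -/
def IsFGProjective {A S : Type*} [Ring A] [Ring S] (f : A →+* S) (M : Type*) [AddCommGroup M]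
    [Module S M] : Prop :=
  letI : Module A M := Module.compHom M f
  Module.Finite A M ∧ Module.Projective A M

/-- The ideal `(h)` of `k[[h]]`. -/
abbrev hIdeal (k : Type*) [CommRing k] : Ideal (PowerSeries k) := Ideal.span {PowerSeries.X}

/-- A module over a `k[[h]]`-algebra `S` is complete (and separated) for the `h`-adic topology. -/
def IsHComplete (k : Type*) [CommRing k] (S : Type*) [Ring S] [Algebra (PowerSeries k) S]
    (M : Type*) [AddCommGroup M] [Module S M] : Prop :=
  letI : Module (PowerSeries k) M := Module.compHom M (algebraMap (PowerSeries k) S)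
  IsAdicComplete (hIdeal k) M

/-- The category of left `S`-modules that are complete for the `h`-adic topology (right `S`-modules
are left modules over `Sᵐᵒᵖ`). -/
abbrev CompleteModuleCat (k : Type v) [CommRing k] (S : Type u) [Ring S]
    [Algebra (PowerSeries k) S] :=
  ObjectProperty.FullSubcategory (fun M : ModuleCat.{u} S => IsHComplete k S M)

/-- `Ext^i_S(M, S)`. -/
def ExtRing {S : Type u} [Ring S] (M : ModuleCat.{u} S) (i : ℕ) : Type u :=
  Abelian.Ext.{u} M (ModuleCat.of S S) i

instance {S : Type u} [Ring S] (M : ModuleCat.{u} S) (i : ℕ) : AddCommGroup (ExtRing M i) :=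
  inferInstanceAs (AddCommGroup (Abelian.Ext.{u} M (ModuleCat.of S S) i))

/-- Right multiplication `x ↦ x * r`, as an endomorphism of the left `S`-module `S`. -/
def rightMul {S : Type u} [Ring S] (r : S) : ModuleCat.of S S ⟶ ModuleCat.of S S :=
  ModuleCat.ofHom (LinearMap.toSpanSingleton S S r)

/-- The action of `r` on `Ext^i_S(M, S)` induced by right multiplication by `r` on the
coefficients. -/
def extMul {S : Type u} [Ring S] {M : ModuleCat.{u} S} {i : ℕ} (r : S)
    (e : Abelian.Ext.{u} M (ModuleCat.of S S) i) : Abelian.Ext.{u} M (ModuleCat.of S S) i :=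
  e.comp (Abelian.Ext.mk₀ (rightMul r)) (add_zero i)

section extMul

variable {S : Type u} [Ring S] {M : ModuleCat.{u} S} {i : ℕ}

theorem extMul_one (e : Abelian.Ext.{u} M (ModuleCat.of S S) i) : extMul 1 e = e := by
  have h : rightMul (1 : S) = 𝟙 _ := by
    ext; simp [rightMul]
  rw [extMul, h]
  exact Abelian.Ext.comp_mk₀_id _

theorem extMul_mul (r r' : S) (e : Abelian.Ext.{u} M (ModuleCat.of S S) i) :
    extMul (r * r') e = extMul r' (extMul r e) := by
  have h : rightMul (r * r') = rightMul r ≫ rightMul r' := by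
    ext; simp [rightMul]
  rw [extMul, extMul, extMul, h, ← Abelian.Ext.mk₀_comp_mk₀,
    Abelian.Ext.comp_assoc_of_third_deg_zero]

theorem extMul_add (r r' : S) (e : Abelian.Ext.{u} M (ModuleCat.of S S) i) :
    extMul (r + r') e = extMul r e + extMul r' e := by
  have h : rightMul (r + r') = rightMul r + rightMul r' := by
    ext; simp [rightMul]
  rw [extMul, extMul, extMul, h, Abelian.Ext.mk₀_add, Abelian.Ext.comp_add]

theorem extMul_zero (e : Abelian.Ext.{u} M (ModuleCat.of S S) i) : extMul 0 e = 0 := by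
  have h : rightMul (0 : S) = 0 := by
    ext; simp [rightMul]
  rw [extMul, h, Abelian.Ext.mk₀_zero, Abelian.Ext.comp_zero]

end extMul

/-- The right `S`-module structure of `Ext^i_S(M, S)` induced by right multiplication on the
coefficients. -/
instance {S : Type u} [Ring S] (M : ModuleCat.{u} S) (i : ℕ) : Module Sᵐᵒᵖ (ExtRing M i) where
  smul r e := extMul r.unop e
  one_smul e := extMul_one e
  mul_smul r r' e := extMul_mul r'.unop r.unop e
  smul_zero _ := Abelian.Ext.zero_comp M i _ _ (add_zero i)
  smul_add _ _ _ := Abelian.Ext.add_comp _ _ _ (add_zero i)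
  add_smul r r' e := extMul_add r.unop r'.unop e
  zero_smul e := extMul_zero e

/-! ### `Aᵉ`-rings with a left counit -/

/-- An `Aᵉ`-ring `U`, given by its source and target maps, together with a left counit. This is a
left bialgebroid without its coproduct. -/
structure CounitalAeRing (R : Type v) (A U : Type u) [CommRing R] [Ring A] [Ring U] [Algebra R A]
    [Algebra R U] where
  s : A →ₐ[R] U
  t : Aᵐᵒᵖ →ₐ[R] U
  s_mul_t : ∀ a b, s a * t b = t b * s a
  ε : U →ₗ[R] A
  ε_one : ε 1 = 1
  ε_bimodule : ∀ a b u, ε (s a * t (op b) * u) = a * ε u * b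
  ε_mul_s : ∀ u v, ε (u * v) = ε (u * s (ε v))
  ε_mul_t : ∀ u v, ε (u * v) = ε (u * t (op (ε v)))

namespace CounitalAeRing

variable {R : Type v} {A U : Type u} [CommRing R] [Ring A] [Ring U] [Algebra R A] [Algebra R U]
  (B : CounitalAeRing R A U)

/-- The left `U`-module structure `u(a) = ε(u s(a))` on the base algebra. -/
abbrev baseModule : Module U A where
  smul u a := B.ε (u * B.s a)
  one_smul a := by
    change B.ε (1 * B.s a) = a
    have := B.ε_bimodule a 1 1
    simpa [B.ε_one] using this
  mul_smul u v a := by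
    change B.ε (u * v * B.s a) = B.ε (u * B.s (B.ε (v * B.s a)))
    rw [mul_assoc, B.ε_mul_s]
  smul_zero u := by change B.ε (u * B.s 0) = 0; simp
  smul_add u a b := by
    change B.ε (u * B.s (a + b)) = B.ε (u * B.s a) + B.ε (u * B.s b)
    simp [mul_add]
  add_smul u v a := by
    change B.ε ((u + v) * B.s a) = B.ε (u * B.s a) + B.ε (v * B.s a)
    simp [add_mul]
  zero_smul a := by change B.ε (0 * B.s a) = 0; simp

/-- The base algebra `A` as an object of the category of left `U`-modules. -/
def base : ModuleCat.{u} U :=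
  letI := B.baseModule
  ModuleCat.of U A

/-- The right `U`-module `Ext^i_U(A, U)`. -/
abbrev ExtBase (i : ℕ) : Type u := ExtRing B.base i

/-- The relations of `U_◃ ⊗_A ▹U`, i.e. `t(a)u ⊗ v = u ⊗ s(a)v`. -/
def takRel : Submodule R (U ⊗[R] U) :=
  balancedRel R (fun (a : A) u => B.t (op a) * u) (fun a v => B.s a * v)

/-- The relations of `▸U ⊗_{Aᵒᵖ} U_◃`, i.e. `u t(a) ⊗ v = u ⊗ t(a)v`. -/
def leftRel : Submodule R (U ⊗[R] U) :=
  balancedRel R (fun (a : A) u => u * B.t (op a)) (fun a v => B.t (op a) * v)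

/-- The relations of `U_◂ ⊗^A ▹U`, i.e. `u s(a) ⊗ v = u ⊗ s(a)v`. -/
def rightRel : Submodule R (U ⊗[R] U) :=
  balancedRel R (fun (a : A) u => u * B.s a) (fun a v => B.s a * v)

/-- The relations of the triple tensor product `U_◃ ⊗_A ▹U_◃ ⊗_A ▹U`. -/
def takRel₃ : Submodule R (U ⊗[R] (U ⊗[R] U)) :=
  Submodule.span R
    ({z | ∃ (a : A) (u v w : U), z = (B.t (op a) * u) ⊗ₜ[R] (v ⊗ₜ[R] w)
        - u ⊗ₜ[R] ((B.s a * v) ⊗ₜ[R] w)} ∪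
     {z | ∃ (a : A) (u v w : U), z = u ⊗ₜ[R] ((B.t (op a) * v) ⊗ₜ[R] w)
        - u ⊗ₜ[R] (v ⊗ₜ[R] (B.s a * w))})

/-- `U_◃ ⊗_A ▹U`. -/
abbrev TakTensor : Type _ := (U ⊗[R] U) ⧸ B.takRel

/-- `▸U ⊗_{Aᵒᵖ} U_◃`. -/
abbrev LeftTensor : Type _ := (U ⊗[R] U) ⧸ B.leftRel

/-- `U_◂ ⊗^A ▹U`. -/
abbrev RightTensor : Type _ := (U ⊗[R] U) ⧸ B.rightRel

/-- The axioms of a coproduct `Δ`, read modulo an ideal `J` of the ground ring. Here `rep u x` says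
that `x ∈ U ⊗[R] U` represents the class of `Δ(u)` in `U_◃ ⊗_A ▹U` modulo `J`. The factorwise
product of two elements of the Takeuchi product is represented by the product in `U ⊗[R] U` of any
two representatives. -/
structure IsCoproductMod (J : Ideal R) (rep : U → U ⊗[R] U → Prop) : Prop where
  bimodule : ∀ a b u x, rep u x →
    rep (B.s a * B.t (op b) * u) ((B.s a ⊗ₜ[R] B.t (op b)) * x)
  takeuchi : ∀ u x, rep u x → ∀ a, x * (B.t (op a) ⊗ₜ[R] 1) - x * (1 ⊗ₜ[R] B.s a) ∈
    B.takRel ⊔ J • (⊤ : Submodule R (U ⊗[R] U))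
  one : rep 1 1
  mul : ∀ u v x y, rep u x → rep v y → rep (u * v) (x * y)
  /-- `(Δ ⊗ id) Δ = (id ⊗ Δ) Δ` -/
  coassoc : ∀ (u : U) (m : ℕ) (p q : Fin m → U) (x y : Fin m → U ⊗[R] U),
    rep u (∑ i, p i ⊗ₜ[R] q i) → (∀ i, rep (p i) (x i)) → (∀ i, rep (q i) (y i)) →
    (∑ i, TensorProduct.assoc R U U U (x i ⊗ₜ[R] q i)) - ∑ i, p i ⊗ₜ[R] y i ∈
      B.takRel₃ ⊔ J • (⊤ : Submodule R (U ⊗[R] (U ⊗[R] U)))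
  /-- `s(ε(u₁)) u₂ = u` -/
  counit_left : ∀ (u : U) (m : ℕ) (p q : Fin m → U), rep u (∑ i, p i ⊗ₜ[R] q i) →
    (∑ i, B.s (B.ε (p i)) * q i) - u ∈ J • (⊤ : Submodule R U)
  /-- `t(ε(u₂)) u₁ = u` -/
  counit_right : ∀ (u : U) (m : ℕ) (p q : Fin m → U), rep u (∑ i, p i ⊗ₜ[R] q i) →
    (∑ i, B.t (op (B.ε (q i))) * p i) - u ∈ J • (⊤ : Submodule R U)

/-! ### The two actions of `A` on right `U`-modules, and dualising modules -/

/-- `b ↦ s(b)`, inducing the right `A`-action `p ◂ b = p s(b)` on right `U`-modules. -/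
def sRight : Aᵐᵒᵖ →+* Uᵐᵒᵖ := (B.s : A →+* U).op

/-- `a ↦ t(a)`, inducing the left `A`-action `a ▸ p = p t(a)` on right `U`-modules. -/
def tRight : A →+* Uᵐᵒᵖ := ((B.t : Aᵐᵒᵖ →+* U).op).comp (RingEquiv.opOp A : A →+* Aᵐᵒᵖᵐᵒᵖ)

variable (P N : Type*) [AddCommGroup P] [Module Uᵐᵒᵖ P] [AddCommGroup N] [Module Uᵐᵒᵖ N]

/-- `Hom_{Aᵒᵖ}(P_◂, N_◂)` for right `U`-modules `P` and `N`. -/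
def homAop : AddSubgroup (P →+ N) where
  carrier := {φ | ∀ (b : A) (p : P), φ (op (B.s b) • p) = op (B.s b) • φ p}
  zero_mem' := by intro b p; simp
  add_mem' := by intro φ ψ hφ hψ b p; simp [hφ b p, hψ b p]
  neg_mem' := by intro φ hφ b p; simp [hφ b p]

/-- `φ ↦ φ ◃ a = (p ↦ φ(a ▸ p))`, the right `A`-action on `Hom_{Aᵒᵖ}(P, N)`. -/
def homAct (a : A) (φ : B.homAop P N) : B.homAop P N :=
  ⟨(φ : P →+ N).comp (DistribSMul.toAddMonoidHom P (op (B.t (op a)))), by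
    intro b p
    have h : op (B.t (op a)) • op (B.s b) • p = op (B.s b) • op (B.t (op a)) • p := by
      rw [← mul_smul, ← mul_smul, ← op_mul, ← op_mul, B.s_mul_t]
    have := φ.2 b (op (B.t (op a)) • p)
    simpa [h] using this⟩

/-- The map `A → Hom_{Aᵒᵖ}(P, P)`, `a ↦ (p ↦ a ▸ p)`. -/
def baseToEnd (a : A) : B.homAop P P :=
  B.homAct P P a ⟨AddMonoidHom.id P, fun _ _ => rfl⟩

/-- `▸P ⊗_{Aᵒᵖ} Hom_{Aᵒᵖ}(P, N)_◃`. -/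
abbrev EvalSource : Type _ :=
  (P ⊗[ℤ] (B.homAop P N)) ⧸
    balancedRel ℤ (fun (a : A) (p : P) => op (B.t (op a)) • p) (B.homAct P N)

/-- The evaluation map `▸P ⊗_{Aᵒᵖ} Hom_{Aᵒᵖ}(P, N)_◃ → N`, `p ⊗ φ ↦ φ(p)`. -/
def evalMap : B.EvalSource P N →+ N :=
  (Submodule.liftQ _
    (TensorProduct.lift (LinearMap.mk₂ ℤ (fun (p : P) (φ : B.homAop P N) => (φ : P →+ N) p)
      (by intros; simp) (by intros; simp) (by intros; simp) (by intros; simp)))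
    (by
      refine Submodule.span_le.2 ?_
      rintro _ ⟨a, p, φ, rfl⟩
      simp [homAct])).toAddMonoidHom

/-- A dualising module for `(U, A)`: a right `U`-module `P` with `P_◂` finitely generated projective
over `Aᵒᵖ`, such that `A → Hom_{Aᵒᵖ}(P, P)` is an isomorphism and the evaluation map
`P ⊗_{Aᵒᵖ} Hom_{Aᵒᵖ}(P, N) → N` is an isomorphism for every right `U`-module `N`. -/
structure IsDualising (P : Type u) [AddCommGroup P] [Module Uᵐᵒᵖ P] : Prop where
  fgProjective : IsFGProjective B.sRight P
  baseToEnd_bijective : Function.Bijective (B.baseToEnd P)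
  evalMap_bijective : ∀ (N : Type u) [AddCommGroup N] [Module Uᵐᵒᵖ N],
    Function.Bijective (B.evalMap P N)

end CounitalAeRing

/-! ### Left bialgebroids, left and right Hopf algebroids -/

/-- A left bialgebroid `(U, A)` over the commutative ring `k`. -/
structure LeftBialgebroid (k : Type v) (A U : Type u) [CommRing k] [Ring A] [Ring U] [Algebra k A]
    [Algebra k U] extends CounitalAeRing k A U where
  Δ : U →ₗ[k] toCounitalAeRing.TakTensor
  isCoproduct : toCounitalAeRing.IsCoproductMod ⊥ (fun u x => Δ u = Submodule.Quotient.mk x)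

namespace LeftBialgebroid

variable {k : Type v} {A U : Type u} [CommRing k] [Ring A] [Ring U] [Algebra k A] [Algebra k U]
  (B : LeftBialgebroid k A U)

/-- The Hopf-Galois map `▸U ⊗_{Aᵒᵖ} U_◃ → U_◃ ⊗_A ▹U`, `u ⊗ v ↦ u₁ ⊗ u₂v`, is a bijection. -/
def IsLeftHopf : Prop :=
  ∃ α : B.LeftTensor ≃ₗ[k] B.TakTensor, ∀ (u v : U) (x : U ⊗[k] U),
    B.Δ u = Submodule.Quotient.mk x →
    α (Submodule.Quotient.mk (u ⊗ₜ[k] v)) = Submodule.Quotient.mk (x * (1 ⊗ₜ[k] v))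

/-- The Hopf-Galois map `U_◂ ⊗^A ▹U → U_◃ ⊗_A ▹U`, `u ⊗ v ↦ u₁v ⊗ u₂`, is a bijection. -/
def IsRightHopf : Prop :=
  ∃ α : B.RightTensor ≃ₗ[k] B.TakTensor, ∀ (u v : U) (x : U ⊗[k] U),
    B.Δ u = Submodule.Quotient.mk x →
    α (Submodule.Quotient.mk (u ⊗ₜ[k] v)) = Submodule.Quotient.mk (x * (v ⊗ₜ[k] 1))

end LeftBialgebroid

/-! ### Topological left bialgebroids over `k[[h]]` -/

section completion

variable (k : Type*) [CommRing k] {T : Type*} [AddCommGroup T] [Module (PowerSeries k) T]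

/-- `x ∈ T` represents the element `z` modulo `hⁿ` of the `h`-adic completion of `T ⧸ W`. -/
def RepMod (W : Submodule (PowerSeries k) T) (n : ℕ) (z : AdicCompletion (hIdeal k) (T ⧸ W))
    (x : T) : Prop :=
  AdicCompletion.eval (hIdeal k) (T ⧸ W) n z = Submodule.Quotient.mk (Submodule.Quotient.mk x)

/-- The image of `x ∈ T` in the `h`-adic completion of `T ⧸ W`. -/
def toCompletion (W : Submodule (PowerSeries k) T) (x : T) :
    AdicCompletion (hIdeal k) (T ⧸ W) :=
  AdicCompletion.of (hIdeal k) (T ⧸ W) (Submodule.Quotient.mk x)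

end completion

/-- A topological left bialgebroid over `k[[h]]`, for the `h`-adic topologies: the coproduct takes
values in the `h`-adic completion of `U_◃ ⊗_A ▹U`, and its axioms hold there, i.e. modulo `hⁿ` for
all `n`. -/
structure TopLeftBialgebroid (k : Type v) (A U : Type u) [CommRing k] [Ring A] [Ring U]
    [Algebra (PowerSeries k) A] [Algebra (PowerSeries k) U] extends
    CounitalAeRing (PowerSeries k) A U where
  Δ : U →ₗ[PowerSeries k] AdicCompletion (hIdeal k) toCounitalAeRing.TakTensor
  isCoproduct : ∀ n : ℕ, toCounitalAeRing.IsCoproductMod (hIdeal k ^ n)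
    (fun u x => RepMod k toCounitalAeRing.takRel n (Δ u) x)

namespace TopLeftBialgebroid

variable {k : Type v} {A U : Type u} [CommRing k] [Ring A] [Ring U]
  [Algebra (PowerSeries k) A] [Algebra (PowerSeries k) U] (B : TopLeftBialgebroid k A U)

/-- The completed tensor product `U_◃ ⊗̂_A ▹U`. -/
abbrev TakCompl : Type _ := AdicCompletion (hIdeal k) B.TakTensor

/-- The completed tensor product `▸U ⊗̂_{Aᵒᵖ} U_◃`. -/
abbrev LeftCompl : Type _ := AdicCompletion (hIdeal k) B.LeftTensor

/-- The completed tensor product `U_◂ ⊗̂^A ▹U`. -/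
abbrev RightCompl : Type _ := AdicCompletion (hIdeal k) B.RightTensor

/-- A topological left Hopf algebroid: the Hopf-Galois map
`▸U ⊗̂_{Aᵒᵖ} U_◃ → U_◃ ⊗̂_A ▹U`, `u ⊗ v ↦ u₁ ⊗ u₂v`, is bijective. It is the only `k[[h]]`-linear
map with the given values. -/
structure LeftHopf where
  galois : B.LeftCompl ≃ₗ[PowerSeries k] B.TakCompl
  galois_tmul : ∀ (u v : U) (n : ℕ) (x : U ⊗[PowerSeries k] U),
    RepMod k B.takRel n (B.Δ u) x →
    RepMod k B.takRel n (galois (toCompletion k B.leftRel (u ⊗ₜ v))) (x * (1 ⊗ₜ v))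

/-- A topological right Hopf algebroid: the Hopf-Galois map
`U_◂ ⊗̂^A ▹U → U_◃ ⊗̂_A ▹U`, `u ⊗ v ↦ u₁v ⊗ u₂`, is bijective. It is the only `k[[h]]`-linear map
with the given values. -/
structure RightHopf where
  galois : B.RightCompl ≃ₗ[PowerSeries k] B.TakCompl
  galois_tmul : ∀ (u v : U) (n : ℕ) (x : U ⊗[PowerSeries k] U),
    RepMod k B.takRel n (B.Δ u) x →
    RepMod k B.takRel n (galois (toCompletion k B.rightRel (u ⊗ₜ v))) (x * (v ⊗ₜ 1))

variable {B}

/-- The translation map `u ↦ u₊ ⊗ u₋`. -/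
def LeftHopf.translation (H : B.LeftHopf) (u : U) : B.LeftCompl :=
  H.galois.symm (toCompletion k B.takRel (u ⊗ₜ 1))

/-- The translation map `u ↦ u₍₊₎ ⊗ u₍₋₎`. -/
def RightHopf.translation (H : B.RightHopf) (u : U) : B.RightCompl :=
  H.galois.symm (toCompletion k B.takRel (1 ⊗ₜ u))

variable (B)

/-- A dualising module for a topological left bialgebroid `(U, A)` over `k[[h]]`: both `P_◂` and
`▸P` are finitely generated projective, `A → Hom_{Aᵒᵖ}(P, P)` is an isomorphism, and the evaluation
map `P ⊗_{Aᵒᵖ} Hom_{Aᵒᵖ}(P, N) → N` is an isomorphism for every complete right `U`-module `N`. -/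
structure IsTopDualising (P : Type u) [AddCommGroup P] [Module Uᵐᵒᵖ P] : Prop where
  fgProjective_right : IsFGProjective B.sRight P
  fgProjective_left : IsFGProjective B.tRight P
  baseToEnd_bijective : Function.Bijective (B.baseToEnd P)
  evalMap_bijective : ∀ (N : Type u) [AddCommGroup N] [Module Uᵐᵒᵖ N],
    IsHComplete k Uᵐᵒᵖ N → Function.Bijective (B.evalMap P N)

/-- `▸P ⊗_{Aᵒᵖ} M_◃` for a right `U`-module `P` and a left `U`-module `M`. -/
abbrev ModTensor (P M : Type*) [AddCommGroup P] [Module Uᵐᵒᵖ P] [AddCommGroup M] [Module U M] :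
    Type _ :=
  (P ⊗[ℤ] M) ⧸ balancedRel ℤ (fun (a : A) (p : P) => op (B.t (op a)) • p)
    (fun a (m : M) => B.t (op a) • m)

variable {B}

/-- The functor `F` is `M ↦ ▸P ⊗_{Aᵒᵖ} M_◃`, where the right `U`-action on the tensor product is
`(p ⊗ m)u = lim p u₊ ⊗ u₋ m` (limit for the `h`-adic topology, over algebraic tensors converging to
`u₊ ⊗ u₋`). -/
structure IsTensorFunctor (H : B.LeftHopf) (P : Type u) [AddCommGroup P] [Module Uᵐᵒᵖ P]
    (F : CompleteModuleCat k U ⥤ CompleteModuleCat k Uᵐᵒᵖ) where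
  iso : ∀ M : CompleteModuleCat k U, B.ModTensor P M.obj ≃+ (F.obj M).obj
  naturality : ∀ {M M' : CompleteModuleCat k U} (f : M ⟶ M') (p : P) (m : M.obj),
    iso M' (Submodule.Quotient.mk (p ⊗ₜ f.hom.hom m)) =
      (F.map f).hom.hom (iso M (Submodule.Quotient.mk (p ⊗ₜ m)))
  action : ∀ (M : CompleteModuleCat k U) (u : U) (p : P) (m : M.obj) (n r : ℕ)
    (v w : Fin r → U), RepMod k B.leftRel n (H.translation u) (∑ i, v i ⊗ₜ w i) →
    ∃ y : (F.obj M).obj,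
      op u • iso M (Submodule.Quotient.mk (p ⊗ₜ m))
        - iso M (Submodule.Quotient.mk (∑ i, (op (v i) • p) ⊗ₜ (w i • m)))
      = algebraMap (PowerSeries k) Uᵐᵒᵖ (PowerSeries.X ^ n) • y

/-- The functor `G` is `N ↦ Hom_{Aᵒᵖ}(P_◂, N_◂)`, where the left `U`-action on the homomorphisms is
`(uφ)(p) = lim φ(p u₍₊₎) u₍₋₎` (limit for the `h`-adic topology, over algebraic tensors converging to
`u₍₊₎ ⊗ u₍₋₎`). -/
structure IsHomFunctor (H : B.RightHopf) (P : Type u) [AddCommGroup P] [Module Uᵐᵒᵖ P]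
    (G : CompleteModuleCat k Uᵐᵒᵖ ⥤ CompleteModuleCat k U) where
  iso : ∀ N : CompleteModuleCat k Uᵐᵒᵖ, B.homAop P N.obj ≃+ (G.obj N).obj
  naturality : ∀ {N N' : CompleteModuleCat k Uᵐᵒᵖ} (f : N ⟶ N') (φ : B.homAop P N.obj) (p : P),
    ((iso N').symm ((G.map f).hom.hom (iso N φ)) : P →+ N'.obj) p =
      f.hom.hom ((φ : P →+ N.obj) p)
  action : ∀ (N : CompleteModuleCat k Uᵐᵒᵖ) (u : U) (φ : B.homAop P N.obj) (p : P) (n r : ℕ)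
    (v w : Fin r → U), RepMod k B.rightRel n (H.translation u) (∑ i, v i ⊗ₜ w i) →
    ∃ y : N.obj,
      ((iso N).symm (u • iso N φ) : P →+ N.obj) p
        - ∑ i, op (w i) • (φ : P →+ N.obj) (op (v i) • p)
      = algebraMap (PowerSeries k) Uᵐᵒᵖ (PowerSeries.X ^ n) • y

end TopLeftBialgebroid

/-! ### Quantisations -/

/-- `(Uh, Ah)` is a quantisation of `(U, A)`: there are isomorphisms of `k[[h]]`-modules
`Ah ≅ A[[h]]` and `Uh ≅ U[[h]]` whose reductions modulo `h` are isomorphisms of algebras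
`Ah / h Ah ≅ A` and `Uh / h Uh ≅ U`, and the latter is an isomorphism of left bialgebroids over the
former. -/
structure Quantisation {k : Type v} {A U Ah Uh : Type u} [CommRing k] [Ring A] [Ring U]
    [Algebra k A] [Algebra k U] [Ring Ah] [Ring Uh] [Algebra (PowerSeries k) Ah]
    [Algebra (PowerSeries k) Uh] (B : LeftBialgebroid k A U)
    (Bh : TopLeftBialgebroid k Ah Uh) where
  isoA : Ah ≃+ PowerSeries A
  isoA_smul : ∀ (f : PowerSeries k) (a : Ah),
    isoA (f • a) = PowerSeries.map (algebraMap k A) f * isoA a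
  isoU : Uh ≃+ PowerSeries U
  isoU_smul : ∀ (f : PowerSeries k) (x : Uh),
    isoU (f • x) = PowerSeries.map (algebraMap k U) f * isoU x
  /-- reduction modulo `h` on `Ah` -/
  redA : Ah →+* A
  redA_eq : ∀ a, redA a = PowerSeries.constantCoeff (isoA a)
  /-- reduction modulo `h` on `Uh` -/
  redU : Uh →+* U
  redU_eq : ∀ x, redU x = PowerSeries.constantCoeff (isoU x)
  redU_s : ∀ a : Ah, redU (Bh.s a) = B.s (redA a)
  redU_t : ∀ a : Ah, redU (Bh.t (op a)) = B.t (op (redA a))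
  redA_ε : ∀ x : Uh, redA (Bh.ε x) = B.ε (redU x)
  redU_Δ : ∀ (x : Uh) (r : ℕ) (v w : Fin r → Uh),
    RepMod k Bh.takRel 1 (Bh.Δ x) (∑ i, v i ⊗ₜ w i) →
    B.Δ (redU x) = Submodule.Quotient.mk (∑ i, redU (v i) ⊗ₜ redU (w i))

end

end Bialgd

/-! Everything is read off modulo h. A linear map from an h-adically complete module to a separated
one without h-torsion is bijective as soon as it is so modulo h (`bijective_of_mod`): surjectivity
is successive approximation (`exists_eq_of_step`), and an element of the kernel can be divided by h
again and again.

The dualising module. Since U is Noetherian, A_h has a resolution by finitely generated free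
U_h-modules whose syzygies are separated, without torsion, and reduce modulo h to the syzygies of a
resolution of A. Ext in degree n is the group of linear forms on the n-th syzygy modulo those that
extend to the free module containing it. Vanishing of Ext over U in degree d - 1 excludes h-torsion
in degree d, and vanishing in degree d + 1 lets linear forms on the d-th syzygy be lifted. Hence P_h
is complete, has no h-torsion and reduces to P (`IsRed.ext_reduction`). Dual bases of P lift to P_h
through lifting of idempotent matrices (`HasDualBasis.lift_of_mod`), and the map from A_h to the
endomorphisms of P_h is covered by the criterion above. The evaluation map needs another argument,
because N_h may have h-torsion. Dual bases of P_h for both actions turn its bijectivity into a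
property of two matrices over the opposite of U_h acting on finite powers of N_h (`coeffGood_iff`).
This property can be checked on hN and N/hN, and then on all N/h^nN (`CoeffGood.of_pow`,
`CoeffGood.of_complete`). A module killed by h is a U-module, and there the property is the
hypothesis on P.

The Hopf-Galois maps. Level 1 of each completed tensor product is the corresponding tensor product
over A, so the completed Galois maps reduce to those of U. Their target is complete, and without
torsion by assumption, so the criterion applies (`exists_galois`).

The equivalence. The Galois isomorphisms turn identities between translation maps into identities
for the coproduct, modulo every power of h: multiplicativity and balancedness make the two limit
formulas into module structures, and the cross relations (`translation_cross_left`,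
`translation_cross_right`) make the unit m ↦ (p ↦ p ⊗ m) and the evaluation linear over U_h. The
unit is bijective because A_h is the endomorphism ring of the finitely generated projective module
P_h (`coev_bijective`); the counit is the evaluation map of the first part. -/

namespace Bialgd
noncomputable section

/-! ### Modules that are complete for the topology defined by one element -/

section PowComplete

variable {R : Type*} [CommRing R] (h : R) (M N : Type*) [AddCommGroup M] [Module R M]
  [AddCommGroup N] [Module R N]

/-- The submodule `hⁿM` of `M`. -/
def hpow (n : ℕ) : Submodule R M := LinearMap.range (LinearMap.lsmul R M (h ^ n))

variable {M N}

theorem mem_hpow {n : ℕ} {x : M} : x ∈ hpow h M n ↔ ∃ z, x = h ^ n • z := by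
  simp only [hpow, LinearMap.mem_range, LinearMap.lsmul_apply, eq_comm]

theorem mem_hpow_one {x : M} : x ∈ hpow h M 1 ↔ ∃ z, x = h • z := by
  simp [mem_hpow]

theorem smul_mem_hpow (n : ℕ) (z : M) : h ^ n • z ∈ hpow h M n := (mem_hpow h).2 ⟨z, rfl⟩

theorem smul_mem_hpow_one (z : M) : h • z ∈ hpow h M 1 := (mem_hpow_one h).2 ⟨z, rfl⟩

theorem hpow_zero : hpow h M 0 = ⊤ := by
  ext x; simp [mem_hpow]

theorem hpow_anti {m n : ℕ} (hmn : m ≤ n) : hpow h M n ≤ hpow h M m := by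
  intro x hx
  obtain ⟨z, rfl⟩ := (mem_hpow h).1 hx
  obtain ⟨r, rfl⟩ := Nat.exists_eq_add_of_le hmn
  rw [pow_add, mul_smul]
  exact smul_mem_hpow h m _

theorem map_mem_hpow {n : ℕ} (f : M →ₗ[R] N) {x : M} (hx : x ∈ hpow h M n) :
    f x ∈ hpow h N n := by
  obtain ⟨z, rfl⟩ := (mem_hpow h).1 hx
  rw [map_smul]
  exact smul_mem_hpow h n _

theorem hpow_eq_smul_top (n : ℕ) :
    Ideal.span {h} ^ n • (⊤ : Submodule R M) = hpow h M n := by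
  ext x
  rw [Ideal.span_singleton_pow, Submodule.ideal_span_singleton_smul,
    Submodule.mem_smul_pointwise_iff_exists, mem_hpow]
  simp [eq_comm]

theorem hpow_pi {ι : Type*} {n : ℕ} {x : ι → M} :
    x ∈ hpow h (ι → M) n ↔ ∀ i, x i ∈ hpow h M n := by
  constructor
  · intro hx i
    exact map_mem_hpow h (LinearMap.proj i : (ι → M) →ₗ[R] M) hx
  · intro hx
    choose z hz using fun i => (mem_hpow h).1 (hx i)
    exact (mem_hpow h).2 ⟨z, funext hz⟩

variable (M)

/-- `M` is separated for the `h`-adic topology. -/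
def PowSep : Prop := ∀ x : M, (∀ n, x ∈ hpow h M n) → x = 0

/-- `M` has no `h`-torsion. -/
def TorsFree : Prop := ∀ x : M, h • x = 0 → x = 0

/-- `M` is complete and separated for the `h`-adic topology. -/
structure PowComplete : Prop where
  sep : PowSep h M
  exists_sum : ∀ y : ℕ → M, ∃ L, ∀ n, L - ∑ i ∈ Finset.range n, h ^ i • y i ∈ hpow h M n

variable {M} {h}

theorem PowSep.eq (hM : PowSep h M) {x y : M} (hxy : ∀ n, x - y ∈ hpow h M n) : x = y :=
  sub_eq_zero.1 (hM _ hxy)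

theorem TorsFree.pow (hM : TorsFree h M) (n : ℕ) {x : M} (hx : h ^ n • x = 0) : x = 0 := by
  induction n with
  | zero => simpa using hx
  | succ n ih => exact ih (hM _ (by rwa [← mul_smul, ← pow_succ']))

theorem TorsFree.pow_inj (hM : TorsFree h M) (n : ℕ) {x y : M} (hx : h ^ n • x = h ^ n • y) :
    x = y := by
  rw [← sub_eq_zero]
  exact hM.pow n (by rw [smul_sub, hx, sub_self])

theorem TorsFree.inj (hM : TorsFree h M) {x y : M} (hx : h • x = h • y) : x = y :=
  hM.pow_inj 1 (by simpa using hx)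

/-- Such a sequence is its first term plus the partial sums of a series with terms h^i y_i. -/
theorem PowComplete.exists_lim (hM : PowComplete h M) (f : ℕ → M)
    (hf : ∀ n, f (n + 1) - f n ∈ hpow h M n) : ∃ L, ∀ n, L - f n ∈ hpow h M n := by
  choose y hy using fun n => (mem_hpow h).1 (hf n)
  obtain ⟨L, hL⟩ := hM.exists_sum y
  refine ⟨f 0 + L, fun n => ?_⟩
  have : ∀ n, f n = f 0 + ∑ i ∈ Finset.range n, h ^ i • y i := by
    intro n
    induction n with
    | zero => simp
    | succ n ih => rw [Finset.sum_range_succ, ← hy n, ← add_assoc, ← ih]; abel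
  rw [this n, add_sub_add_left_eq_sub]
  exact hL n

theorem PowComplete.of_isAdicComplete (hM : IsAdicComplete (Ideal.span {h}) M) :
    PowComplete h M where
  sep x hx := IsHausdorff.haus (I := Ideal.span {h}) hM.toIsHausdorff x fun n => by
    rw [SModEq.zero, hpow_eq_smul_top]; exact hx n
  exists_sum y := by
    obtain ⟨L, hL⟩ := IsPrecomplete.prec (I := Ideal.span {h}) hM.toIsPrecomplete
      (f := fun n => ∑ i ∈ Finset.range n, h ^ i • y i) (by
        intro m n hmn
        rw [SModEq.sub_mem, hpow_eq_smul_top, ← neg_mem_iff, neg_sub,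
          ← Finset.sum_range_add_sum_Ico _ hmn, add_sub_cancel_left]
        refine Submodule.sum_mem _ fun i hi => ?_
        exact hpow_anti h (Finset.mem_Ico.1 hi).1 (smul_mem_hpow h i _))
    refine ⟨L, fun n => ?_⟩
    have := hL n
    rw [SModEq.sub_mem, hpow_eq_smul_top, ← neg_mem_iff, neg_sub] at this
    exact this

theorem PowComplete.isAdicComplete (hM : PowComplete h M) : IsAdicComplete (Ideal.span {h}) M where
  haus' x hx := hM.sep x fun n => by
    have := hx n
    rwa [SModEq.zero, hpow_eq_smul_top] at this
  prec' f hf := by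
    obtain ⟨L, hL⟩ := hM.exists_lim f (fun n => by
      have := hf (Nat.le_succ n)
      rw [SModEq.sub_mem, hpow_eq_smul_top, ← neg_mem_iff, neg_sub] at this
      exact this)
    refine ⟨L, fun n => ?_⟩
    rw [SModEq.sub_mem, hpow_eq_smul_top, ← neg_mem_iff, neg_sub]
    exact hL n

theorem PowSep.of_injective (hN : PowSep h N) (f : M →ₗ[R] N) (hf : Function.Injective f) :
    PowSep h M := fun x hx =>
  hf (by rw [map_zero]; exact hN _ fun n => map_mem_hpow h f (hx n))

theorem TorsFree.of_injective (hN : TorsFree h N) (f : M →ₗ[R] N) (hf : Function.Injective f) :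
    TorsFree h M := fun x hx =>
  hf (by rw [map_zero]; exact hN _ (by rw [← map_smul, hx, map_zero]))

/-- Series are summed upstairs after lifting their terms. Separatedness does not pass to quotients
and has to be supplied. -/
theorem PowComplete.of_surjective (hM : PowComplete h M) (f : M →ₗ[R] N)
    (hf : Function.Surjective f) (hN : PowSep h N) : PowComplete h N where
  sep := hN
  exists_sum y := by
    choose x hx using fun i => hf (y i)
    obtain ⟨L, hL⟩ := hM.exists_sum x
    refine ⟨f L, fun n => ?_⟩
    simpa [hx] using map_mem_hpow h f (hL n)

theorem PowComplete.of_retract (hN : PowComplete h N) (i : M →ₗ[R] N) (r : N →ₗ[R] M)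
    (hir : ∀ x, r (i x) = x) : PowComplete h M :=
  hN.of_surjective r (fun _ => ⟨i _, hir _⟩)
    (hN.sep.of_injective i (Function.LeftInverse.injective hir))

theorem PowSep.pi {ι : Type*} (hM : PowSep h M) : PowSep h (ι → M) := fun _ hx =>
  funext fun i => hM _ fun n => (hpow_pi h).1 (hx n) i

theorem TorsFree.pi {ι : Type*} (hM : TorsFree h M) : TorsFree h (ι → M) := fun _ hx =>
  funext fun i => hM _ (congrFun hx i)

theorem PowComplete.pi {ι : Type*} (hM : PowComplete h M) : PowComplete h (ι → M) where
  sep := hM.sep.pi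
  exists_sum y := by
    choose L hL using fun i => hM.exists_sum (fun n => y n i)
    refine ⟨L, fun n => (hpow_pi h).2 fun i => ?_⟩
    simpa using hL i n

/-- Solving `f x = y` by successive approximation. -/
theorem exists_eq_of_step (hM : PowComplete h M) (hN : PowSep h N) (f : M →ₗ[R] N) (Φ : N → Prop)
    (step : ∀ y, Φ y → ∃ x y', Φ y' ∧ y = f x + h • y') (y : N) (hy : Φ y) : ∃ x, f x = y := by
  -- One step writes y as f (a y) plus h times the remainder b y. Iterating b gives y = f (∑ h^i a(s
  -- i)) + h^n s n, and Φ is the invariant that keeps the step applicable to every remainder.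
  choose! a b hb hab using step
  let s : ℕ → N := fun n => b^[n] y
  have hs : ∀ n, Φ (s n) := by
    intro n
    induction n with
    | zero => exact hy
    | succ n ih => simp only [s, Function.iterate_succ_apply'] at ih ⊢; exact hb _ ih
  have hs' : ∀ n, s n = f (a (s n)) + h • s (n + 1) := by
    intro n
    have := hab _ (hs n)
    simp only [s, Function.iterate_succ_apply'] at this ⊢
    exact this
  obtain ⟨L, hL⟩ := hM.exists_sum (fun n => a (s n))
  have key : ∀ n, y = f (∑ i ∈ Finset.range n, h ^ i • a (s i)) + h ^ n • s n := by
    intro n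
    induction n with
    | zero => simp [s]
    | succ n ih =>
      rw [Finset.sum_range_succ, map_add, map_smul, add_assoc, pow_succ, mul_smul, ← smul_add,
        ← hs' n]
      exact ih
  refine ⟨L, hN.eq fun n => ?_⟩
  have h1 := map_mem_hpow h f (hL n)
  rw [map_sub] at h1
  have : f L - y = f L - f (∑ i ∈ Finset.range n, h ^ i • a (s i)) - h ^ n • s n := by
    conv_lhs => rw [key n]
    abel
  rw [this]
  exact sub_mem h1 (smul_mem_hpow h n _)

theorem surjective_of_mod (hM : PowComplete h M) (hN : PowSep h N) (f : M →ₗ[R] N)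
    (hf : ∀ y, ∃ x, y - f x ∈ hpow h N 1) : Function.Surjective f := fun y =>
  exists_eq_of_step hM hN f (fun _ => True) (fun y _ => by
    obtain ⟨x, hx⟩ := hf y
    obtain ⟨z, hz⟩ := (mem_hpow_one h).1 hx
    exact ⟨x, z, trivial, by rw [← hz]; abel⟩) y trivial

/-- If f x = 0 then x = h z, and f z is h-torsion, so f z = 0 and the argument repeats: x lies in
every h^n M. -/
theorem injective_of_mod (hM : PowSep h M) (hN : TorsFree h N) (f : M →ₗ[R] N)
    (hf : ∀ x, f x ∈ hpow h N 1 → x ∈ hpow h M 1) : Function.Injective f := by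
  refine (injective_iff_map_eq_zero f).2 fun x hx => hM x fun n => ?_
  induction n generalizing x with
  | zero => simp [hpow_zero]
  | succ n ih =>
    obtain ⟨z, rfl⟩ := (mem_hpow_one h).1 (hf x (by rw [hx]; exact zero_mem _))
    obtain ⟨w, rfl⟩ := (mem_hpow h).1 (ih z (hN _ (by rw [← map_smul, hx])))
    rw [← mul_smul, ← pow_succ']
    exact smul_mem_hpow h _ _

/-- The criterion applied below to lifted dual bases, to the map from the base algebra to
endomorphisms, and to the Galois maps. -/
theorem bijective_of_mod (hM : PowComplete h M) (hN : PowSep h N) (hN' : TorsFree h N)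
    (f : M →ₗ[R] N) (hf : ∀ y, ∃ x, y - f x ∈ hpow h N 1)
    (hf' : ∀ x, f x ∈ hpow h N 1 → x ∈ hpow h M 1) : Function.Bijective f :=
  ⟨injective_of_mod hM.sep hN' f hf', surjective_of_mod hM hN f hf⟩

end PowComplete


/-! ### Dual bases and lifting of projectivity -/

/-- A finite dual basis of `M`, regarded as an `A`-module by restriction along `f : A → S`. -/
def HasDualBasis {A S : Type*} [Ring A] [Ring S] (f : A →+* S) (M : Type*) [AddCommGroup M]
    [Module S M] : Prop :=
  ∃ (n : ℕ) (e : Fin n → M) (c : Fin n → M →+ A), (∀ i a m, c i (f a • m) = a * c i m) ∧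
    ∀ m, ∑ i, f (c i m) • e i = m

/-- The dual basis lemma. A dual basis involves only elements and additive maps, so it can be moved
between rings without restricting scalars. -/
theorem isFGProjective_iff_hasDualBasis {A S : Type*} [Ring A] [Ring S] (f : A →+* S) (M : Type*)
    [AddCommGroup M] [Module S M] : IsFGProjective f M ↔ HasDualBasis f M := by
  let : Module A M := Module.compHom M f
  have smul_def : ∀ (a : A) (m : M), a • m = f a • m := fun _ _ => rfl
  constructor
  · rintro ⟨h1, h2⟩
    replace h1 : Module.Finite A M := h1
    replace h2 : Module.Projective A M := h2
    obtain ⟨n, p, hp⟩ := Module.Finite.exists_fin' A M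
    obtain ⟨s, hs⟩ := Module.projective_lifting_property p LinearMap.id hp
    refine ⟨n, fun i => p (Pi.single i 1), fun i => ((LinearMap.proj i).comp s).toAddMonoidHom,
      fun i a m => ?_, fun m => ?_⟩
    · rw [← smul_def]
      exact ((LinearMap.proj i).comp s).map_smul a m
    · conv_rhs => rw [← LinearMap.id_apply (R := A) m, ← hs, LinearMap.comp_apply,
        pi_eq_sum_univ' (s m), map_sum]
      refine Finset.sum_congr rfl fun i _ => ?_
      rw [map_smul, smul_def]
      congr 2
  · rintro ⟨n, e, c, hc, hec⟩
    have lin : ∀ i a m, c i (a • m) = a * c i m := hc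
    let s : M →ₗ[A] (Fin n → A) := LinearMap.pi fun i =>
      { toFun := c i, map_add' := map_add _, map_smul' := lin i }
    let p : (Fin n → A) →ₗ[A] M := Fintype.linearCombination A e
    have hps : p.comp s = LinearMap.id := by
      ext m
      exact (Fintype.linearCombination_apply A e (s m)).trans (hec m)
    have hp : Function.Surjective p := fun m => ⟨s m, LinearMap.congr_fun hps m⟩
    exact ⟨Module.Finite.of_surjective p hp, Module.Projective.of_split s p hps⟩

section Idempotent

variable {R : Type*} [CommRing R] {h : R} {E : Type*} [Ring E] [Algebra R E]

theorem mul_mem_hpow_left {m n : ℕ} {x y : E} (hx : x ∈ hpow h E m) (hy : y ∈ hpow h E n) :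
    x * y ∈ hpow h E (m + n) := by
  obtain ⟨z, rfl⟩ := (mem_hpow h).1 hx
  obtain ⟨w, rfl⟩ := (mem_hpow h).1 hy
  rw [smul_mul_smul_comm, ← pow_add]
  exact smul_mem_hpow h _ _

theorem mul_mem_hpow_of_left {n : ℕ} {x : E} (hx : x ∈ hpow h E n) (y : E) :
    x * y ∈ hpow h E n :=
  mul_mem_hpow_left (n := 0) hx (by simp [hpow_zero])

theorem mul_mem_hpow_of_right {n : ℕ} {x : E} (hx : x ∈ hpow h E n) (y : E) :
    y * x ∈ hpow h E n := by
  have := mul_mem_hpow_left (m := 0) (x := y) (h := h) (by simp [hpow_zero]) hx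
  rwa [zero_add] at this

/-- Lifting of idempotents in a complete ring. -/
theorem exists_idempotent_lift (hE : PowComplete h E) (x : E) (hx : x * x - x ∈ hpow h E 1) :
    ∃ e : E, e * e = e ∧ e - x ∈ hpow h E 1 := by
  -- Newton iteration for y² = y: φ fixes y up to a multiple of the defect y² - y, and squares the
  -- defect up to a factor. Only powers of one element occur, so commutativity is not needed.
  let φ : E → E := fun y => 3 * (y * y) - 2 * (y * y * y)
  have hφ1 : ∀ y, φ y - y = (y * y - y) * (1 - 2 * y) := fun y => by
    simp only [φ]; noncomm_ring
  have hφ2 : ∀ y, φ y * φ y - φ y = (y * y - y) * (y * y - y) * (4 * (y * y) - 4 * y - 3) :=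
    fun y => by simp only [φ]; noncomm_ring
  have hs : ∀ n, φ^[n] x * φ^[n] x - φ^[n] x ∈ hpow h E (n + 1) := by
    intro n
    induction n with
    | zero => simpa using hx
    | succ n ih =>
      rw [Function.iterate_succ_apply', hφ2]
      -- Squaring gives the exponent 2(n + 1), which is at least the required n + 2.
      exact mul_mem_hpow_of_left (hpow_anti h (by omega) (mul_mem_hpow_left ih ih)) _
  have hd : ∀ n, φ^[n + 1] x - φ^[n] x ∈ hpow h E (n + 1) := fun n => by
    rw [Function.iterate_succ_apply', hφ1]
    exact mul_mem_hpow_of_left (hs n) _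
  obtain ⟨e, he⟩ := hE.exists_lim (fun n => φ^[n] x) (fun n => hpow_anti h (by omega) (hd n))
  refine ⟨e, hE.sep.eq fun n => ?_, ?_⟩
  · have h1 : e * e - e = (e - φ^[n] x) * e + φ^[n] x * (e - φ^[n] x)
        + (φ^[n] x * φ^[n] x - φ^[n] x) - (e - φ^[n] x) := by noncomm_ring
    rw [h1]
    exact sub_mem (add_mem (add_mem (mul_mem_hpow_of_left (he n) _)
      (mul_mem_hpow_of_right (he n) _)) (hpow_anti h (by omega) (hs n))) (he n)
  · have := add_mem (he 1) (hd 0)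
    simpa using this

end Idempotent

section Lift

variable {R : Type*} [CommRing R] {h : R} {A' A : Type*} [Ring A'] [Ring A] [Algebra R A']
  {M' M : Type*} [AddCommGroup M'] [AddCommGroup M] [Module R M'] [Module A' M']
  [IsScalarTower R A' M'] [Module A M]

/-- A dual basis modulo `h` lifts to a dual basis. -/
theorem HasDualBasis.lift_of_mod (hA : PowComplete h A') (hM : PowSep h M') (hM' : TorsFree h M')
    (q : A' →+* A) (hq : Function.Surjective q) (hq' : ∀ a, q a = 0 ↔ a ∈ hpow h A' 1)
    (ρ : M' →+ M) (hρ : Function.Surjective ρ) (hρ' : ∀ x, ρ x = 0 ↔ x ∈ hpow h M' 1)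
    (hqρ : ∀ a x, ρ (a • x) = q a • ρ x) (H : HasDualBasis (RingHom.id A) M) :
    HasDualBasis (RingHom.id A') M' := by
  obtain ⟨n, e, c, hc, hec⟩ := H
  simp only [RingHom.id_apply] at hc hec
  choose e' he' using fun i => hρ (e i)
  -- X lifts the matrix (c_j(e_i)), the idempotent whose row space is M inside A^n.
  choose X hX using fun (i j : Fin n) => hq (c j (e i))
  have hE : PowComplete h (Matrix (Fin n) (Fin n) A') := (hA.pi (ι := Fin n)).pi (ι := Fin n)
  have mem_mat : ∀ Y : Matrix (Fin n) (Fin n) A',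
      Y ∈ hpow h (Matrix (Fin n) (Fin n) A') 1 ↔ ∀ i j, q (Y i j) = 0 := by
    intro Y
    refine (hpow_pi h).trans (forall_congr' fun i => (hpow_pi h).trans (forall_congr' fun j => ?_))
    exact (hq' _).symm
  have cvec : ∀ v : Fin n → A, ∀ j, ∑ i, v i * c j (e i) = c j (∑ i, v i • e i) := by
    intro v j
    rw [map_sum]
    exact Finset.sum_congr rfl fun i _ => (hc _ _ _).symm
  obtain ⟨ε, hε, hεX⟩ := exists_idempotent_lift hE (Matrix.of X) (by
    rw [mem_mat]
    intro i j
    simp only [Matrix.sub_apply, Matrix.mul_apply, Matrix.of_apply, map_sub, map_sum, map_mul, hX]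
    rw [cvec, hec, sub_self])
  have hεq : ∀ i j, q (ε i j) = c j (e i) := by
    intro i j
    have := (mem_mat _).1 hεX i j
    rw [Matrix.sub_apply, map_sub, sub_eq_zero] at this
    rw [this, Matrix.of_apply, hX]
  have vq : ∀ (v : Fin n → A') j, q ((Matrix.vecMul v ε) j) = c j (∑ i, q (v i) • e i) := by
    intro v j
    simp only [Matrix.vecMul, dotProduct, map_sum, map_mul, hεq, hc]
  let T : (Fin n → A') →ₗ[R] (Fin n → A') :=
    { toFun := fun v => Matrix.vecMul v ε
      map_add' := fun v w => Matrix.add_vecMul ε v w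
      map_smul' := fun r v => Matrix.smul_vecMul r v ε }
  have hTT : ∀ v, T (T v) = T v := fun v => by
    change Matrix.vecMul (Matrix.vecMul v ε) ε = Matrix.vecMul v ε
    rw [Matrix.vecMul_vecMul, hε]
  -- The image of the lifted idempotent is a direct summand of the free module, and the lifted
  -- generators e' map it isomorphically onto M'.
  let I : Submodule R (Fin n → A') := LinearMap.range T
  have hI : ∀ v ∈ I, T v = v := by
    rintro _ ⟨w, rfl⟩
    exact hTT w
  have hIc : PowComplete h I :=
    (hA.pi (ι := Fin n)).of_retract I.subtype T.rangeRestrict (fun v => Subtype.ext (hI v v.2))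
  let p : (Fin n → A') →ₗ[R] M' :=
    { toFun := fun v => ∑ i, v i • e' i
      map_add' := fun v w => by simp [add_smul, Finset.sum_add_distrib]
      map_smul' := fun r v => by simp [Finset.smul_sum, smul_assoc] }
  have hp : ∀ v, ρ (p v) = ∑ i, q (v i) • e i := by
    intro v
    change ρ (∑ i, v i • e' i) = _
    simp [hqρ, he']
  have hbij : Function.Bijective (p.comp I.subtype) := by
    refine bijective_of_mod hIc hM hM' _ (fun y => ?_) (fun v hv => ?_)
    · choose w hw using fun i => hq (c i (ρ y))
      refine ⟨⟨T w, w, rfl⟩, ?_⟩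
      rw [← hρ', map_sub, sub_eq_zero, LinearMap.comp_apply, Submodule.subtype_apply, hp]
      have : ∀ i, q (T w i) = c i (ρ y) := fun i => by
        change q ((Matrix.vecMul w ε) i) = _
        rw [vq]; simp only [hw, hec]
      simp only [this, hec]
    · rw [← hρ', LinearMap.comp_apply, Submodule.subtype_apply, hp] at hv
      have h0 : (v : Fin n → A') ∈ hpow h (Fin n → A') 1 := by
        refine (hpow_pi h).2 fun i => ?_
        rw [← hq', ← hI v v.2]
        change q ((Matrix.vecMul (v : Fin n → A') ε) i) = 0
        rw [vq, hv, map_zero]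
      -- The entries of v are divisible by h in A'. Since T fixes v, v = h T w, so v is divisible
      -- inside the summand itself.
      obtain ⟨w, hw⟩ := (mem_hpow_one h).1 h0
      refine (mem_hpow_one h).2 ⟨⟨T w, w, rfl⟩, Subtype.ext ?_⟩
      change (v : Fin n → A') = h • T w
      rw [← map_smul, ← hw, hI v v.2]
  let g : I ≃ₗ[R] M' := LinearEquiv.ofBijective _ hbij
  have hg : ∀ m, p (g.symm m) = m := fun m => g.apply_symm_apply m
  refine ⟨n, e', fun i => ((LinearMap.proj i).comp (I.subtype.comp g.symm.toLinearMap)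
    ).toAddMonoidHom, fun i a m => ?_, fun m => hg m⟩
  -- The summand and g were built over R only, so linearity over A' is checked by hand: left
  -- multiplication commutes with multiplication by the matrix on the right.
  have haI : a • ((g.symm m : I) : Fin n → A') ∈ I := by
    refine ⟨a • ((g.symm m : I) : Fin n → A'), ?_⟩
    have := hI _ (g.symm m).2
    change Matrix.vecMul (a • ((g.symm m : I) : Fin n → A')) ε = _
    rw [Matrix.smul_vecMul]
    exact congrArg (a • ·) this
  have : g.symm (a • m) = ⟨_, haI⟩ := by
    rw [LinearEquiv.symm_apply_eq]
    change a • m = p (a • ((g.symm m : I) : Fin n → A'))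
    conv_lhs => rw [← hg m]
    change a • ∑ i, _ • e' i = ∑ i, _ • e' i
    rw [Finset.smul_sum]
    exact Finset.sum_congr rfl fun i _ => by rw [Pi.smul_apply, smul_assoc]
  change ((g.symm (a • m) : I) : Fin n → A') i = a * ((g.symm m : I) : Fin n → A') i
  rw [this]
  rfl

end Lift


/-! ### Ext groups via syzygies -/

section Syzygy

open Abelian

variable {C : Type*} [Category C] [Abelian C] [HasExt.{v} C]

/-- Iterated dimension shifting: the iterated extension class `η ∈ Extⁿ(K₀, Kₙ)` of a sequence of
syzygies. -/
theorem exists_iterated_extClass (K F : ℕ → C) (i : ∀ n, K (n + 1) ⟶ F n) (p : ∀ n, F n ⟶ K n)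
    (w : ∀ n, i n ≫ p n = 0) (hS : ∀ n, (ShortComplex.mk _ _ (w n)).ShortExact)
    (hproj : ∀ n, Projective (F n)) (n : ℕ) :
    ∃ η : Ext.{v} (K 0) (K n) n, ∀ (Y : C),
      (∀ (m s : ℕ) (hs : n + m = s) (x : Ext.{v} (K 0) Y s),
        ∃ y : Ext.{v} (K n) Y m, η.comp y hs = x) ∧
      (∀ (m s : ℕ) (hs : n + (m + 1) = s) (y : Ext.{v} (K n) Y (m + 1)),
        η.comp y hs = 0 → y = 0) ∧
      (∀ f : K n ⟶ Y, η.comp (Ext.mk₀ f) (add_zero n) = 0 ↔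
        match n, f with
        | 0, f => f = 0
        | n + 1, f => ∃ g : F n ⟶ Y, i n ≫ g = f) := by
  induction n with
  | zero =>
    refine ⟨Ext.mk₀ (𝟙 _), fun Y => ⟨fun m s hs x => ?_, fun m s hs y hy => ?_, fun f => ?_⟩⟩
    · obtain rfl : m = s := by omega
      exact ⟨x, by simp⟩
    · obtain rfl : m + 1 = s := by omega
      simpa using hy
    · simp
  | succ n ih =>
    obtain ⟨η, hη⟩ := ih
    -- The new class is the old one composed with the class of 0 → K (n+1) → F n → K n. The three
    -- properties say that composition with η is surjective in all degrees, injective in positive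
    -- degrees, and kills in degree 0 exactly the maps that extend to the preceding free term.
    refine ⟨η.comp (hS n).extClass rfl, fun Y => ?_⟩
    obtain ⟨h1, h2, -⟩ := hη Y
    have ass : ∀ (m s : ℕ) (hs : n + 1 + m = s) (y : Ext.{v} (K (n + 1)) Y m),
        (η.comp (hS n).extClass rfl).comp y hs =
          η.comp ((hS n).extClass.comp y (add_comm 1 m)) (by omega) :=
      fun m s hs y => Ext.comp_assoc _ _ _ _ _ (by omega)
    refine ⟨fun m s hs x => ?_, fun m s hs y hy => ?_, fun f => ?_⟩
    · obtain ⟨y, rfl⟩ := h1 (m + 1) s (by omega) x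
      obtain ⟨z, rfl⟩ := Ext.contravariant_sequence_exact₃ (hS n) Y y
        (by have := hproj n; exact Ext.eq_zero_of_projective _) (add_comm 1 m)
      exact ⟨z, ass _ _ _ _⟩
    · rw [ass] at hy
      obtain ⟨z, rfl⟩ := Ext.contravariant_sequence_exact₁ (hS n) Y y _ (h2 _ _ _ _ hy)
      have := hproj n
      rw [Ext.eq_zero_of_projective (P := F n) z, Ext.comp_zero]
    · change _ ↔ ∃ g : F n ⟶ Y, i n ≫ g = f
      rw [ass]
      constructor
      · intro hy
        obtain ⟨z, hz⟩ := Ext.contravariant_sequence_exact₁ (hS n) Y _ _ (h2 0 _ _ _ hy)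
        obtain ⟨g, rfl⟩ := (Ext.mk₀_bijective _ _).2 z
        rw [Ext.mk₀_comp_mk₀] at hz
        exact ⟨g, (Ext.mk₀_bijective _ _).1 hz⟩
      · rintro ⟨g, rfl⟩
        have h0 : (hS n).extClass.comp (Ext.mk₀ (i n ≫ g)) (add_comm 1 0) = 0 := by
          rw [← Ext.mk₀_comp_mk₀]
          exact (hS n).extClass_comp_assoc _
        rw [h0, Ext.comp_zero]

/-- `Extⁿ(K₀, S)` as a quotient of `Hom(Kₙ, S)`, where `Kₙ` is the `n`-th syzygy of `K₀`. -/
theorem exists_syzygy_hom {S : Type u} [Ring S] (K : ℕ → ModuleCat.{u} S) (r : ℕ → ℕ)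
    (p : ∀ n, (Fin (r n) → S) →ₗ[S] K n) (i : ∀ n, K (n + 1) →ₗ[S] (Fin (r n) → S))
    (hi : ∀ n, Function.Injective (i n)) (hp : ∀ n, Function.Surjective (p n))
    (hip : ∀ n, Function.Exact (i n) (p n)) (n : ℕ) :
    ∃ E : (K n →ₗ[S] S) →+ ExtRing (K 0) n, Function.Surjective E ∧
      (∀ (s : S) (f : K n →ₗ[S] S),
        E ((LinearMap.toSpanSingleton S S s).comp f) = (op s : Sᵐᵒᵖ) • E f) ∧
      ∀ f : K n →ₗ[S] S, E f = 0 ↔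
        match n, f with
        | 0, f => f = 0
        | n + 1, f => ∃ g : (Fin (r n) → S) →ₗ[S] S, g.comp (i n) = f := by
  obtain ⟨η, hη⟩ := exists_iterated_extClass K (fun n => ModuleCat.of S (Fin (r n) → S))
    (fun n => ModuleCat.ofHom (i n)) (fun n => ModuleCat.ofHom (p n))
    (fun n => by ext x; exact (hip n).apply_apply_eq_zero x)
    (fun n => ModuleCat.shortComplex_shortExact _ (hip n) (hi n) (hp n))
    (fun n => ModuleCat.projective_of_free (Pi.basisFun S (Fin (r n)))) n
  obtain ⟨h1, -, h3⟩ := hη (ModuleCat.of S S)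
  refine ⟨{ toFun := fun f => η.comp (Ext.mk₀ (ModuleCat.ofHom f)) (add_zero n)
            map_zero' := ?_, map_add' := fun f g => ?_ }, fun x => ?_, fun s f => ?_, fun f => ?_⟩
  · have : ModuleCat.ofHom (0 : K n →ₗ[S] S) = 0 := rfl
    rw [this, Ext.mk₀_zero, Ext.comp_zero]
    rfl
  · have : ModuleCat.ofHom (f + g) = ModuleCat.ofHom f + ModuleCat.ofHom g := rfl
    rw [this, Ext.mk₀_add, Ext.comp_add]
    rfl
  · obtain ⟨y, hy⟩ := h1 0 n (add_zero n) x
    obtain ⟨f, rfl⟩ := (Ext.mk₀_bijective _ _).2 y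
    exact ⟨f.hom, hy⟩
  · have : ModuleCat.ofHom ((LinearMap.toSpanSingleton S S s).comp f) =
      ModuleCat.ofHom f ≫ rightMul s := rfl
    change η.comp (Ext.mk₀ (ModuleCat.ofHom ((LinearMap.toSpanSingleton S S s).comp f)))
        (add_zero n) =
      (η.comp (Ext.mk₀ (ModuleCat.ofHom f)) (add_zero n)).comp (Ext.mk₀ (rightMul s)) (add_zero n)
    rw [this, ← Ext.mk₀_comp_mk₀, Ext.comp_assoc_of_third_deg_zero]
  · refine (h3 (ModuleCat.ofHom f)).trans ?_
    cases n with
    | zero => exact ⟨fun h0 => congrArg ModuleCat.Hom.hom h0, fun h0 => by rw [h0]; rfl⟩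
    | succ n =>
      exact ⟨fun ⟨g, hg⟩ => ⟨g.hom, congrArg ModuleCat.Hom.hom hg⟩,
        fun ⟨g, hg⟩ => ⟨ModuleCat.ofHom g, by rw [← ModuleCat.ofHom_comp, hg]⟩⟩

end Syzygy


/-! ### Reduction of modules modulo `h`, and of their Ext groups -/

/-- Division by h^n is unique in N, so a map with values in h^n N is h^n times a linear map. The
topology is thus uniform convergence, and pointwise sums of series are linear and are limits. No
finiteness of K is involved. -/
theorem PowComplete.linearMap {R : Type*} [CommRing R] {h : R} {S K N : Type*} [Ring S]
    [AddCommGroup K] [Module S K] [AddCommGroup N] [Module S N] [Module R N] [SMulCommClass S R N]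
    (hN : PowComplete h N) (hN' : TorsFree h N) : PowComplete h (K →ₗ[S] N) := by
  have mem : ∀ (n : ℕ) (f : K →ₗ[S] N), (∀ x, f x ∈ hpow h N n) → f ∈ hpow h (K →ₗ[S] N) n := by
    intro n f hf
    choose z hz using fun x => (mem_hpow h).1 (hf x)
    refine (mem_hpow h).2 ⟨{ toFun := z, map_add' := fun x y => ?_, map_smul' := fun s x => ?_ },
      LinearMap.ext hz⟩
    · exact hN'.pow_inj n (by rw [smul_add, ← hz, ← hz, ← hz, map_add])
    · exact hN'.pow_inj n (by rw [← hz, map_smul, hz, RingHom.id_apply, smul_comm])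
  have ev : ∀ {n : ℕ} {f : K →ₗ[S] N}, f ∈ hpow h (K →ₗ[S] N) n → ∀ x, f x ∈ hpow h N n := by
    intro n f hf x
    obtain ⟨g, rfl⟩ := (mem_hpow h).1 hf
    exact smul_mem_hpow h n (g x)
  refine ⟨fun f hf => LinearMap.ext fun x => hN.sep _ fun n => ev (hf n) x, fun y => ?_⟩
  choose L hL using fun x => hN.exists_sum (fun i => y i x)
  refine ⟨{ toFun := L, map_add' := fun x x' => hN.sep.eq fun n => ?_,
            map_smul' := fun s x => hN.sep.eq fun n => ?_ }, fun n => mem n _ fun x => ?_⟩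
  · have := sub_mem (hL (x + x') n) (add_mem (hL x n) (hL x' n))
    simp only [map_add, smul_add, Finset.sum_add_distrib] at this
    convert this using 1
    abel
  · have h1 := hL (s • x) n
    obtain ⟨z, hz⟩ := (mem_hpow h).1 (hL x n)
    have h2 : s • (L x - ∑ i ∈ Finset.range n, h ^ i • y i x) ∈ hpow h N n := by
      rw [hz, smul_comm]
      exact smul_mem_hpow h n _
    have := sub_mem h1 h2
    simp only [map_smul, smul_sub, Finset.smul_sum, smul_comm s, sub_sub_sub_cancel_right] at this
    exact this
  · simpa using hL x n

/-- `q : S' → S` is the reduction modulo `h` of a complete ring without `h`-torsion. -/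
structure IsReduction {R : Type*} [CommRing R] (h : R) {S' S : Type*} [Ring S'] [Ring S]
    [Algebra R S'] (q : S' →+* S) : Prop where
  surjective : Function.Surjective q
  ker : ∀ a, q a = 0 ↔ a ∈ hpow h S' 1
  complete : PowComplete h S'
  tors : TorsFree h S'

/-- `ρ : K' → K` is the reduction modulo `h` of a separated module without `h`-torsion. -/
structure IsRed {R : Type*} [CommRing R] (h : R) {S' S : Type*} [Ring S'] [Ring S]
    [Algebra R S'] (q : S' →+* S) {K' K : Type*} [AddCommGroup K'] [AddCommGroup K] [Module S' K']
    [Module S K] [Module R K'] (ρ : K' →+ K) : Prop where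
  smul : ∀ a x, ρ (a • x) = q a • ρ x
  surjective : Function.Surjective ρ
  ker : ∀ x, ρ x = 0 ↔ x ∈ hpow h K' 1
  sep : PowSep h K'
  tors : TorsFree h K'

section

variable {R : Type*} [CommRing R] {h : R} {S' S : Type*} [Ring S'] [Ring S]
  [Algebra R S'] {q : S' →+* S} {K' K : Type*} [AddCommGroup K'] [AddCommGroup K] [Module S' K']
  [Module S K] [Module R K'] [IsScalarTower R S' K'] {ρ : K' →+ K}

namespace IsRed

theorem red_aux (hρ : IsRed h q ρ) (hq : IsReduction h q) (f : K' →ₗ[S'] S') :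
    ∃ g : K →ₗ[S] S, ∀ x, g (ρ x) = q (f x) := by
  have wd : ∀ x y, ρ x = ρ y → q (f x) = q (f y) := by
    intro x y hxy
    rw [← sub_eq_zero, ← map_sub, hρ.ker] at hxy
    rw [← sub_eq_zero, ← map_sub, ← map_sub, hq.ker]
    exact map_mem_hpow h (f.restrictScalars R) hxy
  choose s hs using hρ.surjective
  refine ⟨{ toFun := fun y => q (f (s y)), map_add' := fun y z => ?_,
            map_smul' := fun a y => ?_ }, fun x => wd _ _ (hs _)⟩
  · rw [← map_add, ← map_add]
    exact wd _ _ (by rw [map_add, hs, hs, hs])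
  · obtain ⟨a, rfl⟩ := hq.surjective a
    rw [RingHom.id_apply, smul_eq_mul, ← map_mul, ← smul_eq_mul, ← map_smul]
    exact wd _ _ (by rw [hρ.smul, hs, hs])

theorem hom_ext' (hρ : Function.Surjective ρ) {N : Type*} [AddCommGroup N] [Module S N]
    {f g : K →ₗ[S] N} (hfg : ∀ x, f (ρ x) = g (ρ x)) : f = g :=
  LinearMap.ext fun y => by
    obtain ⟨x, rfl⟩ := hρ y
    exact hfg x

variable (hρ : IsRed h q ρ) (hq : IsReduction h q)

/-- The reduction of a linear form. -/
def red : (K' →ₗ[S'] S') →+ (K →ₗ[S] S) where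
  toFun f := (hρ.red_aux hq f).choose
  map_zero' := hom_ext' hρ.surjective fun x => by rw [(hρ.red_aux hq 0).choose_spec]; simp
  map_add' f g := hom_ext' hρ.surjective fun x => by
    rw [(hρ.red_aux hq (f + g)).choose_spec, LinearMap.add_apply, LinearMap.add_apply,
      (hρ.red_aux hq f).choose_spec, (hρ.red_aux hq g).choose_spec, map_add]

theorem red_apply (f : K' →ₗ[S'] S') (x : K') : hρ.red hq f (ρ x) = q (f x) :=
  (hρ.red_aux hq f).choose_spec x

/-- A form with values in hS' can be divided by h, and the quotient is linear because S' has no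
h-torsion. -/
theorem red_eq_zero_iff (f : K' →ₗ[S'] S') :
    hρ.red hq f = 0 ↔ ∃ g : K' →ₗ[S'] S', f = h • g := by
  constructor
  · intro hf
    have : ∀ x, ∃ z, f x = h • z := fun x => by
      refine (mem_hpow_one h).1 ?_
      rw [← hq.ker, ← hρ.red_apply hq, hf, LinearMap.zero_apply]
    choose z hz using this
    refine ⟨{ toFun := z, map_add' := fun x y => ?_, map_smul' := fun s x => ?_ },
      LinearMap.ext hz⟩
    · exact hq.tors.inj (by rw [smul_add, ← hz, ← hz, ← hz, map_add])
    · exact hq.tors.inj (by rw [← hz, map_smul, hz, RingHom.id_apply, smul_comm])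
  · rintro ⟨g, rfl⟩
    refine hom_ext' hρ.surjective fun x => ?_
    rw [hρ.red_apply, LinearMap.zero_apply, hq.ker]
    exact smul_mem_hpow_one h _

end IsRed

/-- The reduction of a free module. -/
def freeRed (q : S' →+* S) (n : ℕ) : (Fin n → S') →+ (Fin n → S) where
  toFun v i := q (v i)
  map_zero' := funext fun _ => map_zero q
  map_add' _ _ := funext fun _ => map_add q _ _

theorem isRed_freeRed (hq : IsReduction h q) (n : ℕ) : IsRed h q (freeRed q n) where
  smul a x := funext fun i => map_mul q _ _
  surjective y := by
    choose x hx using fun i => hq.surjective (y i)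
    exact ⟨x, funext hx⟩
  ker x := by
    rw [hpow_pi, funext_iff]
    exact forall_congr' fun i => hq.ker _
  sep := hq.complete.sep.pi
  tors := hq.tors.pi

omit [IsScalarTower R S' K'] in
theorem linearCombination_freeRed (hρ : IsRed h q ρ) {n : ℕ} (f : (Fin n → S) →ₗ[S] K)
    (z : Fin n → K') (hz : ∀ i, ρ (z i) = f (Pi.single i 1)) (v : Fin n → S') :
    ρ (Fintype.linearCombination S' z v) = f (freeRed q n v) := by
  rw [Fintype.linearCombination_apply, map_sum]
  have e2 : freeRed q n v = ∑ i, q (v i) • (Pi.single i 1 : Fin n → S) := by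
    rw [← Fintype.linearCombination_apply S]
    ext j
    simp [Fintype.linearCombination_apply, Pi.single_apply, freeRed]
  rw [e2, map_sum]
  exact Finset.sum_congr rfl fun i _ => by rw [f.map_smul, ← hz, hρ.smul]

theorem isRed_self (hq : IsReduction h q) : IsRed h q (q : S' →+ S) where
  smul a x := map_mul q a x
  surjective := hq.surjective
  ker := hq.ker
  sep := hq.complete.sep
  tors := hq.tors

theorem free_red_surjective (hq : IsReduction h q) {n : ℕ} (g : (Fin n → S) →ₗ[S] S) :
    ∃ f : (Fin n → S') →ₗ[S'] S', (isRed_freeRed hq n).red hq f = g := by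
  choose z hz using fun i => hq.surjective (g (Pi.single i 1))
  refine ⟨Fintype.linearCombination S' z,
    IsRed.hom_ext' (isRed_freeRed hq n).surjective fun x => ?_⟩
  rw [IsRed.red_apply]
  exact linearCombination_freeRed (isRed_self hq) g z hz x

/-- Nakayama in its complete form: lifts of generators of K generate K', since the free module is
complete and K' is separated. -/
theorem IsRed.exists_cover (hρ : IsRed h q ρ) (hq : IsReduction h q) [Module.Finite S K] :
    ∃ (n : ℕ) (p' : (Fin n → S') →ₗ[S'] K') (p : (Fin n → S) →ₗ[S] K),
      Function.Surjective p' ∧ Function.Surjective p ∧ ∀ v, ρ (p' v) = p (freeRed q n v) := by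
  obtain ⟨n, p, hp⟩ := Module.Finite.exists_fin' S K
  choose z hz using fun i => hρ.surjective (p (Pi.single i 1))
  have hpz := linearCombination_freeRed hρ p z hz
  refine ⟨n, Fintype.linearCombination S' z, p, ?_, hp, hpz⟩
  refine surjective_of_mod (R := R) (hq.complete.pi (ι := Fin n)) hρ.sep
    ((Fintype.linearCombination S' z).restrictScalars R) fun y => ?_
  obtain ⟨v, hv⟩ := hp (ρ y)
  obtain ⟨w, rfl⟩ := (isRed_freeRed hq n).surjective v
  refine ⟨w, ?_⟩
  rw [← hρ.ker, map_sub, sub_eq_zero, ← hv]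
  exact (hpz w).symm

end

/-! ### Resolutions compatible with reduction, and the Ext groups computed from them -/

/-- A resolution of a module by finitely generated free modules, with its syzygies `K'`, and their
reductions modulo `h`. -/
structure RedResolution {R : Type v} [CommRing R] (h : R) {S' S : Type u} [Ring S'] [Ring S]
    [Algebra R S'] (q : S' →+* S) where
  K' : ℕ → Type u
  K : ℕ → Type u
  [addCommGroup' : ∀ n, AddCommGroup (K' n)]
  [addCommGroup : ∀ n, AddCommGroup (K n)]
  [module' : ∀ n, Module S' (K' n)]
  [module : ∀ n, Module S (K n)]
  [moduleR : ∀ n, Module R (K' n)]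
  [tower : ∀ n, IsScalarTower R S' (K' n)]
  ρ : ∀ n, K' n →+ K n
  isRed : ∀ n, IsRed h q (ρ n)
  rank : ℕ → ℕ
  -- The free module of rank `rank n` contains the n-th syzygy, and for n ≥ 1 it covers the
  -- preceding one. Rank 0 at n = 0 makes the boundaries trivial there, so that one formula
  -- describes Ext in every degree.
  rank_zero : rank 0 = 0
  i' : ∀ n, K' n →ₗ[S'] (Fin (rank n) → S')
  i : ∀ n, K n →ₗ[S] (Fin (rank n) → S)
  p' : ∀ n, (Fin (rank (n + 1)) → S') →ₗ[S'] K' n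
  p : ∀ n, (Fin (rank (n + 1)) → S) →ₗ[S] K n
  ρ_i' : ∀ n x, freeRed q _ (i' n x) = i n (ρ n x)
  ρ_p' : ∀ n x, ρ n (p' n x) = p n (freeRed q _ x)
  injective' : ∀ n, Function.Injective (i' (n + 1))
  injective : ∀ n, Function.Injective (i (n + 1))
  surjective' : ∀ n, Function.Surjective (p' n)
  surjective : ∀ n, Function.Surjective (p n)
  exact' : ∀ n, Function.Exact (i' (n + 1)) (p' n)
  exact : ∀ n, Function.Exact (i (n + 1)) (p n)

/-- A linear map that vanishes on the kernel of a surjection factors through it. -/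
theorem exists_factor {S M N Q : Type*} [Ring S] [AddCommGroup M] [AddCommGroup N] [AddCommGroup Q]
    [Module S M] [Module S N] [Module S Q] (p : M →ₗ[S] N) (hp : Function.Surjective p)
    (f : M →ₗ[S] Q) (hf : ∀ x, p x = 0 → f x = 0) : ∃ g : N →ₗ[S] Q, g.comp p = f := by
  have : LinearMap.ker p ≤ LinearMap.ker f := fun x hx => hf x hx
  refine ⟨((LinearMap.ker p).liftQ f this).comp (p.quotKerEquivOfSurjective hp).symm.toLinearMap,
    LinearMap.ext fun x => ?_⟩
  have : (p.quotKerEquivOfSurjective hp).symm (p x) = Submodule.Quotient.mk x := by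
    rw [LinearEquiv.symm_apply_eq]
    rfl
  simp [this]

namespace RedResolution

attribute [instance] addCommGroup' addCommGroup module' module moduleR tower

variable {R : Type v} [CommRing R] {h : R} {S' S : Type u} [Ring S'] [Ring S]
  [Algebra R S'] {q : S' →+* S} (X : RedResolution h q) (hq : IsReduction h q)

theorem red_comp_i' (n : ℕ) (g : (Fin (X.rank n) → S') →ₗ[S'] S') :
    (X.isRed n).red hq (g.comp (X.i' n)) = ((isRed_freeRed hq _).red hq g).comp (X.i n) := by
  refine IsRed.hom_ext' (X.isRed n).surjective fun x => ?_
  rw [IsRed.red_apply, LinearMap.comp_apply, LinearMap.comp_apply, ← X.ρ_i', IsRed.red_apply]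

theorem red_comp_p' (n : ℕ) (f : X.K' n →ₗ[S'] S') :
    (isRed_freeRed hq _).red hq (f.comp (X.p' n)) = ((X.isRed n).red hq f).comp (X.p n) := by
  refine IsRed.hom_ext' (isRed_freeRed hq _).surjective fun x => ?_
  rw [IsRed.red_apply, LinearMap.comp_apply, LinearMap.comp_apply, ← X.ρ_p', IsRed.red_apply]

theorem i'_zero (x) : X.i' 0 x = 0 := funext fun j => by
  rw [X.rank_zero] at j
  exact j.elim0

theorem i_zero (x) : X.i 0 x = 0 := funext fun j => by
  rw [X.rank_zero] at j
  exact j.elim0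

theorem exists_ext_hom' (n : ℕ) :
    ∃ E : (X.K' n →ₗ[S'] S') →+ ExtRing (ModuleCat.of S' (X.K' 0)) n,
      Function.Surjective E ∧
      (∀ (s : S') (f), E ((LinearMap.toSpanSingleton S' S' s).comp f) = (op s : S'ᵐᵒᵖ) • E f) ∧
      ∀ f, E f = 0 ↔ ∃ g : (Fin (X.rank n) → S') →ₗ[S'] S', f = g.comp (X.i' n) := by
  obtain ⟨E, h1, h2, h3⟩ := exists_syzygy_hom (fun n => ModuleCat.of S' (X.K' n))
    (fun n => X.rank (n + 1)) X.p' (fun n => X.i' (n + 1)) X.injective' X.surjective' X.exact' n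
  refine ⟨E, h1, h2, fun f => (h3 f).trans ?_⟩
  cases n with
  | zero =>
    exact ⟨fun h0 => ⟨0, h0⟩, fun ⟨g, hg⟩ => hg.trans (LinearMap.ext fun x => by
      rw [LinearMap.comp_apply, X.i'_zero, map_zero, LinearMap.zero_apply])⟩
  | succ n => exact exists_congr fun g => eq_comm

theorem exists_ext_hom (n : ℕ) :
    ∃ E : (X.K n →ₗ[S] S) →+ ExtRing (ModuleCat.of S (X.K 0)) n,
      Function.Surjective E ∧
      (∀ (s : S) (f), E ((LinearMap.toSpanSingleton S S s).comp f) = (op s : Sᵐᵒᵖ) • E f) ∧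
      ∀ f, E f = 0 ↔ ∃ g : (Fin (X.rank n) → S) →ₗ[S] S, f = g.comp (X.i n) := by
  obtain ⟨E, h1, h2, h3⟩ := exists_syzygy_hom (fun n => ModuleCat.of S (X.K n))
    (fun n => X.rank (n + 1)) X.p (fun n => X.i (n + 1)) X.injective X.surjective X.exact n
  refine ⟨E, h1, h2, fun f => (h3 f).trans ?_⟩
  cases n with
  | zero =>
    exact ⟨fun h0 => ⟨0, h0⟩, fun ⟨g, hg⟩ => hg.trans (LinearMap.ext fun x => by
      rw [LinearMap.comp_apply, X.i_zero, map_zero, LinearMap.zero_apply])⟩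
  | succ n => exact exists_congr fun g => eq_comm

theorem exists_extension (n : ℕ) (H : Subsingleton (ExtRing (ModuleCat.of S (X.K 0)) n))
    (f : X.K n →ₗ[S] S) : ∃ g : (Fin (X.rank n) → S) →ₗ[S] S, f = g.comp (X.i n) := by
  obtain ⟨E, -, -, h3⟩ := X.exists_ext_hom n
  exact (h3 f).1 (Subsingleton.elim _ _)

/-- Composition with `i'`. -/
def bdry (n : ℕ) : ((Fin (X.rank n) → S') →ₗ[S'] S') →ₗ[R] (X.K' n →ₗ[S'] S') where
  toFun g := g.comp (X.i' n)
  map_add' _ _ := LinearMap.add_comp _ _ _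
  map_smul' _ _ := LinearMap.smul_comp _ _ _

theorem bdry_apply (n : ℕ) (g x) : X.bdry n g x = g (X.i' n x) := rfl

include hq

/-- An extension of the reduced form to the free module lifts, and f minus its restriction reduces
to 0, hence is divisible by h. This is the approximation step for writing f as a boundary. -/
theorem bdry_step (n : ℕ) (f : X.K' n →ₗ[S'] S')
    (hf : ∃ g : (Fin (X.rank n) → S) →ₗ[S] S, (X.isRed n).red hq f = g.comp (X.i n)) :
    ∃ g f', f = X.bdry n g + h • f' := by
  obtain ⟨g, hg⟩ := hf
  obtain ⟨g, rfl⟩ := free_red_surjective hq g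
  rw [← red_comp_i', ← sub_eq_zero, ← map_sub, IsRed.red_eq_zero_iff] at hg
  obtain ⟨f', hf'⟩ := hg
  exact ⟨g, f', by rw [← hf']; exact (add_sub_cancel _ _).symm⟩

/-- Vanishing of Ext in degree n passes from S to S': `bdry_step` is available for every form and
can be iterated. -/
theorem exists_extension' (n : ℕ) (H : Subsingleton (ExtRing (ModuleCat.of S (X.K 0)) n))
    (f : X.K' n →ₗ[S'] S') : ∃ g, X.bdry n g = f :=
  exists_eq_of_step (hq.complete.linearMap hq.tors) (hq.complete.linearMap hq.tors).sep (X.bdry n)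
    (fun _ => True)
    (fun y _ => by
      obtain ⟨g, f', e⟩ := X.bdry_step hq n y (X.exists_extension n H _)
      exact ⟨g, f', trivial, e⟩) f trivial

/-- Torsion in degree n + 1 comes from Ext in degree n of the reduction, as in the Bockstein
sequence. If h f = g ∘ i', the reduction of g vanishes on the syzygy, so it descends to the syzygy
one step lower; there it extends to the free module because Ext in degree n vanishes. Lifting that
extension changes g, without changing g ∘ i', into a multiple of h. -/
theorem bdry_tors (n : ℕ)
    (H : ∀ m, m ≠ n → Subsingleton (ExtRing (ModuleCat.of S (X.K 0)) m))
    (f : X.K' n →ₗ[S'] S') (hf : ∃ g, X.bdry n g = h • f) : ∃ g, X.bdry n g = f := by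
  obtain ⟨g, hg⟩ := hf
  cases n with
  | zero =>
    refine ⟨0, LinearMap.ext fun x => ?_⟩
    have h1 := LinearMap.congr_fun hg x
    rw [bdry_apply, i'_zero, map_zero] at h1
    rw [map_zero, LinearMap.zero_apply]
    exact (hq.tors _ h1.symm).symm
  | succ n =>
    have h1 : ((isRed_freeRed hq _).red hq g).comp (X.i (n + 1)) = 0 := by
      rw [← red_comp_i', IsRed.red_eq_zero_iff]
      exact ⟨f, hg⟩
    obtain ⟨k, hk⟩ := exists_factor (X.p n) (X.surjective n) ((isRed_freeRed hq _).red hq g)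
      fun x hx => by
        obtain ⟨y, rfl⟩ := (X.exact n x).1 hx
        exact LinearMap.congr_fun h1 y
    obtain ⟨l, rfl⟩ := X.exists_extension n (H n (by omega)) k
    obtain ⟨l, rfl⟩ := free_red_surjective hq l
    rw [← red_comp_i', ← red_comp_p', ← sub_eq_zero, ← map_sub, IsRed.red_eq_zero_iff] at hk
    obtain ⟨m, hm⟩ := hk
    -- In `hm` the lifted extension comes first and g is subtracted from it, whence the sign.
    refine ⟨-m, LinearMap.ext fun x => hq.tors.inj ?_⟩
    have h2 := LinearMap.congr_fun hg x
    have h3 := LinearMap.congr_fun hm (X.i' (n + 1) x)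
    rw [LinearMap.sub_apply, LinearMap.comp_apply, (X.exact' n).apply_apply_eq_zero, map_zero,
      zero_sub, neg_eq_iff_eq_neg] at h3
    rw [bdry_apply] at h2 ⊢
    rw [LinearMap.neg_apply, smul_neg]
    exact h3.symm.trans h2

/-- Lift f ∘ p to a form g on the free cover. On the next syzygy g equals h w, and w extends to a
form l because Ext in degree n + 1 vanishes. Then g - h l has the same reduction as g and descends
to K'. -/
theorem red_surjective (n : ℕ) (H : Subsingleton (ExtRing (ModuleCat.of S (X.K 0)) (n + 1)))
    (f : X.K n →ₗ[S] S) : ∃ f', (X.isRed n).red hq f' = f := by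
  obtain ⟨g, hg⟩ := free_red_surjective hq (f.comp (X.p n))
  have h1 : (X.isRed (n + 1)).red hq (X.bdry (n + 1) g) = 0 := by
    refine (X.red_comp_i' hq (n + 1) g).trans (LinearMap.ext fun x => ?_)
    rw [hg, LinearMap.comp_apply, LinearMap.comp_apply, (X.exact n).apply_apply_eq_zero, map_zero,
      LinearMap.zero_apply]
  obtain ⟨w, hw⟩ := (IsRed.red_eq_zero_iff _ hq _).1 h1
  obtain ⟨l, rfl⟩ := X.exists_extension' hq (n + 1) H w
  rw [← map_smul, ← sub_eq_zero, ← map_sub] at hw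
  obtain ⟨k, hk⟩ := exists_factor (X.p' n) (X.surjective' n) (g - h • l) fun x hx => by
    obtain ⟨y, rfl⟩ := (X.exact' n x).1 hx
    exact LinearMap.congr_fun hw y
  have h2 : ((X.isRed n).red hq k).comp (X.p n) = f.comp (X.p n) := by
    rw [← red_comp_p', hk, map_sub, hg, sub_eq_self, IsRed.red_eq_zero_iff]
    exact ⟨l, rfl⟩
  refine ⟨k, LinearMap.ext fun x => ?_⟩
  obtain ⟨y, rfl⟩ := X.surjective n x
  exact LinearMap.congr_fun h2 y

/-- If `Ext` of the reduction is concentrated in one degree `n`, then `Extⁿ` is complete without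
`h`-torsion, and its reduction modulo `h` is `Extⁿ` of the reduction. -/
theorem ext_reduction (n : ℕ)
    (H : ∀ m, m ≠ n → Subsingleton (ExtRing (ModuleCat.of S (X.K 0)) m))
    [Module R (ExtRing (ModuleCat.of S' (X.K' 0)) n)]
    [IsScalarTower R S'ᵐᵒᵖ (ExtRing (ModuleCat.of S' (X.K' 0)) n)] :
    PowComplete h (ExtRing (ModuleCat.of S' (X.K' 0)) n) ∧
    TorsFree h (ExtRing (ModuleCat.of S' (X.K' 0)) n) ∧
    ∃ π : ExtRing (ModuleCat.of S' (X.K' 0)) n →+ ExtRing (ModuleCat.of S (X.K 0)) n,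
      Function.Surjective π ∧ (∀ x, π x = 0 ↔ x ∈ hpow h _ 1) ∧
      ∀ (s : S') (x), π ((op s : S'ᵐᵒᵖ) • x) = (op (q s) : Sᵐᵒᵖ) • π x := by
  obtain ⟨E', s', m', k'⟩ := X.exists_ext_hom' n
  obtain ⟨E, s, m, k⟩ := X.exists_ext_hom n
  have k' : ∀ f, E' f = 0 ↔ ∃ g, X.bdry n g = f := fun f =>
    (k' f).trans (exists_congr fun g => eq_comm)
  -- A scalar is central in S', so multiplying by it is a right multiplication, with which E' is
  -- compatible.
  have hr : ∀ (r : R) f, E' (r • f) = r • E' f := fun r f => by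
    have e1 : r • f = (LinearMap.toSpanSingleton S' S' (algebraMap R S' r)).comp f := by
      ext x
      simp [Algebra.smul_def, Algebra.commutes]
    have e2 : r • E' f = op (algebraMap R S' r) • E' f := by
      rw [← MulOpposite.algebraMap_apply, algebraMap_smul]
    rw [e1, m', e2]
  let L : (X.K' n →ₗ[S'] S') →ₗ[R] ExtRing (ModuleCat.of S' (X.K' 0)) n :=
    { E' with map_smul' := hr }
  have hh : ∀ f, E' (h • f) = h • E' f := hr h
  have tors : TorsFree h (ExtRing (ModuleCat.of S' (X.K' 0)) n) := by
    intro x hx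
    obtain ⟨f, rfl⟩ := s' x
    rw [← hh, k'] at hx
    exact (k' f).2 (X.bdry_tors hq n H f hx)
  have redB : ∀ f, E' f = 0 → E ((X.isRed n).red hq f) = 0 := by
    intro f hf
    obtain ⟨g, rfl⟩ := (k' f).1 hf
    exact (k _).2 ⟨_, X.red_comp_i' hq n g⟩
  -- This identifies the kernel of the reduction map on Ext with the multiples of h.
  have redh : ∀ f, E ((X.isRed n).red hq f) = 0 ↔ ∃ f', E' f = h • E' f' := by
    intro f
    constructor
    · intro hf
      obtain ⟨g, f', rfl⟩ := X.bdry_step hq n f ((k _).1 hf)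
      exact ⟨f', by rw [map_add, (k' _).2 ⟨g, rfl⟩, zero_add, hh]⟩
    · rintro ⟨f', hf'⟩
      rw [← hh, ← sub_eq_zero, ← map_sub] at hf'
      have := redB _ hf'
      rw [map_sub, (IsRed.red_eq_zero_iff _ hq (h • f')).2 ⟨f', rfl⟩, sub_zero] at this
      exact this
  refine ⟨(hq.complete.linearMap hq.tors).of_surjective L s' ?_, tors, ?_⟩
  · intro x hx
    obtain ⟨f, rfl⟩ := s' x
    rw [k']
    -- Separatedness of Ext: the invariant is that the class lies in every h^m Ext. Such an f is a
    -- boundary plus h f'', and since Ext has no torsion the class of f'' is again infinitely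
    -- divisible. In the limit f itself is a boundary.
    refine exists_eq_of_step (hq.complete.linearMap hq.tors) (hq.complete.linearMap hq.tors).sep
      (X.bdry n) (fun f => ∀ m, E' f ∈ hpow h _ m) (fun f hf => ?_) f hx
    obtain ⟨z, hz⟩ := (mem_hpow_one h).1 (hf 1)
    obtain ⟨f', rfl⟩ := s' z
    obtain ⟨g, f'', rfl⟩ := X.bdry_step hq n f ((k _).1 ((redh f).2 ⟨f', hz⟩))
    refine ⟨g, f'', fun m => ?_, rfl⟩
    have := hf (m + 1)
    rw [map_add, (k' _).2 ⟨g, rfl⟩, zero_add, hh] at this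
    obtain ⟨w, hw⟩ := (mem_hpow h).1 this
    rw [pow_succ', mul_smul] at hw
    rw [tors.inj hw]
    exact smul_mem_hpow h m w
  · have wd : ∀ f g, E' f = E' g →
        E ((X.isRed n).red hq f) = E ((X.isRed n).red hq g) := by
      intro f g hfg
      rw [← sub_eq_zero, ← map_sub] at hfg
      rw [← sub_eq_zero, ← map_sub, ← map_sub]
      exact redB _ hfg
    choose t ht using s'
    refine ⟨{ toFun := fun x => E ((X.isRed n).red hq (t x)), map_zero' := ?_,
              map_add' := fun x y => ?_ }, fun x => ?_, fun x => ?_, fun a x => ?_⟩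
    · exact redB _ (ht 0)
    · rw [← map_add, ← map_add]
      exact wd _ _ (by rw [map_add, ht, ht, ht])
    · obtain ⟨f, rfl⟩ := s x
      obtain ⟨f, rfl⟩ := X.red_surjective hq n (H _ (by omega)) f
      exact ⟨E' f, wd _ _ (ht _)⟩
    · refine (redh (t x)).trans ?_
      rw [mem_hpow_one, ht]
      exact ⟨fun ⟨f', e⟩ => ⟨_, e⟩, fun ⟨z, e⟩ => ⟨t z, by rw [ht]; exact e⟩⟩
    · change E ((X.isRed n).red hq (t (op a • x))) = op (q a) • E ((X.isRed n).red hq (t x))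
      have e1 : E' (t (op a • x)) = E' ((LinearMap.toSpanSingleton S' S' a).comp (t x)) := by
        rw [m', ht, ht]
      rw [wd _ _ e1, ← m]
      refine congrArg E (IsRed.hom_ext' (X.isRed n).surjective fun y => ?_)
      rw [IsRed.red_apply, LinearMap.comp_apply, LinearMap.comp_apply, IsRed.red_apply]
      simp

end RedResolution


/-! ### Construction of the resolution by iterated syzygies -/

/-- A module over `S'` with a map to a free module, and its reduction modulo `h`. -/
structure RedPair {R : Type v} [CommRing R] (h : R) {S' S : Type u} [Ring S'] [Ring S]
    [Algebra R S'] (q : S' →+* S) where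
  K' : Type u
  K : Type u
  [addCommGroup' : AddCommGroup K']
  [addCommGroup : AddCommGroup K]
  [module' : Module S' K']
  [module : Module S K]
  [moduleR : Module R K']
  [tower : IsScalarTower R S' K']
  ρ : K' →+ K
  isRed : IsRed h q ρ
  finite : Module.Finite S K
  rank : ℕ
  i' : K' →ₗ[S'] (Fin rank → S')
  i : K →ₗ[S] (Fin rank → S)
  ρ_i' : ∀ x, freeRed q _ (i' x) = i (ρ x)

namespace RedPair

attribute [instance] addCommGroup' addCommGroup module' module moduleR tower

variable {R : Type v} [CommRing R] {h : R} {S' S : Type u} [Ring S'] [Ring S]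
  [Algebra R S'] {q : S' →+* S} (X : RedPair h q) (hq : IsReduction h q)

include hq in
theorem exists_cover : ∃ (n : ℕ) (p' : (Fin n → S') →ₗ[S'] X.K') (p : (Fin n → S) →ₗ[S] X.K),
    Function.Surjective p' ∧ Function.Surjective p ∧ ∀ v, X.ρ (p' v) = p (freeRed q n v) :=
  have := X.finite
  X.isRed.exists_cover hq

/-- The rank of a free cover of `X`. -/
def coverRank : ℕ := (X.exists_cover hq).choose

/-- A free cover of `X.K'`. -/
def cover' : (Fin (X.coverRank hq) → S') →ₗ[S'] X.K' := (X.exists_cover hq).choose_spec.choose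

/-- A free cover of `X.K`. -/
def cover : (Fin (X.coverRank hq) → S) →ₗ[S] X.K :=
  (X.exists_cover hq).choose_spec.choose_spec.choose

theorem cover'_surjective : Function.Surjective (X.cover' hq) :=
  (X.exists_cover hq).choose_spec.choose_spec.choose_spec.1

theorem cover_surjective : Function.Surjective (X.cover hq) :=
  (X.exists_cover hq).choose_spec.choose_spec.choose_spec.2.1

theorem ρ_cover' (v : Fin (X.coverRank hq) → S') :
    X.ρ (X.cover' hq v) = X.cover hq (freeRed q _ v) :=
  (X.exists_cover hq).choose_spec.choose_spec.choose_spec.2.2 v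

instance : Module R (LinearMap.ker (X.cover' hq)) :=
  inferInstanceAs (Module R ((LinearMap.ker (X.cover' hq)).restrictScalars R))

instance : IsScalarTower R S' (LinearMap.ker (X.cover' hq)) :=
  ⟨fun r s x => Subtype.ext (smul_assoc r s (x : Fin (X.coverRank hq) → S'))⟩

/-- The reduction map on syzygies. -/
def syzρ : LinearMap.ker (X.cover' hq) →+ LinearMap.ker (X.cover hq) where
  toFun x := ⟨freeRed q _ x, by
    rw [LinearMap.mem_ker, ← ρ_cover', LinearMap.mem_ker.1 x.2, map_zero]⟩
  map_zero' := Subtype.ext (map_zero _)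
  map_add' _ _ := Subtype.ext (map_add _ _ _)

/-- Absence of torsion in K' makes the kernel compatible with reduction. A vector sent into hK' is
corrected by a multiple of h to lie in the kernel, and if h w lies in the kernel then so does w. -/
theorem isRed_syzρ : IsRed h q (X.syzρ hq) where
  smul a x := Subtype.ext ((isRed_freeRed hq _).smul a (x : Fin (X.coverRank hq) → S'))
  surjective := by
    rintro ⟨y, hy⟩
    obtain ⟨v, rfl⟩ := (isRed_freeRed hq _).surjective y
    rw [LinearMap.mem_ker, ← ρ_cover', X.isRed.ker] at hy
    obtain ⟨z, hz⟩ := (mem_hpow_one h).1 hy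
    obtain ⟨w, rfl⟩ := X.cover'_surjective hq z
    refine ⟨⟨v - h • w, ?_⟩, Subtype.ext ?_⟩
    · rw [LinearMap.mem_ker, map_sub, LinearMap.map_smul_of_tower, hz]
      exact sub_self _
    · change freeRed q _ (v - h • w) = freeRed q _ v
      rw [map_sub, sub_eq_self, (isRed_freeRed hq _).ker]
      exact smul_mem_hpow_one h _
  ker := by
    rintro ⟨v, hv⟩
    rw [Subtype.ext_iff]
    refine ((isRed_freeRed hq _).ker v).trans ?_
    rw [mem_hpow_one, mem_hpow_one]
    constructor
    · rintro ⟨w, rfl⟩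
      refine ⟨⟨w, ?_⟩, rfl⟩
      rw [LinearMap.mem_ker, LinearMap.map_smul_of_tower] at hv
      exact X.isRed.tors _ hv
    · rintro ⟨w, hw⟩
      exact ⟨w, congrArg Subtype.val hw⟩
  sep := hq.complete.sep.pi.of_injective
    { toFun := fun x : LinearMap.ker (X.cover' hq) => (x : Fin (X.coverRank hq) → S')
      map_add' := fun _ _ => rfl
      map_smul' := fun _ _ => rfl } Subtype.val_injective
  tors := hq.tors.pi.of_injective
    { toFun := fun x : LinearMap.ker (X.cover' hq) => (x : Fin (X.coverRank hq) → S')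
      map_add' := fun _ _ => rfl
      map_smul' := fun _ _ => rfl } Subtype.val_injective

variable [IsNoetherianRing S]

/-- The syzygies of the chosen free cover. -/
def syz : RedPair h q where
  K' := LinearMap.ker (X.cover' hq)
  K := LinearMap.ker (X.cover hq)
  ρ := X.syzρ hq
  isRed := X.isRed_syzρ hq
  finite := Module.Finite.of_fg (IsNoetherian.noetherian _)
  rank := X.coverRank hq
  i' := (LinearMap.ker (X.cover' hq)).subtype
  i := (LinearMap.ker (X.cover hq)).subtype
  ρ_i' _ := rfl

/-- The iterated syzygies of `X`. -/
def seq (X : RedPair h q) (hq : IsReduction h q) : ℕ → RedPair h q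
  | 0 => X
  | n + 1 => (seq X hq n).syz hq

/-- The resolution that consists of the iterated syzygies. -/
def resolution (hX : X.rank = 0) : RedResolution h q where
  K' n := (X.seq hq n).K'
  K n := (X.seq hq n).K
  ρ n := (X.seq hq n).ρ
  isRed n := (X.seq hq n).isRed
  rank n := (X.seq hq n).rank
  rank_zero := hX
  i' n := (X.seq hq n).i'
  i n := (X.seq hq n).i
  p' n := (X.seq hq n).cover' hq
  p n := (X.seq hq n).cover hq
  ρ_i' n := (X.seq hq n).ρ_i'
  ρ_p' n := (X.seq hq n).ρ_cover' hq
  injective' n := (LinearMap.ker ((X.seq hq n).cover' hq)).injective_subtype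
  injective n := (LinearMap.ker ((X.seq hq n).cover hq)).injective_subtype
  surjective' n := (X.seq hq n).cover'_surjective hq
  surjective n := (X.seq hq n).cover_surjective hq
  exact' _ := LinearMap.exact_subtype_ker_map _
  exact _ := LinearMap.exact_subtype_ker_map _

end RedPair

/-- If `Ext` of the reduction is concentrated in one degree `n`, then `Extⁿ` is complete without
`h`-torsion, and its reduction modulo `h` is `Extⁿ` of the reduction. -/
theorem IsRed.ext_reduction {R : Type v} [CommRing R] {h : R} {S' S : Type u} [Ring S'] [Ring S]
    [IsNoetherianRing S] [Algebra R S'] {q : S' →+* S} (hq : IsReduction h q) {K' K : Type u}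
    [AddCommGroup K'] [AddCommGroup K] [Module S' K'] [Module S K] [Module R K']
    [IsScalarTower R S' K'] [Module.Finite S K] {ρ : K' →+ K} (hρ : IsRed h q ρ) (n : ℕ)
    (H : ∀ m, m ≠ n → Subsingleton (ExtRing (ModuleCat.of S K) m))
    [inst : Module R (ExtRing (ModuleCat.of S' K') n)]
    [inst' : IsScalarTower R S'ᵐᵒᵖ (ExtRing (ModuleCat.of S' K') n)] :
    PowComplete h (ExtRing (ModuleCat.of S' K') n) ∧
    TorsFree h (ExtRing (ModuleCat.of S' K') n) ∧
    ∃ π : ExtRing (ModuleCat.of S' K') n →+ ExtRing (ModuleCat.of S K) n,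
      Function.Surjective π ∧ (∀ x, π x = 0 ↔ x ∈ hpow h _ 1) ∧
      ∀ (s : S') (x), π ((op s : S'ᵐᵒᵖ) • x) = (op (q s) : Sᵐᵒᵖ) • π x :=
  @RedResolution.ext_reduction _ _ _ _ _ _ _ _ _ (RedPair.resolution
    -- The module being resolved is mapped to the free module of rank 0, as the convention
    -- `rank_zero` requires.
    { K' := K', K := K, ρ := ρ, isRed := hρ, finite := inferInstance, rank := 0, i' := 0, i := 0,
      ρ_i' := fun _ => map_zero _ } hq rfl) hq n H inst inst'


/-! ### Operators with coefficients in a ring, on complete modules -/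

section Coeff

variable {R : Type*} [CommRing R] {h : R} {V : Type*} [Ring V] [Algebra R V] {I : Type*} [Fintype I]

/-- The operator `v ↦ ∑ Cᵢ vᵢ`. -/
def coeffMap (R : Type*) [CommRing R] {V : Type*} [Ring V] [Algebra R V] {I : Type*} [Fintype I]
    (C : I → V) (N : Type*) [AddCommGroup N] [Module V N] [Module R N]
    [IsScalarTower R V N] : (I → N) →ₗ[R] N where
  toFun v := ∑ i, C i • v i
  map_add' v w := by simp [Finset.sum_add_distrib]
  map_smul' r v := by
    rw [RingHom.id_apply, Finset.smul_sum]
    exact Finset.sum_congr rfl fun i _ => smul_comm _ _ _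

theorem coeffMap_apply (C : I → V) {N : Type*} [AddCommGroup N] [Module V N] [Module R N]
    [IsScalarTower R V N] (v : I → N) : coeffMap R C N v = ∑ i, C i • v i := rfl

/-- Naturality in N, which allows properties of these operators to be checked on submodules and
quotients. -/
theorem map_coeffMap (C : I → V) {N N' : Type*} [AddCommGroup N] [Module V N] [Module R N]
    [IsScalarTower R V N] [AddCommGroup N'] [Module V N'] [Module R N'] [IsScalarTower R V N']
    (f : N →ₗ[V] N') (v : I → N) : f (coeffMap R C N v) = coeffMap R C N' (fun i => f (v i)) := by
  simp [coeffMap_apply]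

/-- The operator `C` is surjective, and its kernel is contained in the kernel of the `E i`. -/
def CoeffGood (R : Type*) [CommRing R] {V : Type*} [Ring V] [Algebra R V] {I : Type*} [Fintype I]
    (C : I → V) (E : I → I → V) (N : Type*) [AddCommGroup N] [Module V N]
    [Module R N] [IsScalarTower R V N] : Prop :=
  Function.Surjective (coeffMap R C N) ∧
    ∀ v, coeffMap R C N v = 0 → ∀ i, coeffMap R (E i) N v = 0

variable (C : I → V) (E : I → I → V)

/-- The submodule `hⁿN` for the action of a larger ring. -/
def hpowV (h : R) (V : Type*) [Ring V] [Algebra R V] (N : Type*) [AddCommGroup N] [Module V N]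
    [Module R N] [IsScalarTower R V N] (n : ℕ) : Submodule V N where
  carrier := hpow h N n
  add_mem' := fun ha hb => (hpow h N n).add_mem ha hb
  zero_mem' := (hpow h N n).zero_mem
  smul_mem' c x hx := by
    obtain ⟨z, rfl⟩ := (mem_hpow h).1 hx
    rw [smul_comm]
    exact smul_mem_hpow h n _

theorem mem_hpowV {N : Type*} [AddCommGroup N] [Module V N]
    [Module R N] [IsScalarTower R V N] (n : ℕ) (x : N) :
    x ∈ hpowV h V N n ↔ x ∈ hpow h N n := Iff.rfl

/-- Dévissage along hN ⊂ N, for an idempotent matrix E with CE = C. A solution of C v = y in N/hN is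
lifted and then corrected by a solution in hN. -/
theorem CoeffGood.of_pow (hEE : ∀ (N : Type u) [AddCommGroup N] [Module V N] [Module R N]
      [IsScalarTower R V N] (v : I → N) (i : I),
      coeffMap R (E i) N (fun j => coeffMap R (E j) N v) = coeffMap R (E i) N v)
    (hCE : ∀ (N : Type u) [AddCommGroup N] [Module V N] [Module R N]
      [IsScalarTower R V N] (v : I → N),
      coeffMap R C N (fun j => coeffMap R (E j) N v) = coeffMap R C N v)
    (H : ∀ (N : Type u) [AddCommGroup N] [Module V N] [Module R N] [IsScalarTower R V N],
      (∀ x : N, h • x = 0) → CoeffGood R C E N) (n : ℕ) :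
    ∀ (N : Type u) [AddCommGroup N] [Module V N] [Module R N] [IsScalarTower R V N],
      (∀ x : N, h ^ n • x = 0) → CoeffGood R C E N := by
  induction n with
  | zero =>
    intro N _ _ _ _ hN
    have : ∀ x : N, x = 0 := fun x => by simpa using hN x
    exact ⟨fun y => ⟨0, (this _).trans (this _).symm⟩, fun v _ i => this _⟩
  | succ n ih =>
    intro N _ _ _ _ hN
    have h1 : CoeffGood R C E (hpowV h V N 1) := ih _ fun x => by
      obtain ⟨x, hx⟩ := x
      obtain ⟨z, rfl⟩ := (mem_hpow_one h).1 hx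
      refine Subtype.ext ?_
      change h ^ n • h • z = 0
      rw [← mul_smul, ← pow_succ, hN]
    have h2 : CoeffGood R C E (N ⧸ hpowV h V N 1) := H _ fun x => by
      obtain ⟨x, rfl⟩ := Submodule.Quotient.mk_surjective _ x
      rw [← Submodule.Quotient.mk_smul, Submodule.Quotient.mk_eq_zero]
      exact smul_mem_hpow_one h x
    refine ⟨fun y => ?_, fun v hv i => ?_⟩
    · obtain ⟨w, hw⟩ := h2.1 ((hpowV h V N 1).mkQ y)
      choose w' hw' using fun i => (hpowV h V N 1).mkQ_surjective (w i)
      obtain rfl : (fun i => (hpowV h V N 1).mkQ (w' i)) = w := funext hw'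
      rw [← map_coeffMap, ← sub_eq_zero, ← map_sub, ← LinearMap.mem_ker, Submodule.ker_mkQ] at hw
      obtain ⟨z, hz⟩ := h1.1 ⟨_, hw⟩
      have hz' := congrArg (hpowV h V N 1).subtype hz
      rw [map_coeffMap] at hz'
      refine ⟨w' - fun i => (hpowV h V N 1).subtype (z i), ?_⟩
      rw [map_sub, hz']
      exact sub_sub_cancel _ _
    -- If C v = 0, the quotient shows that Ev has entries in hN. There C(Ev) = Cv = 0, so E(Ev) = 0
    -- by induction, and E(Ev) = Ev.
    · have h3 : ∀ i, coeffMap R (E i) N v ∈ hpowV h V N 1 := fun i => by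
        rw [← Submodule.ker_mkQ (hpowV h V N 1), LinearMap.mem_ker, map_coeffMap]
        refine h2.2 _ ?_ i
        rw [← map_coeffMap, hv, map_zero]
      let z : I → hpowV h V N 1 := fun i => ⟨_, h3 i⟩
      have h4 : coeffMap R C _ z = 0 := by
        refine Subtype.ext ?_
        have := map_coeffMap (R := R) C (hpowV h V N 1).subtype z
        exact this.trans ((hCE N v).trans hv)
      have h5 := congrArg (hpowV h V N 1).subtype (h1.2 z h4 i)
      rw [map_coeffMap, map_zero] at h5
      exact (hEE N v i).symm.trans h5

/-- N may have h-torsion, so `bijective_of_mod` is not available. Surjectivity modulo h is enough by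
approximation, and the condition on kernels is tested in every N/h^nN. -/
theorem CoeffGood.of_complete (hEE : ∀ (N : Type u) [AddCommGroup N] [Module V N] [Module R N]
      [IsScalarTower R V N] (v : I → N) (i : I),
      coeffMap R (E i) N (fun j => coeffMap R (E j) N v) = coeffMap R (E i) N v)
    (hCE : ∀ (N : Type u) [AddCommGroup N] [Module V N] [Module R N]
      [IsScalarTower R V N] (v : I → N),
      coeffMap R C N (fun j => coeffMap R (E j) N v) = coeffMap R C N v)
    (H : ∀ (N : Type u) [AddCommGroup N] [Module V N] [Module R N] [IsScalarTower R V N],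
      (∀ x : N, h • x = 0) → CoeffGood R C E N)
    (N : Type u) [AddCommGroup N] [Module V N] [Module R N] [IsScalarTower R V N]
    (hN : PowComplete h N) : CoeffGood R C E N := by
  have hq : ∀ n, CoeffGood R C E (N ⧸ hpowV h V N n) := fun n =>
    CoeffGood.of_pow C E hEE hCE H n _ fun x => by
      obtain ⟨x, rfl⟩ := Submodule.Quotient.mk_surjective _ x
      rw [← Submodule.Quotient.mk_smul, Submodule.Quotient.mk_eq_zero]
      exact smul_mem_hpow h n x
  refine ⟨surjective_of_mod hN.pi hN.sep _ fun y => ?_, fun v hv i => hN.sep _ fun n => ?_⟩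
  · obtain ⟨w, hw⟩ := (hq 1).1 ((hpowV h V N 1).mkQ y)
    choose w' hw' using fun i => (hpowV h V N 1).mkQ_surjective (w i)
    obtain rfl : (fun i => (hpowV h V N 1).mkQ (w' i)) = w := funext hw'
    rw [← map_coeffMap, eq_comm, ← sub_eq_zero, ← map_sub, ← LinearMap.mem_ker,
      Submodule.ker_mkQ] at hw
    exact ⟨w', hw⟩
  · rw [← mem_hpowV (V := V), ← Submodule.ker_mkQ (hpowV h V N n), LinearMap.mem_ker, map_coeffMap]
    refine (hq n).2 _ ?_ i
    rw [← map_coeffMap, hv, map_zero]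

end Coeff

/-! ### Tensor products over noncommutative algebras -/

section Balanced

variable {ι P X Y : Type*} [AddCommGroup P] [AddCommGroup X] [AddCommGroup Y]
  {f : ι → P → P} {g : ι → X → X}

/-- The class of `p ⊗ x`. -/
def balMk (f : ι → P → P) (g : ι → X → X) : P →+ X →+ ((P ⊗[ℤ] X) ⧸ balancedRel ℤ f g) :=
  AddMonoidHom.mk' (fun p => AddMonoidHom.mk' (fun x => Submodule.Quotient.mk (p ⊗ₜ x))
    (fun x y => by rw [tmul_add, Submodule.Quotient.mk_add]))
    (fun p q => by ext x; exact congrArg Submodule.Quotient.mk (add_tmul p q x))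

theorem balMk_balanced (a : ι) (p : P) (x : X) : balMk f g (f a p) x = balMk f g p (g a x) :=
  (Submodule.Quotient.eq _).2 (Submodule.subset_span ⟨a, p, x, rfl⟩)

theorem bal_induction {C : ((P ⊗[ℤ] X) ⧸ balancedRel ℤ f g) → Prop} (z) (zero : C 0)
    (mk : ∀ p x, C (balMk f g p x)) (add : ∀ z w, C z → C w → C (z + w)) : C z := by
  obtain ⟨z, rfl⟩ := Submodule.Quotient.mk_surjective _ z
  induction z with
  | zero => exact zero
  | tmul p x => exact mk p x
  | add z w hz hw => exact add _ _ hz hw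

theorem bal_hom_ext {φ ψ : ((P ⊗[ℤ] X) ⧸ balancedRel ℤ f g) →+ Y}
    (hφψ : ∀ p x, φ (balMk f g p x) = ψ (balMk f g p x)) : φ = ψ :=
  AddMonoidHom.ext fun z => bal_induction (C := fun z => φ z = ψ z) z (by simp) hφψ
    (fun z w hz hw => by rw [map_add, map_add, hz, hw])

/-- The homomorphism on the tensor product over `ℤ` induced by a biadditive map. -/
def intLift (b : P →+ X →+ Y) : P ⊗[ℤ] X →+ Y :=
  TensorProduct.liftAddHom b (fun r p x => by simp)

theorem intLift_tmul (b : P →+ X →+ Y) (p : P) (x : X) : intLift b (p ⊗ₜ x) = b p x :=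
  TensorProduct.liftAddHom_tmul b _ p x

/-- The homomorphism induced by a balanced biadditive map. -/
def balLift (b : P →+ X →+ Y) (hb : ∀ a p x, b (f a p) x = b p (g a x)) :
    ((P ⊗[ℤ] X) ⧸ balancedRel ℤ f g) →+ Y :=
  (Submodule.liftQ (balancedRel ℤ f g) (intLift b).toIntLinearMap (by
      refine Submodule.span_le.2 ?_
      rintro _ ⟨a, p, x, rfl⟩
      change intLift b (f a p ⊗ₜ x - p ⊗ₜ g a x) = 0
      rw [map_sub, intLift_tmul, intLift_tmul, hb, sub_self])).toAddMonoidHom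

theorem balLift_balMk (b : P →+ X →+ Y) (hb : ∀ a p x, b (f a p) x = b p (g a x)) (p : P) (x : X) :
    balLift b hb (balMk f g p x) = b p x :=
  intLift_tmul b p x

end Balanced


/-! ### Homomorphisms and tensor products over the base algebra, in coordinates -/

namespace CounitalAeRing

variable {R : Type v} {A U : Type u} [CommRing R] [Ring A] [Ring U] [Algebra R A] [Algebra R U]
  (B : CounitalAeRing R A U)

section Hom

variable (P N : Type*) [AddCommGroup P] [Module Uᵐᵒᵖ P] [AddCommGroup N] [Module Uᵐᵒᵖ N]

variable {P N} in
theorem homAop_smul (φ : B.homAop P N) (b : A) (p : P) :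
    (φ : P →+ N) (op (B.s b) • p) = op (B.s b) • (φ : P →+ N) p := φ.2 b p

variable {P N} in
theorem homAct_apply (a : A) (φ : B.homAop P N) (p : P) :
    (B.homAct P N a φ : P →+ N) p = (φ : P →+ N) (op (B.t (op a)) • p) := rfl

theorem baseToEnd_apply (a : A) (p : P) :
    (B.baseToEnd P a : P →+ P) p = op (B.t (op a)) • p := rfl

variable {P N} in
theorem homAop_ext {φ ψ : B.homAop P N} (hφψ : ∀ p, (φ : P →+ N) p = (ψ : P →+ N) p) : φ = ψ :=
  Subtype.ext (AddMonoidHom.ext hφψ)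

theorem s_t_smul (a b : A) (p : P) :
    op (B.t (op a)) • op (B.s b) • p = op (B.s b) • op (B.t (op a)) • p := by
  rw [← mul_smul, ← mul_smul, ← op_mul, ← op_mul, B.s_mul_t]

theorem evalMap_balMk (p : P) (φ : B.homAop P N) :
    B.evalMap P N (balMk (fun (a : A) (p : P) => op (B.t (op a)) • p) (B.homAct P N) p φ) =
      (φ : P →+ N) p := by
  rfl

instance homAopModule [Module R N] [SMulCommClass R Uᵐᵒᵖ N] : Module R (B.homAop P N) where
  smul r φ := ⟨r • (φ : P →+ N), fun b p => by
    rw [AddMonoidHom.smul_apply, AddMonoidHom.smul_apply, homAop_smul, smul_comm]⟩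
  one_smul φ := Subtype.ext (one_smul R (φ : P →+ N))
  mul_smul r r' φ := Subtype.ext (mul_smul r r' (φ : P →+ N))
  smul_zero r := Subtype.ext (smul_zero r)
  smul_add r φ ψ := Subtype.ext (smul_add r (φ : P →+ N) (ψ : P →+ N))
  add_smul r r' φ := Subtype.ext (add_smul r r' (φ : P →+ N))
  zero_smul φ := Subtype.ext (zero_smul R (φ : P →+ N))

variable {P N} in
theorem homAop_smul_apply [Module R N] [SMulCommClass R Uᵐᵒᵖ N] (r : R) (φ : B.homAop P N)
    (p : P) : ((r • φ : B.homAop P N) : P →+ N) p = r • (φ : P →+ N) p := rfl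

end Hom

section DualBasis

variable {B} {P : Type*} [AddCommGroup P] [Module Uᵐᵒᵖ P]

/-- A dual basis of `P_◂`. -/
structure RightBasis (B : CounitalAeRing R A U) (P : Type*) [AddCommGroup P] [Module Uᵐᵒᵖ P] where
  n : ℕ
  e : Fin n → P
  c : Fin n → P →+ A
  c_smul : ∀ i a p, c i (op (B.s a) • p) = c i p * a
  sum_smul : ∀ p, ∑ i, op (B.s (c i p)) • e i = p

/-- A dual basis of `▸P`. -/
structure LeftBasis (B : CounitalAeRing R A U) (P : Type*) [AddCommGroup P] [Module Uᵐᵒᵖ P] where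
  n : ℕ
  e : Fin n → P
  c : Fin n → P →+ A
  c_smul : ∀ i a p, c i (op (B.t (op a)) • p) = a * c i p
  sum_smul : ∀ p, ∑ i, op (B.t (op (c i p))) • e i = p

theorem nonempty_rightBasis (H : HasDualBasis B.sRight P) : Nonempty (RightBasis B P) := by
  obtain ⟨n, e, c, h1, h2⟩ := H
  exact ⟨⟨n, e, fun i => (opAddEquiv (α := A)).symm.toAddMonoidHom.comp (c i),
    fun i a p => congrArg unop (h1 i (op a) p), h2⟩⟩

theorem nonempty_leftBasis (H : HasDualBasis B.tRight P) : Nonempty (LeftBasis B P) := by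
  obtain ⟨n, e, c, h1, h2⟩ := H
  exact ⟨⟨n, e, c, h1, h2⟩⟩

variable (X : RightBasis B P) (Y : LeftBasis B P)

namespace RightBasis

variable (N : Type*) [AddCommGroup N] [Module Uᵐᵒᵖ N]

/-- The homomorphism with given values on a dual basis. -/
def ofVec : (Fin X.n → N) →+ B.homAop P N :=
  AddMonoidHom.mk' (fun v => ⟨AddMonoidHom.mk' (fun p => ∑ j, op (B.s (X.c j p)) • v j)
    (fun p q => by simp [add_smul, Finset.sum_add_distrib]), fun b p => by
      simp only [AddMonoidHom.mk'_apply, X.c_smul, map_mul, op_mul, mul_smul, Finset.smul_sum]⟩)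
    (fun v w => B.homAop_ext fun p => by
      change ∑ j, _ • (v j + w j) = ∑ j, _ • v j + ∑ j, _ • w j
      simp [Finset.sum_add_distrib])

variable {N}

theorem ofVec_apply (v : Fin X.n → N) (p : P) :
    (X.ofVec N v : P →+ N) p = ∑ j, op (B.s (X.c j p)) • v j := rfl

theorem ofVec_apply_e (φ : B.homAop P N) : X.ofVec N (fun j => (φ : P →+ N) (X.e j)) = φ :=
  B.homAop_ext fun p => by
    rw [ofVec_apply]
    conv_rhs => rw [← X.sum_smul p, map_sum]
    exact Finset.sum_congr rfl fun j _ => (B.homAop_smul φ _ _).symm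

include X in
-- Evaluation on the dual basis makes Hom(P, N) a direct summand of a finite power of N.
theorem powComplete {h : R} [Module R N] [IsScalarTower R Uᵐᵒᵖ N] (hN : PowComplete h N) :
    PowComplete h (B.homAop P N) :=
  (hN.pi (ι := Fin X.n)).of_retract
    { toFun := fun φ j => (φ : P →+ N) (X.e j)
      map_add' := fun _ _ => rfl
      map_smul' := fun _ _ => rfl }
    { X.ofVec N with
      map_smul' := fun r v => B.homAop_ext fun p => by
        change ∑ j, _ • r • v j = r • ∑ j, _ • v j
        rw [Finset.smul_sum]
        exact Finset.sum_congr rfl fun j _ => smul_comm _ _ _ }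
    (fun φ => X.ofVec_apply_e φ)

end RightBasis

/-- `g` is a right action of `A` on `M`, possibly without unit. -/
structure IsRightAction {M : Type*} [AddCommGroup M] (g : A → M → M) : Prop where
  add : ∀ a x y, g a (x + y) = g a x + g a y
  add' : ∀ a b x, g (a + b) x = g a x + g b x
  mul : ∀ a b x, g (a * b) x = g b (g a x)

theorem isRightAction_homAct {N : Type*} [AddCommGroup N] [Module Uᵐᵒᵖ N] :
    IsRightAction (B.homAct P N) where
  add _ _ _ := rfl
  add' a b φ := B.homAop_ext fun p => by
    change (φ : P →+ N) (op (B.t (op (a + b))) • p) =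
      (φ : P →+ N) (op (B.t (op a)) • p) + (φ : P →+ N) (op (B.t (op b)) • p)
    rw [← map_add, MulOpposite.op_add, map_add, MulOpposite.op_add, add_smul]
  mul a b φ := B.homAop_ext fun p => by
    change (φ : P →+ N) (op (B.t (op (a * b))) • p) =
      (φ : P →+ N) (op (B.t (op a)) • op (B.t (op b)) • p)
    rw [op_mul, map_mul, op_mul, mul_smul]

theorem isRightAction_smul {M : Type*} [AddCommGroup M] [Module U M] :
    IsRightAction (fun (a : A) (m : M) => B.t (op a) • m) where
  add _ _ _ := smul_add _ _ _
  add' a b φ := by rw [MulOpposite.op_add, map_add, add_smul]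
  mul a b φ := by rw [op_mul, map_mul, mul_smul]

namespace LeftBasis

variable {M : Type*} [AddCommGroup M] {g : A → M → M}

theorem sum_balMk (p : P) (x : M) :
    ∑ i, balMk (fun (a : A) (p : P) => op (B.t (op a)) • p) g (Y.e i) (g (Y.c i p) x)
      = balMk _ _ p x := by
  conv_rhs => rw [← Y.sum_smul p, map_sum, AddMonoidHom.finsetSum_apply]
  exact Finset.sum_congr rfl fun i _ => (balMk_balanced _ _ _).symm

/-- The coordinates of an element of `P ⊗ M`. -/
def coord (hg : IsRightAction g) (i : Fin Y.n) :
    ((P ⊗[ℤ] M) ⧸ balancedRel ℤ (fun (a : A) (p : P) => op (B.t (op a)) • p) g) →+ M :=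
  balLift (AddMonoidHom.mk' (fun p => AddMonoidHom.mk' (fun x => g (Y.c i p) x) (hg.add _))
    (fun p q => by ext x; simp [hg.add']))
    (fun a p x => by
      change g (Y.c i (op (B.t (op a)) • p)) x = g (Y.c i p) (g a x)
      rw [Y.c_smul, hg.mul])

theorem coord_balMk (hg : IsRightAction g) (i : Fin Y.n) (p : P) (x : M) :
    Y.coord hg i (balMk _ _ p x) = g (Y.c i p) x := balLift_balMk _ _ _ _

theorem sum_balMk_coord (hg : IsRightAction g)
    (z : (P ⊗[ℤ] M) ⧸ balancedRel ℤ (fun (a : A) (p : P) => op (B.t (op a)) • p) g) :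
    ∑ i, balMk _ _ (Y.e i) (Y.coord hg i z) = z :=
  bal_induction (C := fun z => ∑ i, balMk _ _ (Y.e i) (Y.coord hg i z) = z) z (by simp)
    (fun p x => by simp only [coord_balMk, sum_balMk])
    (fun z w hz hw => by simp only [map_add, Finset.sum_add_distrib, hz, hw])

end LeftBasis

/-! ### The evaluation map in coordinates -/

section Eval

/-- The coefficients of the evaluation map. -/
def evalCoeff (i : Fin Y.n × Fin X.n) : Uᵐᵒᵖ := op (B.s (X.c i.2 (Y.e i.1)))

/-- The coefficients of the projection to the image of `P ⊗ Hom(P, N)` in coordinate space. -/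
def projCoeff (i' i : Fin Y.n × Fin X.n) : Uᵐᵒᵖ :=
  op (B.s (X.c i.2 (op (B.t (op (Y.c i'.1 (Y.e i.1)))) • X.e i'.2)))

variable (N : Type*) [AddCommGroup N] [Module Uᵐᵒᵖ N]

/-- The coordinates of an element of `P ⊗ Hom(P, N)`. -/
def toCoord (z : B.EvalSource P N) (i : Fin Y.n × Fin X.n) : N :=
  ((Y.coord isRightAction_homAct i.1 z : B.homAop P N) : P →+ N) (X.e i.2)

/-- The element of `P ⊗ Hom(P, N)` with given coordinates. -/
def ofCoord (v : Fin Y.n × Fin X.n → N) : B.EvalSource P N :=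
  ∑ i, balMk _ _ (Y.e i) (X.ofVec N fun j => v (i, j))

theorem ofCoord_toCoord (z : B.EvalSource P N) : ofCoord X Y N (toCoord X Y N z) = z := by
  simp only [ofCoord, toCoord, X.ofVec_apply_e, Y.sum_balMk_coord]

variable [Module R N] [IsScalarTower R Uᵐᵒᵖ N]

/-- P ⊗ Hom(P, N) is a direct summand of coordinate space, and the projection is a matrix over the
opposite of U that does not depend on N. This is what opens the evaluation map to dévissage in N. -/
theorem toCoord_ofCoord (v : Fin Y.n × Fin X.n → N) (i) :
    toCoord X Y N (ofCoord X Y N v) i = coeffMap R (projCoeff X Y i) N v := by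
  simp only [ofCoord, toCoord, map_sum, LeftBasis.coord_balMk, coeffMap_apply,
    Fintype.sum_prod_type, projCoeff]
  rw [AddSubgroup.val_finsetSum, AddMonoidHom.finsetSum_apply]
  rfl

theorem evalMap_ofCoord (v : Fin Y.n × Fin X.n → N) :
    B.evalMap P N (ofCoord X Y N v) = coeffMap R (evalCoeff X Y) N v := by
  simp only [ofCoord, map_sum, evalMap_balMk, coeffMap_apply, Fintype.sum_prod_type, evalCoeff]
  rfl

theorem projCoeff_projCoeff (v : Fin Y.n × Fin X.n → N) (i) :
    coeffMap R (projCoeff X Y i) N (fun j => coeffMap R (projCoeff X Y j) N v) =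
      coeffMap R (projCoeff X Y i) N v := by
  simp only [← toCoord_ofCoord]
  change toCoord X Y N (ofCoord X Y N (toCoord X Y N (ofCoord X Y N v))) i = _
  rw [ofCoord_toCoord]

theorem evalCoeff_projCoeff (v : Fin Y.n × Fin X.n → N) :
    coeffMap R (evalCoeff X Y) N (fun j => coeffMap R (projCoeff X Y j) N v) =
      coeffMap R (evalCoeff X Y) N v := by
  simp only [← toCoord_ofCoord, ← evalMap_ofCoord]
  change B.evalMap P N (ofCoord X Y N (toCoord X Y N (ofCoord X Y N v))) = _
  rw [ofCoord_toCoord]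

/-- `ofCoord` is surjective with section `toCoord`, so its kernel is that of the projection matrix.
Composed with evaluation it becomes `evalCoeff`; evaluation is thus injective exactly when the
kernel of that operator is no larger. -/
theorem coeffGood_iff :
    CoeffGood R (evalCoeff X Y) (projCoeff X Y) N ↔ Function.Bijective (B.evalMap P N) := by
  have toCoord_zero : ∀ i, toCoord X Y N 0 i = 0 := fun i => by
    rw [toCoord, map_zero]; rfl
  have hof0 : ofCoord X Y N 0 = 0 := by
    have h1 : toCoord X Y N 0 = 0 := funext toCoord_zero
    have h2 := ofCoord_toCoord X Y N 0
    rwa [h1] at h2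
  constructor
  · rintro ⟨h1, h2⟩
    refine ⟨(injective_iff_map_eq_zero _).2 fun z hz => ?_, fun y => ?_⟩
    · have h3 := h2 (toCoord X Y N z) (by rw [← evalMap_ofCoord, ofCoord_toCoord, hz])
      have h4 : toCoord X Y N z = 0 := funext fun i => by
        have := h3 i
        rwa [← toCoord_ofCoord, ofCoord_toCoord] at this
      rw [← ofCoord_toCoord X Y N z, h4, hof0]
    · obtain ⟨v, rfl⟩ := h1 y
      exact ⟨_, evalMap_ofCoord X Y N v⟩
  · rintro ⟨h1, h2⟩
    refine ⟨fun y => ?_, fun v hv i => ?_⟩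
    · obtain ⟨z, rfl⟩ := h2 y
      exact ⟨toCoord X Y N z, by rw [← evalMap_ofCoord, ofCoord_toCoord]⟩
    · rw [← evalMap_ofCoord] at hv
      rw [← toCoord_ofCoord, (injective_iff_map_eq_zero _).1 h1 _ hv, toCoord_zero]

end Eval

end DualBasis

end CounitalAeRing


/-! ### Reduction modulo `h` of dualising modules -/

section

variable {R : Type*} [CommRing R] {h : R}

theorem mem_hpow_op {S : Type*} [AddCommGroup S] [Module R S] {n : ℕ} {x : Sᵐᵒᵖ} :
    x ∈ hpow h Sᵐᵒᵖ n ↔ unop x ∈ hpow h S n := by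
  rw [mem_hpow, mem_hpow]
  exact ⟨fun ⟨z, hz⟩ => ⟨unop z, congrArg unop hz⟩, fun ⟨z, hz⟩ => ⟨op z, congrArg op hz⟩⟩

theorem IsReduction.op {S' S : Type*} [Ring S'] [Ring S] [Algebra R S'] {q : S' →+* S}
    (hq : IsReduction h q) : IsReduction h (RingHom.op q) where
  surjective x := by
    obtain ⟨y, hy⟩ := hq.surjective (unop x)
    exact ⟨MulOpposite.op y, congrArg MulOpposite.op hy⟩
  ker a := by
    rw [mem_hpow_op, ← hq.ker]
    exact MulOpposite.op_eq_zero_iff (q (unop a))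
  complete := hq.complete.of_retract (opLinearEquiv R (M := S')).symm.toLinearMap
    (opLinearEquiv R (M := S')).toLinearMap (fun _ => rfl)
  tors := hq.tors.of_injective (opLinearEquiv R (M := S')).symm.toLinearMap
    (opLinearEquiv R (M := S')).symm.injective

theorem HasDualBasis.lift_of_isRed {A' A S' S : Type*} [Ring A'] [Ring A] [Ring S'] [Ring S]
    [Algebra R A'] [Algebra R S'] {q : A' →+* A} (hq : IsReduction h q) {qS : S' →+* S}
    {M' M : Type*} [AddCommGroup M'] [AddCommGroup M] [Module S' M'] [Module S M] [Module R M']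
    [IsScalarTower R S' M'] {π : M' →+ M} (hπ : IsRed h qS π) {f' : A' →+* S'} {f : A →+* S}
    (hf' : ∀ (r : R) a, f' (r • a) = r • f' a) (hf : ∀ a, qS (f' a) = f (q a))
    (H : HasDualBasis f M) : HasDualBasis f' M' := by
  let _ : Module A' M' := Module.compHom M' f'
  let _ : Module A M := Module.compHom M f
  have _ : IsScalarTower R A' M' := ⟨fun r a x => by
    change f' (r • a) • x = r • f' a • x
    rw [hf', smul_assoc]⟩
  exact HasDualBasis.lift_of_mod hq.complete hπ.sep hπ.tors q hq.surjective hq.ker π hπ.surjective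
    hπ.ker (fun a x => (hπ.smul (f' a) x).trans (congrArg (· • π x) (hf a))) H

theorem exists_factor_of_surjective {M' M N : Type*} [AddCommGroup M'] [AddCommGroup M]
    [AddCommGroup N] {π : M' →+ M} (hπ : Function.Surjective π) (φ : M' →+ N)
    (hφ : ∀ x, π x = 0 → φ x = 0) : ∃ ψ : M →+ N, ∀ x, ψ (π x) = φ x :=
  ⟨π.liftOfSurjective hπ ⟨φ, hφ⟩, fun x =>
    π.liftOfRightInverse_comp_apply _ (Function.rightInverse_surjInv hπ) ⟨φ, hφ⟩ x⟩

/-- The kernel of q is hS', which annihilates N, so the action factors through S. -/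
theorem IsReduction.exists_module {S' S : Type*} [Ring S'] [Ring S] [Algebra R S'] {q : S' →+* S}
    (hq : IsReduction h q) (N : Type*) [AddCommGroup N] [Module S' N] [Module R N]
    [IsScalarTower R S' N] (hN : ∀ x : N, h • x = 0) :
    ∃ _ : Module S N, ∀ (a : S') (x : N), q a • x = a • x := by
  have hker : ∀ a, q a = 0 → Module.toAddMonoidEnd S' N a = 0 := fun a ha => by
    obtain ⟨b, rfl⟩ := (mem_hpow_one h).1 ((hq.ker a).1 ha)
    refine AddMonoidHom.ext fun x => ?_
    change (h • b) • x = 0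
    rw [smul_assoc, hN]
  refine ⟨Module.compHom N (q.liftOfSurjective hq.surjective ⟨Module.toAddMonoidEnd S' N, hker⟩),
    fun a x => ?_⟩
  exact congrArg (fun f : N →+ N => f x)
    (q.liftOfRightInverse_comp_apply _ (Function.rightInverse_surjInv hq.surjective) ⟨Module.toAddMonoidEnd S' N, hker⟩ a)

end

namespace CounitalAeRing

section HomComplete

variable {R : Type v} {h : R} {A U : Type u} [CommRing R] [Ring A] [Ring U] [Algebra R A]
  [Algebra R U] (B : CounitalAeRing R A U) {P N : Type*} [AddCommGroup P] [Module Uᵐᵒᵖ P]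
  [AddCommGroup N] [Module Uᵐᵒᵖ N] [Module R N] [IsScalarTower R Uᵐᵒᵖ N]

theorem s_algebraMap_smul (r : R) (x : N) : op (B.s (algebraMap R A r)) • x = r • x := by
  rw [AlgHom.commutes]
  exact algebraMap_smul Uᵐᵒᵖ r x

theorem t_algebraMap_smul (r : R) (x : N) : op (B.t (op (algebraMap R A r))) • x = r • x := by
  rw [show op (algebraMap R A r) = algebraMap R Aᵐᵒᵖ r from rfl, AlgHom.commutes]
  exact algebraMap_smul Uᵐᵒᵖ r x

variable [Module R P] [IsScalarTower R Uᵐᵒᵖ P]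

variable {B} in
-- Elements of `homAop` are only additive and compatible with s. Scalars act through s, so linearity
-- over the ground ring is automatic.
theorem homAop_map_smul (φ : B.homAop P N) (r : R) (p : P) :
    (φ : P →+ N) (r • p) = r • (φ : P →+ N) p := by
  rw [← B.s_algebraMap_smul, homAop_smul, s_algebraMap_smul]

omit [Module R P] [IsScalarTower R Uᵐᵒᵖ P]

variable {B} in
theorem homAop_mem_hpow (hN : TorsFree h N) {n : ℕ} (φ : B.homAop P N)
    (hφ : ∀ p, (φ : P →+ N) p ∈ hpow h N n) : φ ∈ hpow h (B.homAop P N) n := by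
  choose z hz using fun p => (mem_hpow h).1 (hφ p)
  refine (mem_hpow h).2 ⟨⟨AddMonoidHom.mk' z fun p q => ?_, fun b p => ?_⟩, B.homAop_ext hz⟩
  · exact hN.pow_inj n (by rw [smul_add, ← hz, ← hz, ← hz, map_add])
  · refine hN.pow_inj n (?_ : h ^ n • z _ = h ^ n • _ • z _)
    rw [← hz, homAop_smul, hz, smul_comm]

theorem torsFree_homAop (hN : TorsFree h N) : TorsFree h (B.homAop P N) := fun _ hφ =>
  B.homAop_ext fun p => hN _ (congrArg (fun ψ : B.homAop P N => (ψ : P →+ N) p) hφ)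

theorem apply_mem_hpow {n : ℕ} {φ : B.homAop P N} (hφ : φ ∈ hpow h (B.homAop P N) n) (p : P) :
    (φ : P →+ N) p ∈ hpow h N n := by
  obtain ⟨ψ, rfl⟩ := (mem_hpow h).1 hφ
  exact smul_mem_hpow h n ((ψ : P →+ N) p)

variable (P) in
/-- `baseToEnd` as a linear map. -/
def baseToEndₗ : A →ₗ[R] B.homAop P P where
  toFun := B.baseToEnd P
  map_add' a b := B.homAop_ext fun p => by
    change op (B.t (op (a + b))) • p = op (B.t (op a)) • p + op (B.t (op b)) • p
    rw [MulOpposite.op_add, map_add, MulOpposite.op_add, add_smul]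
  map_smul' r a := B.homAop_ext fun p => by
    change op (B.t (op (r • a))) • p = r • op (B.t (op a)) • p
    rw [op_smul, map_smul, op_smul, smul_assoc]

end HomComplete

/-- `Bh` reduces to `B` modulo `h`. -/
structure IsReductionOf {k R : Type v} {h : R} {A U Ah Uh : Type u} [CommRing k] [CommRing R] [Ring A] [Ring U]
    [Ring Ah] [Ring Uh] [Algebra k A] [Algebra k U] [Algebra R Ah] [Algebra R Uh]
    (B : CounitalAeRing k A U) (Bh : CounitalAeRing R Ah Uh) (qA : Ah →+* A) (qU : Uh →+* U) :
    Prop where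
  isReductionA : IsReduction h qA
  isReductionU : IsReduction h qU
  s : ∀ a, qU (Bh.s a) = B.s (qA a)
  t : ∀ a, qU (Bh.t (op a)) = B.t (op (qA a))

section Reduction

variable {k R : Type v} {h : R} {A U Ah Uh : Type u} [CommRing k] [CommRing R] [Ring A] [Ring U]
  [Ring Ah] [Ring Uh] [Algebra k A] [Algebra k U] [Algebra R Ah] [Algebra R Uh]
  {B : CounitalAeRing k A U} {Bh : CounitalAeRing R Ah Uh} {qA : Ah →+* A} {qU : Uh →+* U}
  (H : IsReductionOf (h := h) B Bh qA qU)
  {P' P : Type u} [AddCommGroup P'] [AddCommGroup P] [Module Uhᵐᵒᵖ P'] [Module Uᵐᵒᵖ P]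
  [Module R P'] [IsScalarTower R Uhᵐᵒᵖ P'] {π : P' →+ P} (hπ : IsRed h (RingHom.op qU) π)

include H hπ

theorem IsReductionOf.hasDualBasis_sRight (hP : HasDualBasis B.sRight P) :
    HasDualBasis Bh.sRight P' :=
  hP.lift_of_isRed H.isReductionA.op hπ
    (fun r a => congrArg op (map_smul Bh.s r (unop a))) (fun a => by exact congrArg op (H.s (unop a)))

theorem IsReductionOf.hasDualBasis_tRight (hP : HasDualBasis B.tRight P) :
    HasDualBasis Bh.tRight P' :=
  hP.lift_of_isRed H.isReductionA hπ
    (fun r a => congrArg op (map_smul Bh.t r (op a))) (fun a => by exact congrArg op (H.t a))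

omit [IsScalarTower R Uhᵐᵒᵖ P'] in
theorem IsReductionOf.π_s (a : Ah) (p : P') :
    π (op (Bh.s a) • p) = op (B.s (qA a)) • π p :=
  (hπ.smul _ p).trans (congrArg (fun u => op u • π p) (H.s a))

omit [IsScalarTower R Uhᵐᵒᵖ P'] in
theorem IsReductionOf.π_t (a : Ah) (p : P') :
    π (op (Bh.t (op a)) • p) = op (B.t (op (qA a))) • π p :=
  (hπ.smul _ p).trans (congrArg (fun u => op u • π p) (H.t a))

/-- The target is separated, as a summand of a power of P', and inherits freeness from torsion. An
endomorphism of P' induces one of P, which is multiplication by an element of A; any lift of that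
element approximates it modulo h. -/
theorem IsReductionOf.baseToEnd_bijective (hP' : PowComplete h P')
    (hP : HasDualBasis B.sRight P) (hB : Function.Bijective (B.baseToEnd P)) :
    Function.Bijective (Bh.baseToEnd P') := by
  obtain ⟨X⟩ := nonempty_rightBasis (H.hasDualBasis_sRight hπ hP)
  refine bijective_of_mod H.isReductionA.complete (X.powComplete hP').sep
    (Bh.torsFree_homAop hπ.tors) (Bh.baseToEndₗ P') (fun φ => ?_) (fun a ha => ?_)
  · obtain ⟨ψ, hψ⟩ := exists_factor_of_surjective hπ.surjective (π.comp (φ : P' →+ P'))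
      (fun x hx => by
        obtain ⟨y, rfl⟩ := (mem_hpow_one h).1 ((hπ.ker x).1 hx)
        rw [AddMonoidHom.comp_apply, hπ.ker, homAop_map_smul]
        exact smul_mem_hpow_one h _)
    obtain ⟨a, ha⟩ := hB.2 ⟨ψ, fun b p => by
      obtain ⟨p, rfl⟩ := hπ.surjective p
      obtain ⟨b, rfl⟩ := H.isReductionA.surjective b
      rw [← H.π_s hπ, hψ, hψ, AddMonoidHom.comp_apply, homAop_smul, H.π_s hπ,
        AddMonoidHom.comp_apply]⟩
    obtain ⟨a, rfl⟩ := H.isReductionA.surjective a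
    refine ⟨a, homAop_mem_hpow hπ.tors _ fun p => ?_⟩
    rw [← hπ.ker]
    change π ((φ : P' →+ P') p - op (Bh.t (op a)) • p) = 0
    rw [map_sub, H.π_t hπ, ← B.baseToEnd_apply, ha, sub_eq_zero]
    exact (hψ p).symm
  · rw [← H.isReductionA.ker]
    have h0 : B.baseToEnd P 0 = 0 := B.homAop_ext fun p => by rw [baseToEnd_apply]; simp
    refine hB.1 (.trans (B.homAop_ext fun p => ?_) h0.symm)
    obtain ⟨p, rfl⟩ := hπ.surjective p
    exact (H.π_t hπ a p).symm.trans ((hπ.ker _).2 (Bh.apply_mem_hpow ha p))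

/-- N is a U-module and homomorphisms P' → N factor through P. This gives a surjection Θ from P ⊗
Hom(P, N) to P' ⊗ Hom(P', N) whose composite with the evaluation of P' is that of P. -/
theorem IsReductionOf.evalMap_bijective_of_smul_eq_zero
    (hB : ∀ (N : Type u) [AddCommGroup N] [Module Uᵐᵒᵖ N], Function.Bijective (B.evalMap P N))
    (N : Type u) [AddCommGroup N] [Module Uhᵐᵒᵖ N] [Module R N] [IsScalarTower R Uhᵐᵒᵖ N]
    (hN : ∀ x : N, h • x = 0) : Function.Bijective (Bh.evalMap P' N) := by
  obtain ⟨inst, hinst⟩ := H.isReductionU.op.exists_module N hN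
  have hs : ∀ (a : Ah) (x : N), op (B.s (qA a)) • x = op (Bh.s a) • x := fun a x => by
    rw [← hinst, ← H.s]; rfl
  let Θ₀ : B.homAop P N →+ Bh.homAop P' N := AddMonoidHom.mk' (fun φ => ⟨(φ : P →+ N).comp π,
    fun b p => by
      rw [AddMonoidHom.comp_apply, H.π_s hπ, homAop_smul, hs]; rfl⟩) (fun _ _ => rfl)
  have hΘ₀ : ∀ φ p, (Θ₀ φ : P' →+ N) p = (φ : P →+ N) (π p) := fun _ _ => rfl
  have Θ₀_surj : Function.Surjective Θ₀ := fun φ => by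
    obtain ⟨ψ, hψ⟩ := exists_factor_of_surjective hπ.surjective (φ : P' →+ N)
      (fun x hx => by
        obtain ⟨y, rfl⟩ := (mem_hpow_one h).1 ((hπ.ker x).1 hx)
        rw [homAop_map_smul, hN])
    refine ⟨⟨ψ, fun b p => ?_⟩, Bh.homAop_ext hψ⟩
    obtain ⟨p, rfl⟩ := hπ.surjective p
    obtain ⟨b, rfl⟩ := H.isReductionA.surjective b
    rw [← H.π_s hπ, hψ, hψ, homAop_smul, hs]
  let b₀ : P' →+ B.homAop P N →+ Bh.EvalSource P' N :=
    AddMonoidHom.mk' (fun p => (balMk _ _ p).comp Θ₀) (fun p q => by ext φ; simp)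
  -- If p = h y, balancedness moves h, in the form t(h), to the Hom factor, where it acts as 0
  -- because h kills N.
  obtain ⟨b, hb⟩ := exists_factor_of_surjective hπ.surjective b₀ (fun x hx => by
    obtain ⟨y, rfl⟩ := (mem_hpow_one h).1 ((hπ.ker x).1 hx)
    refine AddMonoidHom.ext fun φ => ?_
    change balMk _ _ (h • y) (Θ₀ φ) = 0
    rw [← Bh.t_algebraMap_smul]
    refine (balMk_balanced _ _ _).trans ?_
    rw [show Bh.homAct P' N (algebraMap R Ah h) (Θ₀ φ) = 0 from Bh.homAop_ext fun p => ?_, map_zero]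
    rw [homAct_apply, t_algebraMap_smul, homAop_map_smul, hN]
    rfl)
  let Θ : B.EvalSource P N →+ Bh.EvalSource P' N := balLift b (fun a p φ => by
    obtain ⟨p, rfl⟩ := hπ.surjective p
    obtain ⟨a, rfl⟩ := H.isReductionA.surjective a
    rw [← H.π_t hπ, hb, hb]
    refine (balMk_balanced a p (Θ₀ φ)).trans ?_
    change balMk _ _ p _ = balMk _ _ p _
    congr 1
    refine Bh.homAop_ext fun p => ?_
    rw [homAct_apply, hΘ₀, hΘ₀, homAct_apply, H.π_t hπ])
  have hΘ : ∀ p φ, Θ (balMk _ _ (π p) φ) = balMk _ _ p (Θ₀ φ) := fun p φ => by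
    change balLift b _ _ = _
    rw [balLift_balMk, hb]; rfl
  have Θ_surj : Function.Surjective Θ := fun z =>
    bal_induction (C := fun z => ∃ w, Θ w = z) z ⟨0, map_zero _⟩
      (fun p φ => by
        obtain ⟨φ, rfl⟩ := Θ₀_surj φ
        exact ⟨_, hΘ p φ⟩)
      (by rintro _ _ ⟨z, rfl⟩ ⟨w, rfl⟩; exact ⟨z + w, map_add _ _ _⟩)
  have comm : (Bh.evalMap P' N).comp Θ = B.evalMap P N := bal_hom_ext fun p φ => by
    obtain ⟨p, rfl⟩ := hπ.surjective p
    rw [AddMonoidHom.comp_apply, hΘ, evalMap_balMk, evalMap_balMk, hΘ₀]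
  -- The composite is bijective and Θ is surjective. This already makes the second map bijective, so
  -- injectivity of Θ need not be shown separately.
  have hbij := hB N
  rw [← comm] at hbij
  refine ⟨(injective_iff_map_eq_zero _).2 fun z hz => ?_, fun y => ?_⟩
  · obtain ⟨w, rfl⟩ := Θ_surj z
    rw [(injective_iff_map_eq_zero _).1 hbij.1 w hz, map_zero]
  · obtain ⟨w, rfl⟩ := hbij.2 y
    exact ⟨_, rfl⟩

theorem IsReductionOf.evalMap_bijective (hP : HasDualBasis B.sRight P)
    (hP₂ : HasDualBasis B.tRight P)
    (hB : ∀ (N : Type u) [AddCommGroup N] [Module Uᵐᵒᵖ N], Function.Bijective (B.evalMap P N))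
    (N : Type u) [AddCommGroup N] [Module Uhᵐᵒᵖ N] [Module R N] [IsScalarTower R Uhᵐᵒᵖ N]
    (hN : PowComplete h N) : Function.Bijective (Bh.evalMap P' N) := by
  obtain ⟨X⟩ := nonempty_rightBasis (H.hasDualBasis_sRight hπ hP)
  obtain ⟨Y⟩ := nonempty_leftBasis (H.hasDualBasis_tRight hπ hP₂)
  rw [← coeffGood_iff (R := R) X Y]
  exact CoeffGood.of_complete (h := h) _ _
    (fun N _ _ _ _ => projCoeff_projCoeff X Y N) (fun N _ _ _ _ => evalCoeff_projCoeff X Y N)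
    (fun N _ _ _ _ hN =>
      (coeffGood_iff X Y N).2 (H.evalMap_bijective_of_smul_eq_zero hπ hB N hN)) N hN

end Reduction

end CounitalAeRing


/-! ### Part one: the dualising module of a quantisation -/

section PowerSeriesModule

variable {R : Type*} [CommRing R] {h : R} {M S : Type*} [AddCommGroup M] [Module R M] [Ring S]
  (e : M ≃+ PowerSeries S) (he : ∀ a, e (h • a) = PowerSeries.X * e a)

include he

theorem map_pow_smul_eq (n : ℕ) (a : M) : e (h ^ n • a) = PowerSeries.X ^ n * e a := by
  induction n with
  | zero => simp
  | succ n ih => rw [pow_succ', mul_smul, he, ih, ← mul_assoc, ← pow_succ']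

theorem mem_hpow_iff_coeff (n : ℕ) (a : M) :
    a ∈ hpow h M n ↔ ∀ m < n, PowerSeries.coeff m (e a) = 0 := by
  rw [← PowerSeries.X_pow_dvd_iff, mem_hpow]
  constructor
  · rintro ⟨z, rfl⟩
    exact ⟨e z, map_pow_smul_eq e he n z⟩
  · rintro ⟨z, hz⟩
    exact ⟨e.symm z, e.injective (by rw [map_pow_smul_eq e he, hz, e.apply_symm_apply])⟩

theorem torsFree_of_powerSeries : TorsFree h M := fun a ha => e.injective <| by
  ext n
  have := congrArg (fun x => PowerSeries.coeff (n + 1) (e x)) ha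
  simpa [he, PowerSeries.coeff_succ_X_mul] using this

theorem powComplete_of_powerSeries : PowComplete h M where
  sep a ha := e.injective <| by
    ext n
    simpa using (mem_hpow_iff_coeff e he (n + 1) a).1 (ha _) n n.lt_succ_self
  exists_sum y := by
    -- The terms h^i y_i with i > m do not contribute to the coefficient of index m.
    refine ⟨e.symm (PowerSeries.mk fun m => ∑ i ∈ Finset.range (m + 1),
      PowerSeries.coeff m (e (h ^ i • y i))), fun n => ?_⟩
    rw [mem_hpow_iff_coeff e he]
    intro m hm
    rw [map_sub, e.apply_symm_apply, map_sub, PowerSeries.coeff_mk, map_sum, map_sum, sub_eq_zero]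
    refine Finset.sum_subset (Finset.range_subset_range.2 hm) fun i _ hi => ?_
    exact (mem_hpow_iff_coeff e he i _).1 (smul_mem_hpow h i _) m
      (by simpa [Nat.lt_succ_iff] using hi)

end PowerSeriesModule

theorem isReduction_of_powerSeries {R : Type*} [CommRing R] {h : R} {S' S : Type*} [Ring S]
    [Ring S'] [Algebra R S'] (e : S' ≃+ PowerSeries S)
    (he : ∀ a, e (h • a) = PowerSeries.X * e a) (q : S' →+* S)
    (hq : ∀ a, q a = PowerSeries.constantCoeff (e a)) : IsReduction h q where
  surjective x := ⟨e.symm (PowerSeries.C x), by simp [hq]⟩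
  ker a := by
    rw [mem_hpow_iff_coeff (h := h) e he, hq]
    simp
  complete := powComplete_of_powerSeries e he
  tors := torsFree_of_powerSeries e he

section

variable {k : Type v} [CommRing k] {S : Type u} [Ring S] [Algebra (PowerSeries k) S]

/-- The scalar action in `IsHComplete` is the restricted one, and it agrees with any action that
forms a scalar tower. -/
theorem isHComplete_iff {M : Type*} [AddCommGroup M] [Module S M] [inst : Module (PowerSeries k) M]
    [IsScalarTower (PowerSeries k) S M] :
    IsHComplete k S M ↔ PowComplete (PowerSeries.X : PowerSeries k) M := by
  have : Module.compHom M (algebraMap (PowerSeries k) S) = inst :=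
    Module.ext' _ _ fun r x => algebraMap_smul S r x
  unfold IsHComplete
  rw [this]
  exact ⟨fun H => PowComplete.of_isAdicComplete H, fun H => H.isAdicComplete⟩

variable (k) in
theorem isScalarTower_compHom (M : Type*) [AddCommGroup M] [Module S M] :
    letI : Module (PowerSeries k) M := Module.compHom M (algebraMap (PowerSeries k) S)
    IsScalarTower (PowerSeries k) S M :=
  letI : Module (PowerSeries k) M := Module.compHom M (algebraMap (PowerSeries k) S)
  ⟨fun r a x => by
    change (r • a) • x = algebraMap (PowerSeries k) S r • a • x
    rw [Algebra.smul_def, mul_smul]⟩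

end

namespace Quantisation

variable {k : Type v} {A U Ah Uh : Type u} [CommRing k] [Ring A] [Ring U]
  [Algebra k A] [Algebra k U] [Ring Ah] [Ring Uh] [Algebra (PowerSeries k) Ah]
  [Algebra (PowerSeries k) Uh] {B : LeftBialgebroid k A U} {Bh : TopLeftBialgebroid k Ah Uh}
  (Q : Quantisation B Bh)

theorem isReductionOf : CounitalAeRing.IsReductionOf (h := (PowerSeries.X : PowerSeries k))
    B.toCounitalAeRing Bh.toCounitalAeRing Q.redA Q.redU where
  isReductionA := isReduction_of_powerSeries Q.isoA (fun a => by simp [Q.isoA_smul]) _ Q.redA_eq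
  isReductionU := isReduction_of_powerSeries Q.isoU (fun a => by simp [Q.isoU_smul]) _ Q.redU_eq
  s := Q.redU_s
  t := Q.redU_t

/-- The dualising module of the quantisation reduces to the dualising module. -/
theorem exists_isRed_extBase [IsNoetherianRing U] (d : ℕ)
    (hExt : ∀ i : ℕ, i ≠ d → Subsingleton (B.ExtBase i)) [inst : Module (PowerSeries k) (Bh.ExtBase d)]
    [inst' : IsScalarTower (PowerSeries k) Uhᵐᵒᵖ (Bh.ExtBase d)] :
    PowComplete (PowerSeries.X : PowerSeries k) (Bh.ExtBase d) ∧
    ∃ π : Bh.ExtBase d →+ B.ExtBase d, IsRed (PowerSeries.X : PowerSeries k) (RingHom.op Q.redU) π := by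
  let _ := Bh.baseModule
  let _ := B.baseModule
  have smul_defh : ∀ (x : Uh) (a : Ah), x • a = Bh.ε (x * Bh.s a) := fun _ _ => rfl
  have smul_def : ∀ (x : U) (a : A), x • a = B.ε (x * B.s a) := fun _ _ => rfl
  have : IsScalarTower (PowerSeries k) Uh Ah := ⟨fun r x a => by
    rw [smul_defh, smul_defh, smul_mul_assoc, map_smul]⟩
  have s_smul : ∀ a : A, B.s a • (1 : A) = a := fun a => by
    have := B.ε_bimodule a 1 1
    simpa [smul_def, B.ε_one] using this
  -- The base module is cyclic, since s(a) sends 1 to a.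
  have : Module.Finite U A := ⟨⟨{1}, by
    refine Submodule.eq_top_iff'.2 fun a => ?_
    rw [← s_smul a]
    exact Submodule.smul_mem _ _ (Submodule.subset_span (by simp))⟩⟩
  have hρ : IsRed (PowerSeries.X : PowerSeries k) Q.redU (Q.redA : Ah →+ A) :=
    { smul := fun x a => by
        change Q.redA (Bh.ε (x * Bh.s a)) = B.ε (Q.redU x * B.s (Q.redA a))
        rw [Q.redA_ε, map_mul, Q.redU_s]
      surjective := Q.isReductionOf.isReductionA.surjective
      ker := Q.isReductionOf.isReductionA.ker
      sep := Q.isReductionOf.isReductionA.complete.sep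
      tors := Q.isReductionOf.isReductionA.tors }
  let _ : Module (PowerSeries k) (ExtRing (ModuleCat.of Uh Ah) d) := inst
  have : IsScalarTower (PowerSeries k) Uhᵐᵒᵖ (ExtRing (ModuleCat.of Uh Ah) d) := inst'
  obtain ⟨h1, h2, π, h3, h4, h5⟩ := IsRed.ext_reduction Q.isReductionOf.isReductionU hρ d hExt
  exact ⟨h1, π, fun x => h5 (unop x), h3, h4, h1.sep, h2⟩

include Q in
theorem isTopDualising_extBase [IsNoetherianRing U] (d : ℕ)
    (hExt : ∀ i : ℕ, i ≠ d → Subsingleton (B.ExtBase i)) (hdual : B.IsDualising (B.ExtBase d))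
    (hproj : IsFGProjective B.tRight (B.ExtBase d)) : Bh.IsTopDualising (Bh.ExtBase d) := by
  let _ : Module (PowerSeries k) (Bh.ExtBase d) :=
    Module.compHom _ (algebraMap (PowerSeries k) Uhᵐᵒᵖ)
  have := isScalarTower_compHom k (S := Uhᵐᵒᵖ) (Bh.ExtBase d)
  obtain ⟨hc, π, hπ⟩ := Q.exists_isRed_extBase d hExt
  have h1 := (isFGProjective_iff_hasDualBasis _ _).1 hdual.fgProjective
  have h2 := (isFGProjective_iff_hasDualBasis _ _).1 hproj
  have H := Q.isReductionOf
  refine ⟨(isFGProjective_iff_hasDualBasis _ _).2 (H.hasDualBasis_sRight hπ h1),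
    (isFGProjective_iff_hasDualBasis _ _).2 (H.hasDualBasis_tRight hπ h2),
    H.baseToEnd_bijective hπ hc h1 hdual.baseToEnd_bijective, fun N _ _ hN => ?_⟩
  let _ : Module (PowerSeries k) N := Module.compHom _ (algebraMap (PowerSeries k) Uhᵐᵒᵖ)
  have := isScalarTower_compHom k (S := Uhᵐᵒᵖ) N
  exact H.evalMap_bijective hπ h1 h2 hdual.evalMap_bijective N (isHComplete_iff.1 hN)

end Quantisation


/-! ### Representatives modulo `hⁿ` of elements of completions -/

section Rep

variable {k : Type*} [CommRing k] {T : Type*} [AddCommGroup T] [Module (PowerSeries k) T]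
  {W : Submodule (PowerSeries k) T} {n : ℕ}

/-- `W + hⁿT`. -/
def supPow (W : Submodule (PowerSeries k) T) (n : ℕ) : Submodule (PowerSeries k) T :=
  W ⊔ hIdeal k ^ n • ⊤

theorem supPow_eq : supPow W n = W ⊔ hpow PowerSeries.X T n := by
  rw [supPow, hpow_eq_smul_top]

theorem mem_supPow {x : T} :
    x ∈ supPow W n ↔ ∃ z, x - (PowerSeries.X : PowerSeries k) ^ n • z ∈ W := by
  rw [supPow_eq, Submodule.mem_sup]
  constructor
  · rintro ⟨y, hy, _, hz, rfl⟩
    obtain ⟨z, rfl⟩ := (mem_hpow _).1 hz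
    exact ⟨z, by rwa [add_sub_cancel_right]⟩
  · rintro ⟨z, hz⟩
    exact ⟨_, hz, _, smul_mem_hpow _ n z, sub_add_cancel _ _⟩

theorem le_supPow : W ≤ supPow W n := le_sup_left

theorem pow_smul_mem_supPow (x : T) : (PowerSeries.X : PowerSeries k) ^ n • x ∈ supPow W n :=
  mem_supPow.2 ⟨x, by rw [sub_self]; exact W.zero_mem⟩

theorem map_mem_supPow {T' : Type*} [AddCommGroup T'] [Module (PowerSeries k) T']
    {W' : Submodule (PowerSeries k) T'} (f : T →ₗ[PowerSeries k] T')
    (hf : ∀ x ∈ W, f x ∈ supPow W' n) {x : T} (hx : x ∈ supPow W n) : f x ∈ supPow W' n := by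
  obtain ⟨z, hz⟩ := mem_supPow.1 hx
  have := add_mem (hf _ hz) (pow_smul_mem_supPow (W := W') (n := n) (f z))
  rwa [← map_smul, ← map_add, sub_add_cancel] at this

/-- Level n of the completion of T/W is T/(W + h^nT). Identities in the completion thus become
congruences between elements of T. -/
theorem mk_mk_eq_zero_iff (x : T) :
    (Submodule.Quotient.mk (Submodule.Quotient.mk x : T ⧸ W) :
      (T ⧸ W) ⧸ (hIdeal k ^ n • ⊤ : Submodule (PowerSeries k) (T ⧸ W))) = 0 ↔ x ∈ supPow W n := by
  rw [Submodule.Quotient.mk_eq_zero, hpow_eq_smul_top, mem_hpow, mem_supPow]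
  constructor
  · rintro ⟨z, hz⟩
    obtain ⟨z, rfl⟩ := Submodule.Quotient.mk_surjective _ z
    exact ⟨z, (Submodule.Quotient.eq W).1 hz⟩
  · rintro ⟨z, hz⟩
    exact ⟨Submodule.Quotient.mk z, (Submodule.Quotient.eq W).2 hz⟩

theorem mk_mk_eq_iff (x y : T) :
    (Submodule.Quotient.mk (Submodule.Quotient.mk x : T ⧸ W) :
      (T ⧸ W) ⧸ (hIdeal k ^ n • ⊤ : Submodule (PowerSeries k) (T ⧸ W))) =
        Submodule.Quotient.mk (Submodule.Quotient.mk y) ↔ x - y ∈ supPow W n := by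
  rw [← mk_mk_eq_zero_iff, Submodule.Quotient.mk_sub, Submodule.Quotient.mk_sub, sub_eq_zero]

namespace RepMod

variable {z w : AdicCompletion (hIdeal k) (T ⧸ W)} {x y : T}

variable (W n z) in
theorem exists_rep : ∃ x, RepMod k W n z x := by
  obtain ⟨y, hy⟩ := Submodule.Quotient.mk_surjective _ (AdicCompletion.eval (hIdeal k) (T ⧸ W) n z)
  obtain ⟨x, rfl⟩ := Submodule.Quotient.mk_surjective _ y
  exact ⟨x, hy.symm⟩

theorem sub_mem (hx : RepMod k W n z x) (hy : RepMod k W n z y) : x - y ∈ supPow W n := by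
  rw [← mk_mk_eq_iff]
  exact hx.symm.trans hy

theorem congr (hx : RepMod k W n z x) (hxy : x - y ∈ supPow W n) : RepMod k W n z y :=
  hx.trans ((mk_mk_eq_iff x y).2 hxy)

theorem zero_iff : RepMod k W n 0 x ↔ x ∈ supPow W n := by
  rw [RepMod, map_zero, eq_comm, mk_mk_eq_zero_iff]

theorem add (hx : RepMod k W n z x) (hy : RepMod k W n w y) : RepMod k W n (z + w) (x + y) := by
  rw [RepMod, map_add, hx, hy, Submodule.Quotient.mk_add, Submodule.Quotient.mk_add]

theorem sub (hx : RepMod k W n z x) (hy : RepMod k W n w y) : RepMod k W n (z - w) (x - y) := by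
  rw [RepMod, map_sub, hx, hy, Submodule.Quotient.mk_sub, Submodule.Quotient.mk_sub]

theorem smul (r : PowerSeries k) (hx : RepMod k W n z x) : RepMod k W n (r • z) (r • x) := by
  rw [RepMod, map_smul, hx, Submodule.Quotient.mk_smul, Submodule.Quotient.mk_smul]

theorem of (x : T) : RepMod k W n (toCompletion k W x) x := AdicCompletion.eval_of _ _ _ _

theorem ext (hzw : ∀ n, ∃ x, RepMod k W n z x ∧ RepMod k W n w x) : z = w :=
  AdicCompletion.ext fun n => by
    obtain ⟨x, hx, hx'⟩ := hzw n
    exact hx.trans hx'.symm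

/-- For a finitely generated ideal the kernel of the projection to level n is the n-th power of the
ideal times the completion. -/
theorem mem_hpow_iff : RepMod k W n z 0 ↔ z ∈ hpow (PowerSeries.X : PowerSeries k) _ n := by
  rw [← hpow_eq_smul_top, AdicCompletion.pow_smul_top_eq_ker_eval (Submodule.fg_span_singleton _),
    LinearMap.mem_ker]
  rfl

theorem sum {ι : Type*} {s : Finset ι} {z : ι → AdicCompletion (hIdeal k) (T ⧸ W)} {x : ι → T}
    (hx : ∀ i ∈ s, RepMod k W n (z i) (x i)) : RepMod k W n (∑ i ∈ s, z i) (∑ i ∈ s, x i) := by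
  rw [RepMod, map_sum, Finset.sum_congr rfl hx]
  exact (map_sum ((hIdeal k ^ n • ⊤ : Submodule (PowerSeries k) (T ⧸ W)).mkQ.comp W.mkQ) x s).symm

theorem mem_hpow_iff' (hx : RepMod k W n z x) : z ∈ hpow (PowerSeries.X : PowerSeries k) _ n ↔ x ∈ supPow W n := by
  rw [← mem_hpow_iff]
  exact ⟨fun h0 => by simpa using hx.sub_mem h0, fun h0 => hx.congr (by simpa using h0)⟩

theorem map {T' : Type*} [AddCommGroup T'] [Module (PowerSeries k) T']
    {W' : Submodule (PowerSeries k) T'} (f : T →ₗ[PowerSeries k] T') (hf : W ≤ W'.comap f)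
    (hx : RepMod k W n z x) :
    RepMod k W' n (AdicCompletion.map (hIdeal k) (Submodule.mapQ W W' f hf) z) (f x) := by
  rw [RepMod, AdicCompletion.eval_apply, AdicCompletion.map_val_apply, ← AdicCompletion.eval_apply,
    hx]
  rfl

end RepMod

variable (W) in
theorem powComplete_completion :
    PowComplete (PowerSeries.X : PowerSeries k) (AdicCompletion (hIdeal k) (T ⧸ W)) :=
  PowComplete.of_isAdicComplete (AdicCompletion.isAdicComplete (Submodule.fg_span_singleton _))

/-- The extension to the completion of a map with values in a complete module. -/
theorem exists_extension_completion {X : Type*} [AddCommGroup X] [Module (PowerSeries k) X]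
    (hX : PowComplete (PowerSeries.X : PowerSeries k) X) (g : T →ₗ[PowerSeries k] X)
    (hg : ∀ x ∈ W, g x = 0) :
    ∃ f : AdicCompletion (hIdeal k) (T ⧸ W) →ₗ[PowerSeries k] X,
      ∀ x, f (toCompletion k W x) = g x := by
  have := hX.isAdicComplete
  refine ⟨((AdicCompletion.ofLinearEquiv (hIdeal k) _).symm.toLinearMap).comp
    ((AdicCompletion.map (hIdeal k) (W.liftQ g hg)).restrictScalars (PowerSeries k)), fun x => ?_⟩
  change (AdicCompletion.ofLinearEquiv (hIdeal k) _).symm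
    (AdicCompletion.map (hIdeal k) (W.liftQ g hg) (AdicCompletion.of _ _ _)) = _
  rw [AdicCompletion.map_of, AdicCompletion.ofLinearEquiv_symm_of]
  rfl

end Rep

/-! ### The Hopf-Galois maps on algebraic tensors -/

theorem exists_fin_sum {R M N : Type*} [CommRing R] [AddCommGroup M] [Module R M]
    [AddCommGroup N] [Module R N] (x : M ⊗[R] N) :
    ∃ (r : ℕ) (v : Fin r → M) (w : Fin r → N), x = ∑ i, v i ⊗ₜ[R] w i := by
  induction x with
  | zero => exact ⟨0, Fin.elim0, Fin.elim0, by simp⟩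
  | tmul m n => exact ⟨1, fun _ => m, fun _ => n, by simp⟩
  | add x y hx hy =>
    obtain ⟨r, v, w, rfl⟩ := hx
    obtain ⟨r', v', w', rfl⟩ := hy
    exact ⟨r + r', Fin.append v v', Fin.append w w', by simp [Fin.sum_univ_add]⟩

namespace CounitalAeRing

variable {R : Type v} {A U : Type u} [CommRing R] [Ring A] [Ring U] [Algebra R A] [Algebra R U]
  (B : CounitalAeRing R A U)

/-- The relations multiply by t(a) and s(a) on the left, so they span a right ideal; on the other
side only Takeuchi elements act. -/
theorem takRel_mul_mem {x : U ⊗[R] U} (hx : x ∈ B.takRel) (y : U ⊗[R] U) : x * y ∈ B.takRel := by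
  induction y with
  | zero => simp
  | add y z hy hz => rw [mul_add]; exact add_mem hy hz
  | tmul p q =>
    refine Submodule.span_induction (p := fun x _ => x * p ⊗ₜ[R] q ∈ B.takRel) ?_ (by simp)
      (fun x y _ _ hx hy => by rw [add_mul]; exact add_mem hx hy)
      (fun r x _ hx => by rw [smul_mul_assoc]; exact Submodule.smul_mem _ r hx) hx
    rintro _ ⟨a, u, v, rfl⟩
    rw [sub_mul, Algebra.TensorProduct.tmul_mul_tmul, Algebra.TensorProduct.tmul_mul_tmul,
      mul_assoc, mul_assoc]
    exact Submodule.subset_span ⟨a, _, _, rfl⟩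

end CounitalAeRing

namespace TopLeftBialgebroid

variable {k : Type v} {A U : Type u} [CommRing k] [Ring A] [Ring U]
  [Algebra (PowerSeries k) A] [Algebra (PowerSeries k) U] (B : TopLeftBialgebroid k A U)

/-- `x` represents `Δ(u)` modulo `hⁿ`. -/
abbrev RepΔ (n : ℕ) (u : U) (x : U ⊗[PowerSeries k] U) : Prop := RepMod k B.takRel n (B.Δ u) x

variable {B} {n : ℕ}

theorem mul_mem_supPow {x : U ⊗[PowerSeries k] U} (hx : x ∈ supPow B.takRel n)
    (y : U ⊗[PowerSeries k] U) : x * y ∈ supPow B.takRel n :=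
  map_mem_supPow (LinearMap.mulRight (PowerSeries k) y)
    (fun _ hx => le_supPow (B.takRel_mul_mem hx y)) hx

/-- Left multiplication by a representative of a coproduct respects the relations by the Takeuchi
condition: y(t(a) ⊗ 1) and y(1 ⊗ s(a)) agree in the quotient. -/
theorem rep_mul_mem_supPow {u : U} {y : U ⊗[PowerSeries k] U} (hy : B.RepΔ n u y)
    {x : U ⊗[PowerSeries k] U} (hx : x ∈ supPow B.takRel n) : y * x ∈ supPow B.takRel n := by
  refine map_mem_supPow (LinearMap.mulLeft (PowerSeries k) y) (fun x hx => ?_) hx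
  change y * x ∈ _
  refine Submodule.span_induction (p := fun x _ => y * x ∈ supPow B.takRel n) ?_ (by simp)
    (fun x y _ _ hx hy => by rw [mul_add]; exact add_mem hx hy)
    (fun r x _ hx => by rw [mul_smul_comm]; exact Submodule.smul_mem _ r hx) hx
  rintro _ ⟨a, u, v, rfl⟩
  have h1 := mul_mem_supPow ((B.isCoproduct n).takeuchi _ _ hy a) (u ⊗ₜ v)
  rwa [sub_mul, mul_assoc, mul_assoc, ← mul_sub, Algebra.TensorProduct.tmul_mul_tmul,
    Algebra.TensorProduct.tmul_mul_tmul, one_mul, one_mul] at h1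

theorem repΔ_s (a : A) : B.RepΔ n (B.s a) (B.s a ⊗ₜ 1) := by
  have := (B.isCoproduct n).bimodule a 1 1 1 (B.isCoproduct n).one
  simpa using this

theorem repΔ_t (a : A) : B.RepΔ n (B.t (op a)) (1 ⊗ₜ B.t (op a)) := by
  have := (B.isCoproduct n).bimodule 1 a 1 1 (B.isCoproduct n).one
  simpa using this

theorem RepΔ.mul {u v : U} {x y : U ⊗[PowerSeries k] U} (hx : B.RepΔ n u x) (hy : B.RepΔ n v y) :
    B.RepΔ n (u * v) (x * y) :=
  (B.isCoproduct n).mul u v x y hx hy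

variable (B)

/-- Right multiplication by an algebraic tensor on the completed tensor product. -/
def mulCompl (y : U ⊗[PowerSeries k] U) : B.TakCompl →ₗ[PowerSeries k] B.TakCompl :=
  (AdicCompletion.map (hIdeal k) (Submodule.mapQ B.takRel B.takRel
    (LinearMap.mulRight (PowerSeries k) y) fun _ hx => B.takRel_mul_mem hx y)).restrictScalars _

variable {B}

theorem rep_mulCompl {z : B.TakCompl} {x : U ⊗[PowerSeries k] U} (hx : RepMod k B.takRel n z x)
    (y : U ⊗[PowerSeries k] U) : RepMod k B.takRel n (B.mulCompl y z) (x * y) :=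
  hx.map (LinearMap.mulRight (PowerSeries k) y) _

variable (B) in
/-- The map `u ⊗ v ↦ Δ(u) j(v)`. -/
def galoisMap (j : U →ₗ[PowerSeries k] U ⊗[PowerSeries k] U) :
    U ⊗[PowerSeries k] U →ₗ[PowerSeries k] B.TakCompl :=
  TensorProduct.lift (LinearMap.mk₂ (PowerSeries k) (fun u v => B.mulCompl (j v) (B.Δ u))
    (fun _ _ _ => by rw [map_add, map_add]) (fun _ _ _ => by rw [map_smul, map_smul])
    (fun u v w => RepMod.ext fun n => by
      obtain ⟨x, hx⟩ := RepMod.exists_rep B.takRel n (B.Δ u)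
      refine ⟨_, rep_mulCompl hx _, ?_⟩
      rw [map_add, mul_add]
      exact (rep_mulCompl hx _).add (rep_mulCompl hx _))
    (fun r u v => RepMod.ext fun n => by
      obtain ⟨x, hx⟩ := RepMod.exists_rep B.takRel n (B.Δ u)
      refine ⟨_, rep_mulCompl hx _, ?_⟩
      rw [map_smul, mul_smul_comm]
      exact (rep_mulCompl hx _).smul r))

variable (j : U →ₗ[PowerSeries k] U ⊗[PowerSeries k] U)

theorem rep_galoisMap {u : U} {x : U ⊗[PowerSeries k] U} (hx : B.RepΔ n u x) (v : U) :
    RepMod k B.takRel n (B.galoisMap j (u ⊗ₜ v)) (x * j v) :=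
  rep_mulCompl hx _

/-- The embedding `v ↦ 1 ⊗ v`. -/
def inrₗ (R U : Type*) [CommRing R] [Ring U] [Algebra R U] : U →ₗ[R] U ⊗[R] U :=
  TensorProduct.mk R U U 1

/-- The embedding `v ↦ v ⊗ 1`. -/
def inlₗ (R U : Type*) [CommRing R] [Ring U] [Algebra R U] : U →ₗ[R] U ⊗[R] U :=
  (TensorProduct.mk R U U).flip 1

/-- Δ(u t(a)) = Δ(u)(1 ⊗ t(a)), so the Galois map respects the balancing. -/
theorem galoisMap_inr_leftRel : ∀ x ∈ B.leftRel, B.galoisMap (inrₗ _ U) x = 0 := by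
  intro x hx
  rw [← LinearMap.mem_ker]
  revert x
  refine Submodule.span_le.2 ?_
  rintro _ ⟨a, u, v, rfl⟩
  rw [SetLike.mem_coe, LinearMap.mem_ker, map_sub, sub_eq_zero]
  refine RepMod.ext fun n => ?_
  obtain ⟨x, hx⟩ := RepMod.exists_rep B.takRel n (B.Δ u)
  refine ⟨_, rep_galoisMap _ (RepΔ.mul hx (repΔ_t a)) _, ?_⟩
  have := rep_galoisMap (inrₗ _ U) hx (B.t (op a) * v)
  rwa [mul_assoc, show (1 ⊗ₜ B.t (op a)) * inrₗ (PowerSeries k) U v = inrₗ _ U (B.t (op a) * v) by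
    simp [inrₗ]]

theorem galoisMap_inl_rightRel : ∀ x ∈ B.rightRel, B.galoisMap (inlₗ _ U) x = 0 := by
  intro x hx
  rw [← LinearMap.mem_ker]
  revert x
  refine Submodule.span_le.2 ?_
  rintro _ ⟨a, u, v, rfl⟩
  rw [SetLike.mem_coe, LinearMap.mem_ker, map_sub, sub_eq_zero]
  refine RepMod.ext fun n => ?_
  obtain ⟨x, hx⟩ := RepMod.exists_rep B.takRel n (B.Δ u)
  refine ⟨_, rep_galoisMap _ (RepΔ.mul hx (repΔ_s a)) _, ?_⟩
  have := rep_galoisMap (inlₗ _ U) hx (B.s a * v)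
  rwa [mul_assoc, show (B.s a ⊗ₜ 1) * inlₗ (PowerSeries k) U v = inlₗ _ U (B.s a * v) by
    simp [inlₗ]]

end TopLeftBialgebroid


/-! ### Part two: quantisations of Hopf algebroids -/

namespace Quantisation

variable {k : Type v} {A U Ah Uh : Type u} [CommRing k] [Ring A] [Ring U]
  [Algebra k A] [Algebra k U] [Ring Ah] [Ring Uh] [Algebra (PowerSeries k) Ah]
  [Algebra (PowerSeries k) Uh] {B : LeftBialgebroid k A U} {Bh : TopLeftBialgebroid k Ah Uh}
  (Q : Quantisation B Bh)

theorem redU_smul (f : PowerSeries k) (x : Uh) :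
    Q.redU (f • x) = PowerSeries.constantCoeff f • Q.redU x := by
  rw [Q.redU_eq, Q.redU_eq, Q.isoU_smul, map_mul, Algebra.smul_def]
  congr 1

theorem redU_surjective : Function.Surjective Q.redU := Q.isReductionOf.isReductionU.surjective

/-- The reduction `Uh ⊗ Uh → U ⊗ U`. -/
def redT : Uh ⊗[PowerSeries k] Uh →+ U ⊗[k] U :=
  TensorProduct.liftAddHom (AddMonoidHom.mk' (fun u => AddMonoidHom.mk'
      (fun v => Q.redU u ⊗ₜ Q.redU v) (fun v w => by rw [map_add, tmul_add]))
    (fun u w => by ext v; simp [add_tmul]))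
    (fun r u v => by simp [redU_smul, smul_tmul])

theorem redT_tmul (u v : Uh) : Q.redT (u ⊗ₜ v) = Q.redU u ⊗ₜ Q.redU v := rfl

theorem redT_smul (f : PowerSeries k) (x : Uh ⊗[PowerSeries k] Uh) :
    Q.redT (f • x) = PowerSeries.constantCoeff f • Q.redT x := by
  induction x with
  | zero => simp
  | tmul u v => rw [smul_tmul', redT_tmul, redU_smul, redT_tmul, smul_tmul']
  | add x y hx hy => rw [smul_add, map_add, hx, hy, map_add, smul_add]

theorem redT_mul (x y : Uh ⊗[PowerSeries k] Uh) : Q.redT (x * y) = Q.redT x * Q.redT y := by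
  induction x with
  | zero => simp
  | add x x' hx hx' => rw [add_mul, map_add, hx, hx', map_add, add_mul]
  | tmul u v =>
    induction y with
    | zero => simp
    | add y y' hy hy' => rw [mul_add, map_add, hy, hy', map_add, mul_add]
    | tmul u' v' =>
      simp only [Algebra.TensorProduct.tmul_mul_tmul, redT_tmul, map_mul]

theorem redT_surjective : Function.Surjective Q.redT := fun x => by
  induction x with
  | zero => exact ⟨0, map_zero _⟩
  | tmul u v =>
    obtain ⟨u, rfl⟩ := Q.redU_surjective u
    obtain ⟨v, rfl⟩ := Q.redU_surjective v
    exact ⟨_, Q.redT_tmul u v⟩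
  | add x y hx hy =>
    obtain ⟨x, rfl⟩ := hx
    obtain ⟨y, rfl⟩ := hy
    exact ⟨_, map_add _ _ _⟩

/-- An additive map on `Uh ⊗ Uh` that is killed by `h` factors through the reduction. -/
theorem exists_factor_redT {N : Type*} [AddCommGroup N] [Module (PowerSeries k) N]
    (g : Uh ⊗[PowerSeries k] Uh →ₗ[PowerSeries k] N)
    (hg : ∀ x, g ((PowerSeries.X : PowerSeries k) • x) = 0) :
    ∃ σ : U ⊗[k] U →+ N, ∀ x, σ (Q.redT x) = g x := by
  have hker : ∀ u, Q.redU u = 0 → ∃ w, u = (PowerSeries.X : PowerSeries k) • w := fun u hu =>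
    (mem_hpow_one _).1 ((Q.isReductionOf.isReductionU.ker u).1 hu)
  have h1 : ∀ u : Uh, ∃ b : U →+ N, ∀ v, b (Q.redU v) = g (u ⊗ₜ v) := fun u =>
    exists_factor_of_surjective (π := (Q.redU : Uh →+ U)) Q.redU_surjective
      (g.toAddMonoidHom.comp (TensorProduct.mk (PowerSeries k) Uh Uh u).toAddMonoidHom)
      (fun v hv => by
        obtain ⟨w, rfl⟩ := hker v hv
        change g (u ⊗ₜ _) = 0
        rw [tmul_smul, hg])
  choose b hb using h1
  have hb' : ∀ {f f' : U →+ N}, (∀ v, f (Q.redU v) = f' (Q.redU v)) → f = f' := fun hf =>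
    AddMonoidHom.ext fun v => by
      obtain ⟨v, rfl⟩ := Q.redU_surjective v
      exact hf v
  obtain ⟨c, hc⟩ := exists_factor_of_surjective (π := (Q.redU : Uh →+ U)) Q.redU_surjective
    (AddMonoidHom.mk' b fun u w => hb' fun v => by
      rw [AddMonoidHom.add_apply, hb, hb, hb, add_tmul, map_add])
    (fun u hu => by
      obtain ⟨w, rfl⟩ := hker u hu
      refine hb' fun v => ?_
      rw [AddMonoidHom.mk'_apply, hb, ← smul_tmul', hg, AddMonoidHom.zero_apply])
  have hc' : ∀ u v, c (Q.redU u) (Q.redU v) = g (u ⊗ₜ v) := fun u v =>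
    (congrArg (fun f : U →+ N => f (Q.redU v)) (hc u)).trans (hb u v)
  refine ⟨TensorProduct.liftAddHom c fun r u v => ?_, fun x => ?_⟩
  · obtain ⟨u, rfl⟩ := Q.redU_surjective u
    obtain ⟨v, rfl⟩ := Q.redU_surjective v
    have := Q.redU_smul (PowerSeries.C r)
    simp only [PowerSeries.constantCoeff_C] at this
    rw [← this, ← this, hc', hc', smul_tmul]
  · induction x with
    | zero => simp
    | tmul u v => exact hc' u v
    | add x y hx hy => rw [map_add, map_add, hx, hy, map_add]

/-- The relations over U lift to relations over U_h, and an element with zero reduction is a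
multiple of h up to them. Hence the quotient over U is level 1 of the completed one. -/
theorem redT_mem_balancedRel_iff {f g : A → U → U} {f' g' : Ah → Uh → Uh}
    (hf : ∀ a u, Q.redU (f' a u) = f (Q.redA a) (Q.redU u))
    (hg : ∀ a u, Q.redU (g' a u) = g (Q.redA a) (Q.redU u)) (x : Uh ⊗[PowerSeries k] Uh) :
    Q.redT x ∈ balancedRel k f g ↔ x ∈ supPow (balancedRel (PowerSeries k) f' g') 1 := by
  constructor
  · intro hx
    obtain ⟨σ, hσ⟩ := Q.exists_factor_redT (supPow (balancedRel (PowerSeries k) f' g') 1).mkQ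
      (fun x => by
        rw [Submodule.mkQ_apply, Submodule.Quotient.mk_eq_zero]
        simpa using pow_smul_mem_supPow (n := 1) x)
    rw [← Submodule.Quotient.mk_eq_zero, ← Submodule.mkQ_apply, ← hσ]
    refine Submodule.span_induction (p := fun y _ => σ y = 0) ?_ (map_zero _)
      (fun x y _ _ hx hy => by rw [map_add, hx, hy, add_zero]) (fun r y _ hy => ?_) hx
    · rintro _ ⟨a, u, v, rfl⟩
      obtain ⟨a, rfl⟩ := Q.isReductionOf.isReductionA.surjective a
      obtain ⟨u, rfl⟩ := Q.redU_surjective u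
      obtain ⟨v, rfl⟩ := Q.redU_surjective v
      rw [← hf, ← hg, ← redT_tmul, ← redT_tmul, ← map_sub, hσ, Submodule.mkQ_apply,
        Submodule.Quotient.mk_eq_zero]
      exact le_supPow (Submodule.subset_span ⟨a, u, v, rfl⟩)
    -- A scalar of k is lifted to the constant power series.
    · obtain ⟨y, rfl⟩ := Q.redT_surjective y
      have := Q.redT_smul (PowerSeries.C r) y
      rw [PowerSeries.constantCoeff_C] at this
      rw [← this, hσ, map_smul, ← hσ, hy, smul_zero]
  · intro hx
    obtain ⟨z, hz⟩ := mem_supPow.1 hx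
    have h1 : Q.redT (x - (PowerSeries.X : PowerSeries k) ^ 1 • z) ∈ balancedRel k f g := by
      refine Submodule.span_induction (p := fun y _ => Q.redT y ∈ balancedRel k f g) ?_ (by simp)
        (fun x y _ _ hx hy => by rw [map_add]; exact add_mem hx hy)
        (fun r y _ hy => by rw [redT_smul]; exact Submodule.smul_mem _ _ hy) hz
      rintro _ ⟨a, u, v, rfl⟩
      rw [map_sub, redT_tmul, redT_tmul, hf, hg]
      exact Submodule.subset_span ⟨_, _, _, rfl⟩
    rw [map_sub, redT_smul] at h1
    simpa using h1

theorem redT_mem_takRel_iff (x : Uh ⊗[PowerSeries k] Uh) :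
    Q.redT x ∈ B.takRel ↔ x ∈ supPow Bh.takRel 1 :=
  Q.redT_mem_balancedRel_iff (fun a u => by rw [map_mul, Q.redU_t])
    (fun a u => by rw [map_mul, Q.redU_s]) x

theorem redT_mem_leftRel_iff (x : Uh ⊗[PowerSeries k] Uh) :
    Q.redT x ∈ B.leftRel ↔ x ∈ supPow Bh.leftRel 1 :=
  Q.redT_mem_balancedRel_iff (fun a u => by rw [map_mul, Q.redU_t])
    (fun a u => by rw [map_mul, Q.redU_t]) x

theorem redT_mem_rightRel_iff (x : Uh ⊗[PowerSeries k] Uh) :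
    Q.redT x ∈ B.rightRel ↔ x ∈ supPow Bh.rightRel 1 :=
  Q.redT_mem_balancedRel_iff (fun a u => by rw [map_mul, Q.redU_s])
    (fun a u => by rw [map_mul, Q.redU_s]) x

/-- Both Galois maps at once: j is v ↦ 1 ⊗ v or v ↦ v ⊗ 1. The extension f to the completion induces
α at level 1, so f is bijective by `bijective_of_mod`, the target having no torsion. -/
theorem exists_galois (j : Uh →ₗ[PowerSeries k] Uh ⊗[PowerSeries k] Uh)
    (L : Submodule (PowerSeries k) (Uh ⊗[PowerSeries k] Uh))
    (hL : ∀ x ∈ L, Bh.galoisMap j x = 0) (j₀ : U → U ⊗[k] U)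
    (hj : ∀ v, Q.redT (j v) = j₀ (Q.redU v)) (L₀ : Submodule k (U ⊗[k] U))
    (hL₀ : ∀ x, Q.redT x ∈ L₀ → x ∈ supPow L 1) (α : ((U ⊗[k] U) ⧸ L₀) ≃ₗ[k] B.TakTensor)
    (hα : ∀ (u v : U) (x : U ⊗[k] U), B.Δ u = Submodule.Quotient.mk x →
      α (Submodule.Quotient.mk (u ⊗ₜ[k] v)) = Submodule.Quotient.mk (x * j₀ v))
    (tors : ∀ z : Bh.TakCompl, (PowerSeries.X : PowerSeries k) • z = 0 → z = 0) :
    ∃ e : AdicCompletion (hIdeal k) ((Uh ⊗[PowerSeries k] Uh) ⧸ L) ≃ₗ[PowerSeries k] Bh.TakCompl,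
      ∀ (u v : Uh) (n : ℕ) (x : Uh ⊗[PowerSeries k] Uh), RepMod k Bh.takRel n (Bh.Δ u) x →
        RepMod k Bh.takRel n (e (toCompletion k L (u ⊗ₜ v))) (x * j v) := by
  obtain ⟨f, hf⟩ := exists_extension_completion (powComplete_completion Bh.takRel)
    (Bh.galoisMap j) hL
  have key : ∀ x z, RepMod k Bh.takRel 1 (Bh.galoisMap j x) z →
      α (Submodule.Quotient.mk (Q.redT x)) = Submodule.Quotient.mk (Q.redT z) := by
    -- One representative suffices, because two of them differ by an element that reduces into
    -- `takRel`.
    have key' : ∀ x, ∃ z, RepMod k Bh.takRel 1 (Bh.galoisMap j x) z ∧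
        α (Submodule.Quotient.mk (Q.redT x)) = Submodule.Quotient.mk (Q.redT z) := fun x => by
      induction x with
      | zero => exact ⟨0, by rw [map_zero, RepMod.zero_iff]; exact zero_mem _, by simp⟩
      | tmul u v =>
        obtain ⟨y, hy⟩ := RepMod.exists_rep Bh.takRel 1 (Bh.Δ u)
        refine ⟨_, TopLeftBialgebroid.rep_galoisMap j hy v, ?_⟩
        rw [redT_tmul, redT_mul, hj]
        refine hα _ _ _ ?_
        obtain ⟨r, p, q, rfl⟩ := exists_fin_sum y
        rw [Q.redU_Δ u r p q hy, map_sum]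
        rfl
      | add x y hx hy =>
        obtain ⟨z, hz, hz'⟩ := hx
        obtain ⟨w, hw, hw'⟩ := hy
        refine ⟨z + w, by rw [map_add]; exact hz.add hw, ?_⟩
        rw [map_add, map_add, Submodule.Quotient.mk_add, Submodule.Quotient.mk_add, map_add, hz',
          hw']
    intro x z hz
    obtain ⟨z', hz', h⟩ := key' x
    rw [h, Submodule.Quotient.eq, ← map_sub]
    exact (Q.redT_mem_takRel_iff _).2 (hz'.sub_mem hz)
  have bij : Function.Bijective f := by
    refine bijective_of_mod (powComplete_completion L) (powComplete_completion Bh.takRel).sep tors f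
      (fun y => ?_) (fun x hx => ?_)
    · obtain ⟨y', hy'⟩ := RepMod.exists_rep Bh.takRel 1 y
      obtain ⟨w, hw⟩ := α.surjective (Submodule.Quotient.mk (Q.redT y'))
      obtain ⟨w, rfl⟩ := Submodule.Quotient.mk_surjective _ w
      obtain ⟨w, rfl⟩ := Q.redT_surjective w
      obtain ⟨z, hz⟩ := RepMod.exists_rep Bh.takRel 1 (Bh.galoisMap j w)
      refine ⟨toCompletion k L w, ?_⟩
      rw [hf, RepMod.mem_hpow_iff' (hy'.sub hz), ← Q.redT_mem_takRel_iff, map_sub,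
        ← Submodule.Quotient.eq, ← hw, key w z hz]
    · obtain ⟨w, hw⟩ := RepMod.exists_rep L 1 x
      obtain ⟨z, hz⟩ := RepMod.exists_rep Bh.takRel 1 (Bh.galoisMap j w)
      -- An element of the completion is replaced by an algebraic tensor congruent to it modulo h,
      -- to which `key` applies.
      have h1 : toCompletion k L w - x ∈ hpow (PowerSeries.X : PowerSeries k) _ 1 :=
        (RepMod.mem_hpow_iff' ((RepMod.of w).sub hw)).2 (by rw [sub_self]; exact zero_mem _)
      have h2 := add_mem (map_mem_hpow _ f h1) hx
      rw [← map_add, sub_add_cancel, hf, RepMod.mem_hpow_iff' hz, ← Q.redT_mem_takRel_iff,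
        ← Submodule.Quotient.mk_eq_zero, ← key w z hz, LinearEquiv.map_eq_zero_iff,
        Submodule.Quotient.mk_eq_zero] at h2
      exact (RepMod.mem_hpow_iff' hw).2 (hL₀ w h2)
  refine ⟨LinearEquiv.ofBijective f bij, fun u v n x hx => ?_⟩
  rw [LinearEquiv.ofBijective_apply, hf]
  exact TopLeftBialgebroid.rep_galoisMap j hx v

include Q in
theorem nonempty_leftHopf (hB : B.IsLeftHopf)
    (tors : ∀ z : Bh.TakCompl, (PowerSeries.X : PowerSeries k) • z = 0 → z = 0) :
    Nonempty Bh.LeftHopf := by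
  obtain ⟨α, hα⟩ := hB
  obtain ⟨e, he⟩ := Q.exists_galois (TopLeftBialgebroid.inrₗ _ Uh) Bh.leftRel
    TopLeftBialgebroid.galoisMap_inr_leftRel (fun v => 1 ⊗ₜ v)
    (fun v => by simp [TopLeftBialgebroid.inrₗ, redT_tmul]) B.leftRel
    (fun x => (Q.redT_mem_leftRel_iff x).1) α hα tors
  exact ⟨⟨e, he⟩⟩

include Q in
theorem nonempty_rightHopf (hB : B.IsRightHopf)
    (tors : ∀ z : Bh.TakCompl, (PowerSeries.X : PowerSeries k) • z = 0 → z = 0) :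
    Nonempty Bh.RightHopf := by
  obtain ⟨α, hα⟩ := hB
  obtain ⟨e, he⟩ := Q.exists_galois (TopLeftBialgebroid.inlₗ _ Uh) Bh.rightRel
    TopLeftBialgebroid.galoisMap_inl_rightRel (fun v => v ⊗ₜ 1)
    (fun v => by simp [TopLeftBialgebroid.inlₗ, redT_tmul]) B.rightRel
    (fun x => (Q.redT_mem_rightRel_iff x).1) α hα tors
  exact ⟨⟨e, he⟩⟩

end Quantisation


/-! ### Translation maps modulo `hⁿ` -/

namespace TopLeftBialgebroid

variable {k : Type v} {A U : Type u} [CommRing k] [Ring A] [Ring U]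
  [Algebra (PowerSeries k) A] [Algebra (PowerSeries k) U] {B : TopLeftBialgebroid k A U} {n : ℕ}

section

variable {j e : U →ₗ[PowerSeries k] U ⊗[PowerSeries k] U}

/-- Writing β for the Galois map, β((a ⊗ 1) x (1 ⊗ b)) = Δ(a) β(x) j(b). All identities for
translation maps rest on this formula. -/
theorem rep_galoisMap_mul (hj : ∀ v w, j (v * w) = j v * j w) {a : U}
    {y : U ⊗[PowerSeries k] U} (hy : B.RepΔ n a y) {x z : U ⊗[PowerSeries k] U}
    (hz : RepMod k B.takRel n (B.galoisMap j x) z) (b : U) :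
    RepMod k B.takRel n (B.galoisMap j ((a ⊗ₜ 1) * x * (1 ⊗ₜ b))) (y * z * j b) := by
  -- The choice of representative is immaterial: multiplication by Δ(a) on the left and by any
  -- tensor on the right respects the relations.
  suffices h : ∃ z', RepMod k B.takRel n (B.galoisMap j x) z' ∧
      RepMod k B.takRel n (B.galoisMap j ((a ⊗ₜ 1) * x * (1 ⊗ₜ b))) (y * z' * j b) by
    obtain ⟨z', hz', h'⟩ := h
    refine h'.congr ?_
    rw [← sub_mul, ← mul_sub]
    exact mul_mem_supPow (rep_mul_mem_supPow hy (hz'.sub_mem hz)) _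
  clear hz z
  induction x with
  | zero =>
    refine ⟨0, by simp [RepMod.zero_iff], by simp [RepMod.zero_iff]⟩
  | tmul u v =>
    obtain ⟨x, hx⟩ := RepMod.exists_rep B.takRel n (B.Δ u)
    refine ⟨_, rep_galoisMap j hx v, ?_⟩
    rw [Algebra.TensorProduct.tmul_mul_tmul, Algebra.TensorProduct.tmul_mul_tmul, one_mul, mul_one,
      ← mul_assoc, mul_assoc, ← hj]
    exact rep_galoisMap j (RepΔ.mul hy hx) _
  | add x x' hx hx' =>
    obtain ⟨z, hz, h⟩ := hx
    obtain ⟨z', hz', h'⟩ := hx'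
    refine ⟨z + z', by rw [map_add]; exact hz.add hz', ?_⟩
    rw [mul_add, add_mul, map_add, mul_add, add_mul]
    exact h.add h'

variable (B j e n) in
/-- `x` is sent by the Galois map of `j` to `e(u)`, modulo `hⁿ`. -/
def IsTransl (u : U) (x : U ⊗[PowerSeries k] U) : Prop :=
  RepMod k B.takRel n (B.galoisMap j x) (e u)

theorem IsTransl.exists_rep {u : U} {r : ℕ} {v w : Fin r → U}
    (h : IsTransl B n j e u (∑ i, v i ⊗ₜ w i)) : ∃ y : Fin r → U ⊗[PowerSeries k] U,
      (∀ i, B.RepΔ n (v i) (y i)) ∧ ∑ i, y i * j (w i) - e u ∈ supPow B.takRel n := by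
  choose y hy using fun i => RepMod.exists_rep B.takRel n (B.Δ (v i))
  refine ⟨y, hy, ?_⟩
  rw [IsTransl, map_sum] at h
  exact (RepMod.sum fun i _ => rep_galoisMap j (hy i) (w i)).sub_mem h

/-- The Galois map sends u₊u'₊ ⊗ u'₋u₋ to ∑ Δ(v_i) e(u') j(w_i). The two legs commute, so this is ∑
Δ(v_i) j(w_i) e(u') = e(u) e(u'). -/
theorem IsTransl.mul (hj : ∀ v w, j (v * w) = j v * j w) (he : ∀ v w, e (v * w) = e v * e w)
    (hje : ∀ v w, e v * j w = j w * e v) {u u' : U} {r : ℕ} {v w : Fin r → U}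
    {x' : U ⊗[PowerSeries k] U} (h : IsTransl B n j e u (∑ i, v i ⊗ₜ w i))
    (h' : IsTransl B n j e u' x') :
    IsTransl B n j e (u * u') (∑ i, (v i ⊗ₜ 1) * x' * (1 ⊗ₜ w i)) := by
  obtain ⟨y, hy, h⟩ := h.exists_rep
  rw [IsTransl, map_sum]
  refine (RepMod.sum fun i _ => rep_galoisMap_mul hj (hy i) h' (w i)).congr ?_
  rw [he]
  simp only [mul_assoc, hje]
  simp only [← mul_assoc]
  rw [← Finset.sum_mul, ← sub_mul]
  exact mul_mem_supPow h _

/-- Under the Galois map of e, x_i becomes j(w_i), so the sum becomes ∑ Δ(v_i) j(w_i) = e(u), which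
is also the image of 1 ⊗ u. -/
theorem IsTransl.cross (he : ∀ v w, e (v * w) = e v * e w) (he' : e 1 = 1) {u : U} {r : ℕ}
    {v w : Fin r → U} {x : Fin r → U ⊗[PowerSeries k] U}
    (h : IsTransl B n j e u (∑ i, v i ⊗ₜ w i)) (h' : ∀ i, IsTransl B n e j (w i) (x i)) :
    RepMod k B.takRel n (B.galoisMap e (∑ i, (v i ⊗ₜ 1) * x i - 1 ⊗ₜ u)) 0 := by
  obtain ⟨y, hy, h⟩ := h.exists_rep
  rw [map_sub, map_sum]
  have h1 : RepMod k B.takRel n (∑ i, B.galoisMap e ((v i ⊗ₜ 1) * x i)) (∑ i, y i * j (w i)) :=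
    RepMod.sum fun i _ => by
      have := rep_galoisMap_mul he (hy i) (h' i) 1
      rwa [he', mul_one, ← Algebra.TensorProduct.one_def, mul_one] at this
  have h2 := rep_galoisMap e (B.isCoproduct n).one u
  rw [one_mul] at h2
  exact (h1.sub h2).congr (by rwa [sub_zero])

variable {W : Submodule (PowerSeries k) (U ⊗[PowerSeries k] U)}
  (E : AdicCompletion (hIdeal k) ((U ⊗[PowerSeries k] U) ⧸ W) ≃ₗ[PowerSeries k] B.TakCompl)

theorem galois_toCompletion
    (hE : ∀ (u v : U) (n : ℕ) (x : U ⊗[PowerSeries k] U), B.RepΔ n u x →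
      RepMod k B.takRel n (E (toCompletion k W (u ⊗ₜ v))) (x * j v)) (x : U ⊗[PowerSeries k] U) :
    E (toCompletion k W x) = B.galoisMap j x := by
  induction x with
  | zero => simp [toCompletion]
  | tmul u v =>
    refine RepMod.ext fun n => ?_
    obtain ⟨x, hx⟩ := RepMod.exists_rep B.takRel n (B.Δ u)
    exact ⟨_, hE u v n x hx, rep_galoisMap j hx v⟩
  | add x y hx hy =>
    rw [map_add, ← hx, ← hy, ← map_add]
    rfl

variable (hE : ∀ x, E (toCompletion k W x) = B.galoisMap j x)

include hE

/-- The inverse of E is linear and so preserves multiples of h^n: congruences may be verified after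
applying the Galois map. -/
theorem mem_supPow_of_galoisMap {x : U ⊗[PowerSeries k] U}
    (hx : RepMod k B.takRel n (B.galoisMap j x) 0) : x ∈ supPow W n := by
  rw [← hE, RepMod.mem_hpow_iff] at hx
  have := map_mem_hpow _ E.symm.toLinearMap hx
  rw [LinearEquiv.coe_coe, E.symm_apply_apply] at this
  exact (RepMod.mem_hpow_iff' (RepMod.of x)).1 this

theorem rep_symm_iff (u : U) (x : U ⊗[PowerSeries k] U) :
    RepMod k W n (E.symm (toCompletion k B.takRel (e u))) x ↔ IsTransl B n j e u x := by
  have key : ∀ x, RepMod k W n (E.symm (toCompletion k B.takRel (e u))) x →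
      IsTransl B n j e u x := fun x hx => by
    have h1 := (RepMod.mem_hpow_iff' (hx.sub (RepMod.of x))).2 (by rw [sub_self]; exact zero_mem _)
    have h2 := map_mem_hpow _ E.toLinearMap h1
    rw [LinearEquiv.coe_coe, map_sub, E.apply_symm_apply, hE] at h2
    have h3 := ((RepMod.of (k := k) (W := B.takRel) (n := n) (e u)).sub
      (RepMod.mem_hpow_iff.2 h2))
    rwa [sub_sub_cancel, sub_zero] at h3
  refine ⟨key x, fun hx => ?_⟩
  obtain ⟨x', hx'⟩ := RepMod.exists_rep W n (E.symm (toCompletion k B.takRel (e u)))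
  refine hx'.congr (mem_supPow_of_galoisMap E hE ?_)
  rw [map_sub, ← sub_self (e u)]
  exact (key x' hx').sub hx

end

theorem inrₗ_mul (v w : U) : inrₗ (PowerSeries k) U (v * w) = inrₗ _ U v * inrₗ _ U w := by
  simp [inrₗ]

theorem inlₗ_mul (v w : U) : inlₗ (PowerSeries k) U (v * w) = inlₗ _ U v * inlₗ _ U w := by
  simp [inlₗ]

theorem inlₗ_mul_inrₗ (v w : U) :
    inlₗ (PowerSeries k) U v * inrₗ _ U w = inrₗ _ U w * inlₗ _ U v := by
  simp [inlₗ, inrₗ]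

namespace LeftHopf

variable (Hl : B.LeftHopf)

theorem galois_toCompletion (x : U ⊗[PowerSeries k] U) :
    Hl.galois (toCompletion k B.leftRel x) = B.galoisMap (inrₗ _ U) x :=
  TopLeftBialgebroid.galois_toCompletion _ Hl.galois_tmul x

include Hl in
theorem mem_leftRel {x : U ⊗[PowerSeries k] U}
    (hx : RepMod k B.takRel n (B.galoisMap (inrₗ _ U) x) 0) : x ∈ supPow B.leftRel n :=
  mem_supPow_of_galoisMap _ Hl.galois_toCompletion hx

theorem rep_translation_iff {u : U} {x : U ⊗[PowerSeries k] U} :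
    RepMod k B.leftRel n (Hl.translation u) x ↔ IsTransl B n (inrₗ _ U) (inlₗ _ U) u x :=
  rep_symm_iff (e := inlₗ _ U) _ Hl.galois_toCompletion u x

/-- The translation map as a linear map. -/
def translationₗ : U →ₗ[PowerSeries k] B.LeftCompl :=
  Hl.galois.symm.toLinearMap.comp
    (((AdicCompletion.of _ _).comp B.takRel.mkQ).comp (inlₗ (PowerSeries k) U))

theorem translationₗ_apply (u : U) : Hl.translationₗ u = Hl.translation u := rfl

theorem rep_translation_s (a : A) : RepMod k B.leftRel n (Hl.translation (B.s a)) (B.s a ⊗ₜ 1) := by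
  rw [rep_translation_iff]
  have := rep_galoisMap (inrₗ _ U) (repΔ_s (B := B) (n := n) a) 1
  simpa [inrₗ, inlₗ, IsTransl] using this

/-- t(a)u₊ ⊗ u₋ = u₊ ⊗ u₋t(a), since the Galois map sends both to u ⊗ t(a). This makes the action on
P ⊗ M well defined on the balanced tensor product. -/
theorem rep_translation_balanced {u : U} {x : U ⊗[PowerSeries k] U}
    (hx : RepMod k B.leftRel n (Hl.translation u) x) (a : A) :
    (B.t (op a) ⊗ₜ 1) * x - x * (1 ⊗ₜ B.t (op a)) ∈ supPow B.leftRel n := by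
  rw [rep_translation_iff] at hx
  refine Hl.mem_leftRel ?_
  have h1 := rep_galoisMap_mul inrₗ_mul (repΔ_t a) hx 1
  have h2 := rep_galoisMap_mul inrₗ_mul (B.isCoproduct n).one hx (B.t (op a))
  rw [map_sub]
  have h3 := (h1.sub h2).congr (y := 0) (by simp [inrₗ, inlₗ, ← Algebra.TensorProduct.one_def])
  simpa [← Algebra.TensorProduct.one_def] using h3

theorem rep_translation_mul {u u' : U} {r : ℕ} {v w : Fin r → U} {x' : U ⊗[PowerSeries k] U}
    (h : RepMod k B.leftRel n (Hl.translation u) (∑ i, v i ⊗ₜ w i))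
    (h' : RepMod k B.leftRel n (Hl.translation u') x') :
    RepMod k B.leftRel n (Hl.translation (u * u')) (∑ i, (v i ⊗ₜ 1) * x' * (1 ⊗ₜ w i)) := by
  rw [rep_translation_iff] at h h' ⊢
  exact h.mul inrₗ_mul inlₗ_mul inlₗ_mul_inrₗ h'

end LeftHopf

namespace RightHopf

variable (Hr : B.RightHopf)

theorem galois_toCompletion (x : U ⊗[PowerSeries k] U) :
    Hr.galois (toCompletion k B.rightRel x) = B.galoisMap (inlₗ _ U) x :=
  TopLeftBialgebroid.galois_toCompletion _ Hr.galois_tmul x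

include Hr in
theorem mem_rightRel {x : U ⊗[PowerSeries k] U}
    (hx : RepMod k B.takRel n (B.galoisMap (inlₗ _ U) x) 0) : x ∈ supPow B.rightRel n :=
  mem_supPow_of_galoisMap _ Hr.galois_toCompletion hx

theorem rep_translation_iff {u : U} {x : U ⊗[PowerSeries k] U} :
    RepMod k B.rightRel n (Hr.translation u) x ↔ IsTransl B n (inlₗ _ U) (inrₗ _ U) u x :=
  rep_symm_iff (e := inrₗ _ U) _ Hr.galois_toCompletion u x

/-- The translation map as a linear map. -/
def translationₗ : U →ₗ[PowerSeries k] B.RightCompl :=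
  Hr.galois.symm.toLinearMap.comp
    (((AdicCompletion.of _ _).comp B.takRel.mkQ).comp (inrₗ (PowerSeries k) U))

theorem translationₗ_apply (u : U) : Hr.translationₗ u = Hr.translation u := rfl

theorem rep_translation_t (a : A) :
    RepMod k B.rightRel n (Hr.translation (B.t (op a))) (B.t (op a) ⊗ₜ 1) := by
  rw [rep_translation_iff]
  have := rep_galoisMap (inlₗ _ U) (repΔ_t (B := B) (n := n) a) 1
  simpa [inrₗ, inlₗ, IsTransl] using this

/-- Both sides go to s(a) ⊗ u under the Galois map. This makes uφ compatible with the action through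
s. -/
theorem rep_translation_balanced {u : U} {x : U ⊗[PowerSeries k] U}
    (hx : RepMod k B.rightRel n (Hr.translation u) x) (a : A) :
    (B.s a ⊗ₜ 1) * x - x * (1 ⊗ₜ B.s a) ∈ supPow B.rightRel n := by
  rw [rep_translation_iff] at hx
  refine Hr.mem_rightRel ?_
  have h1 := rep_galoisMap_mul inlₗ_mul (repΔ_s a) hx 1
  have h2 := rep_galoisMap_mul inlₗ_mul (B.isCoproduct n).one hx (B.s a)
  rw [map_sub]
  have h3 := (h1.sub h2).congr (y := 0) (by simp [inrₗ, inlₗ, ← Algebra.TensorProduct.one_def])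
  simpa [← Algebra.TensorProduct.one_def] using h3

theorem rep_translation_mul {u u' : U} {r : ℕ} {v w : Fin r → U} {x' : U ⊗[PowerSeries k] U}
    (h : RepMod k B.rightRel n (Hr.translation u) (∑ i, v i ⊗ₜ w i))
    (h' : RepMod k B.rightRel n (Hr.translation u') x') :
    RepMod k B.rightRel n (Hr.translation (u * u')) (∑ i, (v i ⊗ₜ 1) * x' * (1 ⊗ₜ w i)) := by
  rw [rep_translation_iff] at h h' ⊢
  exact h.mul inlₗ_mul inrₗ_mul (fun v w => (inlₗ_mul_inrₗ w v).symm) h'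

end RightHopf

variable (Hl : B.LeftHopf) (Hr : B.RightHopf)

theorem translation_cross_right {u : U} {r : ℕ} {v w : Fin r → U}
    {x : Fin r → U ⊗[PowerSeries k] U}
    (h : RepMod k B.leftRel n (Hl.translation u) (∑ i, v i ⊗ₜ w i))
    (h' : ∀ i, RepMod k B.rightRel n (Hr.translation (w i)) (x i)) :
    ∑ i, (v i ⊗ₜ 1) * x i - 1 ⊗ₜ u ∈ supPow B.rightRel n := by
  simp only [LeftHopf.rep_translation_iff, RightHopf.rep_translation_iff] at h h'
  exact Hr.mem_rightRel (h.cross inlₗ_mul rfl h')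

theorem translation_cross_left {u : U} {r : ℕ} {v w : Fin r → U}
    {x : Fin r → U ⊗[PowerSeries k] U}
    (h : RepMod k B.rightRel n (Hr.translation u) (∑ i, v i ⊗ₜ w i))
    (h' : ∀ i, RepMod k B.leftRel n (Hl.translation (w i)) (x i)) :
    ∑ i, (v i ⊗ₜ 1) * x i - 1 ⊗ₜ u ∈ supPow B.leftRel n := by
  simp only [LeftHopf.rep_translation_iff, RightHopf.rep_translation_iff] at h h'
  exact Hl.mem_leftRel (h.cross inrₗ_mul rfl h')

end TopLeftBialgebroid


/-! ### Limits along representatives -/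

section ComplLift

variable {k : Type*} [CommRing k] {T : Type*} [AddCommGroup T] [Module (PowerSeries k) T]
  {W : Submodule (PowerSeries k) T} {X : Type*} [AddCommGroup X] [Module (PowerSeries k) X]
  (hX : PowComplete (PowerSeries.X : PowerSeries k) X) (act : T →ₗ[PowerSeries k] X)
  (hact : ∀ x ∈ W, act x = 0)

/-- The limit of `act x`, for `x` converging to a given element of the completion. -/
def complLift : AdicCompletion (hIdeal k) (T ⧸ W) →ₗ[PowerSeries k] X :=
  (exists_extension_completion hX act hact).choose

variable {z : AdicCompletion (hIdeal k) (T ⧸ W)}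

theorem complLift_sub_mem {n : ℕ} {x : T} (hx : RepMod k W n z x) :
    complLift hX act hact z - act x ∈ hpow (PowerSeries.X : PowerSeries k) X n := by
  rw [← (exists_extension_completion hX act hact).choose_spec]
  change complLift hX act hact z - complLift hX act hact _ ∈ _
  rw [← map_sub]
  exact map_mem_hpow _ _
    ((RepMod.mem_hpow_iff' (hx.sub (RepMod.of x))).2 (by rw [sub_self]; exact zero_mem _))

/-- The module axioms for limits are proved through this: a candidate is compared with one
convenient representative modulo each h^n. -/
theorem complLift_unique {y : X} (hy : ∀ n, ∃ x, RepMod k W n z x ∧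
    y - act x ∈ hpow (PowerSeries.X : PowerSeries k) X n) : complLift hX act hact z = y :=
  hX.sep.eq fun n => by
    obtain ⟨x, hx, hyx⟩ := hy n
    rw [← sub_sub_sub_cancel_right _ _ (act x)]
    exact sub_mem (complLift_sub_mem hX act hact hx) hyx

include hact in
theorem map_supPow_mem_hpow {n : ℕ} {x : T} (hx : x ∈ supPow W n) :
    act x ∈ hpow (PowerSeries.X : PowerSeries k) X n := by
  obtain ⟨z, hz⟩ := mem_supPow.1 hx
  have := hact _ hz
  rw [map_sub, map_smul, sub_eq_zero] at this
  rw [this]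
  exact smul_mem_hpow _ n _

end ComplLift

namespace TopLeftBialgebroid

variable {k : Type v} {A U : Type u} [CommRing k] [Ring A] [Ring U]
  [Algebra (PowerSeries k) A] [Algebra (PowerSeries k) U] (B : TopLeftBialgebroid k A U)

/-! ### The right `U`-module `P ⊗ M` -/

section Tensor

variable (P M : Type*) [AddCommGroup P] [Module Uᵐᵒᵖ P] [AddCommGroup M] [Module U M]

/-- The class of `p ⊗ m`. -/
def tmk : P →+ M →+ B.ModTensor P M := balMk _ _

variable {P M} in
theorem tmk_balanced (a : A) (p : P) (m : M) :
    B.tmk P M (op (B.t (op a)) • p) m = B.tmk P M p (B.t (op a) • m) := balMk_balanced a p m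

variable {B P M} in
theorem tmk_hom_ext {Y : Type*} [AddCommGroup Y] {φ ψ : B.ModTensor P M →+ Y}
    (hφψ : ∀ p m, φ (B.tmk P M p m) = ψ (B.tmk P M p m)) : φ = ψ := bal_hom_ext hφψ

variable [Module (PowerSeries k) M] [IsScalarTower (PowerSeries k) U M]

/-- Multiplication by a scalar on `P ⊗ M`. -/
def tensorSmul (r : PowerSeries k) : B.ModTensor P M →+ B.ModTensor P M :=
  balLift (AddMonoidHom.mk' (fun p => (B.tmk P M p).comp (DistribSMul.toAddMonoidHom M r))
    (fun p q => by ext m; simp)) (fun a p m => by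
      change B.tmk P M (op (B.t (op a)) • p) (r • m) = B.tmk P M p (r • B.t (op a) • m)
      rw [tmk_balanced, smul_comm])

theorem tensorSmul_tmk (r : PowerSeries k) (p : P) (m : M) :
    B.tensorSmul P M r (B.tmk P M p m) = B.tmk P M p (r • m) := balLift_balMk _ _ _ _

instance modTensorModule : Module (PowerSeries k) (B.ModTensor P M) where
  smul r z := B.tensorSmul P M r z
  one_smul := DFunLike.congr_fun (tmk_hom_ext (φ := B.tensorSmul P M 1) (ψ := .id _)
    fun p m => by simp [tensorSmul_tmk])
  mul_smul r r' := DFunLike.congr_fun (tmk_hom_ext (φ := B.tensorSmul P M (r * r'))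
    (ψ := (B.tensorSmul P M r).comp (B.tensorSmul P M r'))
    fun p m => by simp [tensorSmul_tmk, mul_smul])
  smul_zero r := map_zero _
  smul_add r := map_add _
  add_smul r r' := DFunLike.congr_fun (tmk_hom_ext (φ := B.tensorSmul P M (r + r'))
    (ψ := B.tensorSmul P M r + B.tensorSmul P M r')
    fun p m => by simp [tensorSmul_tmk, add_smul])
  zero_smul := DFunLike.congr_fun (tmk_hom_ext (φ := B.tensorSmul P M 0) (ψ := 0)
    fun p m => by simp [tensorSmul_tmk])

variable {P M}

theorem smul_tmk (r : PowerSeries k) (p : P) (m : M) :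
    r • B.tmk P M p m = B.tmk P M p (r • m) := B.tensorSmul_tmk P M r p m

theorem tmk_smul [Module (PowerSeries k) P] [IsScalarTower (PowerSeries k) Uᵐᵒᵖ P]
    (r : PowerSeries k) (p : P) (m : M) : B.tmk P M (r • p) m = r • B.tmk P M p m := by
  rw [← B.t_algebraMap_smul, tmk_balanced, smul_tmk]
  congr 1
  rw [show op (algebraMap (PowerSeries k) A r) = algebraMap (PowerSeries k) Aᵐᵒᵖ r from rfl,
    AlgHom.commutes, algebraMap_smul]

variable {B}

/-- A dual basis for the action through t makes P ⊗ M a direct summand of a finite power of M, so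
the algebraic tensor product is already complete. -/
theorem powComplete_modTensor (Y : CounitalAeRing.LeftBasis B.toCounitalAeRing P)
    (hM : PowComplete (PowerSeries.X : PowerSeries k) M) :
    PowComplete (PowerSeries.X : PowerSeries k) (B.ModTensor P M) :=
  (hM.pi (ι := Fin Y.n)).of_retract
    { toFun := fun z i => Y.coord CounitalAeRing.isRightAction_smul i z
      map_add' := fun z w => funext fun i => map_add _ z w
      map_smul' := fun r z => funext fun i => by
        refine DFunLike.congr_fun (tmk_hom_ext (B := B)
          (φ := (Y.coord CounitalAeRing.isRightAction_smul i).comp (B.tensorSmul P M r))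
          (ψ := (DistribSMul.toAddMonoidHom M r).comp
            (Y.coord CounitalAeRing.isRightAction_smul i)) fun p m => ?_) z
        rw [AddMonoidHom.comp_apply, tensorSmul_tmk]
        refine (Y.coord_balMk _ i p _).trans ?_
        refine .trans ?_ (congrArg (r • ·) (Y.coord_balMk _ i p m)).symm
        exact smul_comm _ _ _ }
    { toFun := fun v => ∑ i, B.tmk P M (Y.e i) (v i)
      map_add' := fun v w => by simp [Finset.sum_add_distrib]
      map_smul' := fun r v => by simp [Finset.smul_sum, smul_tmk] }
    (fun z => Y.sum_balMk_coord CounitalAeRing.isRightAction_smul z)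

variable [Module (PowerSeries k) P] [IsScalarTower (PowerSeries k) Uᵐᵒᵖ P]

variable (B) in
/-- The map `v ⊗ w ↦ p v ⊗ w m`. -/
def tact (p : P) (m : M) : U ⊗[PowerSeries k] U →ₗ[PowerSeries k] B.ModTensor P M :=
  TensorProduct.lift (LinearMap.mk₂ (PowerSeries k) (fun v w => B.tmk P M (op v • p) (w • m))
    (fun v v' w => by rw [MulOpposite.op_add, add_smul, map_add, AddMonoidHom.add_apply])
    (fun r v w => by rw [op_smul, smul_assoc, tmk_smul])
    (fun v w w' => by rw [add_smul, map_add])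
    (fun r v w => by rw [smul_assoc, smul_tmk]))

theorem tact_tmul (p : P) (m : M) (v w : U) :
    B.tact p m (v ⊗ₜ w) = B.tmk P M (op v • p) (w • m) := rfl

theorem tact_leftRel (p : P) (m : M) : ∀ x ∈ B.leftRel, B.tact p m x = 0 := by
  intro x hx
  rw [← LinearMap.mem_ker]
  revert x
  refine Submodule.span_le.2 ?_
  rintro _ ⟨a, u, v, rfl⟩
  rw [SetLike.mem_coe, LinearMap.mem_ker, map_sub, tact_tmul, tact_tmul, op_mul, mul_smul,
    tmk_balanced, mul_smul, sub_self]

theorem tact_mul (p : P) (m : M) (v w : U) (x : U ⊗[PowerSeries k] U) :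
    B.tact p m ((v ⊗ₜ 1) * x * (1 ⊗ₜ w)) = B.tact (op v • p) (w • m) x := by
  induction x with
  | zero => simp
  | tmul v' w' =>
    simp [Algebra.TensorProduct.tmul_mul_tmul, tact_tmul, mul_smul]
  | add x y hx hy => rw [mul_add, add_mul, map_add, hx, hy, map_add]

theorem tact_add_left (p p' : P) (m : M) (x : U ⊗[PowerSeries k] U) :
    B.tact (p + p') m x = B.tact p m x + B.tact p' m x := by
  induction x with
  | zero => simp
  | tmul v w => simp [tact_tmul]
  | add x y hx hy => rw [map_add, hx, hy, map_add, map_add]; abel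

theorem tact_add_right (p : P) (m m' : M) (x : U ⊗[PowerSeries k] U) :
    B.tact p (m + m') x = B.tact p m x + B.tact p m' x := by
  induction x with
  | zero => simp
  | tmul v w => simp [tact_tmul]
  | add x y hx hy => rw [map_add, hx, hy, map_add, map_add]; abel

theorem tact_smul (r : PowerSeries k) (p : P) (m : M) (x : U ⊗[PowerSeries k] U) :
    B.tact p (r • m) x = r • B.tact p m x := by
  induction x with
  | zero => simp
  | tmul v w => rw [tact_tmul, tact_tmul, smul_tmk, smul_comm]
  | add x y hx hy => rw [map_add, hx, hy, map_add, smul_add]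

variable (Hl : B.LeftHopf)
  (hF : PowComplete (PowerSeries.X : PowerSeries k) (B.ModTensor P M))

/-- `(p ⊗ m)u`, as a limit. -/
def tlim (u : U) (p : P) (m : M) : B.ModTensor P M :=
  complLift hF (B.tact p m) (tact_leftRel p m) (Hl.translation u)

theorem tlim_sub_mem {n : ℕ} {u : U} {x : U ⊗[PowerSeries k] U}
    (hx : RepMod k B.leftRel n (Hl.translation u) x) (p : P) (m : M) :
    tlim Hl hF u p m - B.tact p m x ∈ hpow (PowerSeries.X : PowerSeries k) _ n :=
  complLift_sub_mem hF _ _ hx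

theorem tlim_unique {u : U} {p : P} {m : M} {y : B.ModTensor P M}
    (hy : ∀ n, ∃ x, RepMod k B.leftRel n (Hl.translation u) x ∧
      y - B.tact p m x ∈ hpow (PowerSeries.X : PowerSeries k) _ n) : tlim Hl hF u p m = y :=
  complLift_unique hF _ _ hy

theorem tlim_add_left (u : U) (p p' : P) (m : M) :
    tlim Hl hF u (p + p') m = tlim Hl hF u p m + tlim Hl hF u p' m :=
  tlim_unique Hl hF fun n => by
    obtain ⟨x, hx⟩ := RepMod.exists_rep B.leftRel n (Hl.translation u)
    refine ⟨x, hx, ?_⟩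
    rw [tact_add_left, add_sub_add_comm]
    exact add_mem (tlim_sub_mem Hl hF hx p m) (tlim_sub_mem Hl hF hx p' m)

theorem tlim_add_right (u : U) (p : P) (m m' : M) :
    tlim Hl hF u p (m + m') = tlim Hl hF u p m + tlim Hl hF u p m' :=
  tlim_unique Hl hF fun n => by
    obtain ⟨x, hx⟩ := RepMod.exists_rep B.leftRel n (Hl.translation u)
    refine ⟨x, hx, ?_⟩
    rw [tact_add_right, add_sub_add_comm]
    exact add_mem (tlim_sub_mem Hl hF hx p m) (tlim_sub_mem Hl hF hx p m')

theorem tlim_smul (u : U) (r : PowerSeries k) (p : P) (m : M) :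
    tlim Hl hF u p (r • m) = r • tlim Hl hF u p m :=
  tlim_unique Hl hF fun n => by
    obtain ⟨x, hx⟩ := RepMod.exists_rep B.leftRel n (Hl.translation u)
    refine ⟨x, hx, ?_⟩
    rw [tact_smul, ← smul_sub]
    exact Submodule.smul_mem _ _ (tlim_sub_mem Hl hF hx p m)

theorem tlim_balanced (u : U) (a : A) (p : P) (m : M) :
    tlim Hl hF u (op (B.t (op a)) • p) m = tlim Hl hF u p (B.t (op a) • m) :=
  tlim_unique Hl hF fun n => by
    obtain ⟨x, hx⟩ := RepMod.exists_rep B.leftRel n (Hl.translation u)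
    refine ⟨x, hx, ?_⟩
    have h1 := map_supPow_mem_hpow _ (tact_leftRel p m) (Hl.rep_translation_balanced hx a)
    have h2 := tact_mul (B := B) p m (B.t (op a)) 1 x
    have h3 := tact_mul (B := B) p m 1 (B.t (op a)) x
    rw [← Algebra.TensorProduct.one_def, mul_one, one_smul] at h2
    rw [← Algebra.TensorProduct.one_def, one_mul, op_one, one_smul] at h3
    rw [map_sub, h2, h3] at h1
    rw [← sub_sub_sub_cancel_right _ _ (B.tact p (B.t (op a) • m) x)]
    exact sub_mem (tlim_sub_mem Hl hF hx p _) h1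

/-- The right action of `u` on `P ⊗ M`. -/
def tensorAct (u : U) : B.ModTensor P M →ₗ[PowerSeries k] B.ModTensor P M :=
  let f : B.ModTensor P M →+ B.ModTensor P M :=
    balLift (AddMonoidHom.mk' (fun p => AddMonoidHom.mk' (fun m => tlim Hl hF u p m)
      (tlim_add_right Hl hF u p)) (fun p q => by ext m; exact tlim_add_left Hl hF u p q m))
      (fun a p m => tlim_balanced Hl hF u a p m)
  { f with
    map_smul' := fun r => DFunLike.congr_fun (tmk_hom_ext (φ := f.comp (B.tensorSmul P M r))
      (ψ := (B.tensorSmul P M r).comp f) fun p m => by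
        rw [AddMonoidHom.comp_apply, tensorSmul_tmk]
        exact tlim_smul Hl hF u r p m) }

theorem tensorAct_tmk (u : U) (p : P) (m : M) :
    tensorAct Hl hF u (B.tmk P M p m) = tlim Hl hF u p m := rfl

omit [Module (PowerSeries k) P] [IsScalarTower (PowerSeries k) Uᵐᵒᵖ P] in
theorem tensorAct_ext {f g : B.ModTensor P M →ₗ[PowerSeries k] B.ModTensor P M}
    (hfg : ∀ p m, f (B.tmk P M p m) = g (B.tmk P M p m)) : f = g :=
  LinearMap.toAddMonoidHom_injective (tmk_hom_ext hfg)

/-- The translation map sends s(a) to s(a) ⊗ 1, so s(A) acts through P alone. The unit law and the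
agreement of the scalar actions follow. -/
theorem tensorAct_s (a : A) (p : P) (m : M) :
    tensorAct Hl hF (B.s a) (B.tmk P M p m) = B.tmk P M (op (B.s a) • p) m :=
  tlim_unique Hl hF fun n => by
    refine ⟨_, Hl.rep_translation_s a, ?_⟩
    rw [tact_tmul, one_smul, sub_self]
    exact zero_mem _

theorem tensorAct_one : tensorAct Hl hF (1 : U) = (LinearMap.id : B.ModTensor P M →ₗ[_] _) :=
  tensorAct_ext fun p m => by
    rw [← map_one B.s, tensorAct_s, map_one, op_one, one_smul, LinearMap.id_apply]

theorem tensorAct_add (u v : U) :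
    tensorAct (P := P) (M := M) Hl hF (u + v) = tensorAct Hl hF u + tensorAct Hl hF v :=
  tensorAct_ext fun p m => by
    rw [LinearMap.add_apply, tensorAct_tmk, tensorAct_tmk, tensorAct_tmk, tlim, tlim, tlim,
      ← map_add, ← Hl.translationₗ_apply, map_add]
    rfl

theorem tensorAct_mul (u u' : U) : tensorAct (P := P) (M := M) Hl hF (u * u') =
    (tensorAct Hl hF u').comp (tensorAct Hl hF u) :=
  tensorAct_ext fun p m => tlim_unique Hl hF fun n => by
    obtain ⟨x, hx⟩ := RepMod.exists_rep B.leftRel n (Hl.translation u)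
    obtain ⟨x', hx'⟩ := RepMod.exists_rep B.leftRel n (Hl.translation u')
    obtain ⟨r, v, w, rfl⟩ := exists_fin_sum x
    refine ⟨_, Hl.rep_translation_mul hx hx', ?_⟩
    -- The action of u' is linear over the ground ring, so it may be applied to an approximation
    -- modulo h^n. The second approximation is then made term by term.
    have h1 := map_mem_hpow _ (tensorAct Hl hF u') (tlim_sub_mem Hl hF hx p m)
    simp only [map_sub, map_sum, tact_tmul, tensorAct_tmk] at h1
    have h2 := Submodule.sum_mem _ fun i (_ : i ∈ Finset.univ) =>
      tlim_sub_mem Hl hF hx' (op (v i) • p) (w i • m)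
    rw [Finset.sum_sub_distrib] at h2
    rw [map_sum, LinearMap.comp_apply, tensorAct_tmk]
    simp only [tact_mul]
    have := add_mem h1 h2
    rwa [sub_add_sub_cancel] at this

/-- `P ⊗ M` as a right `U`-module. -/
abbrev tensorModule : Module Uᵐᵒᵖ (B.ModTensor P M) where
  smul u z := tensorAct Hl hF (unop u) z
  one_smul z := LinearMap.congr_fun (tensorAct_one Hl hF) z
  mul_smul u v z := LinearMap.congr_fun (tensorAct_mul Hl hF (unop v) (unop u)) z
  smul_zero u := map_zero _
  smul_add u := map_add _
  add_smul u v z := LinearMap.congr_fun (tensorAct_add Hl hF (unop u) (unop v)) z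
  zero_smul z := by
    have := LinearMap.congr_fun (tensorAct_add Hl hF 0 0) z
    rw [add_zero, LinearMap.add_apply] at this
    exact left_eq_add.1 this

theorem tensorAct_algebraMap (r : PowerSeries k) (z : B.ModTensor P M) :
    tensorAct Hl hF (algebraMap (PowerSeries k) U r) z = r • z := by
  refine LinearMap.congr_fun (g := r • LinearMap.id) (tensorAct_ext fun p m => ?_) z
  rw [← AlgHom.commutes B.s, tensorAct_s, B.s_algebraMap_smul, tmk_smul]
  rfl

theorem isScalarTower_tensorModule :
    letI := tensorModule (P := P) (M := M) Hl hF
    IsScalarTower (PowerSeries k) Uᵐᵒᵖ (B.ModTensor P M) :=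
  letI := tensorModule (P := P) (M := M) Hl hF
  ⟨fun r u z => by
    change tensorAct Hl hF (r • unop u) z = r • tensorAct Hl hF (unop u) z
    rw [Algebra.smul_def, Algebra.commutes, tensorAct_mul, LinearMap.comp_apply,
      tensorAct_algebraMap]⟩

end Tensor

end TopLeftBialgebroid


namespace TopLeftBialgebroid

open CounitalAeRing

variable {k : Type v} {A U : Type u} [CommRing k] [Ring A] [Ring U]
  [Algebra (PowerSeries k) A] [Algebra (PowerSeries k) U] {B : TopLeftBialgebroid k A U}
  {P : Type*} [AddCommGroup P] [Module Uᵐᵒᵖ P] [Module (PowerSeries k) P]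
  [IsScalarTower (PowerSeries k) Uᵐᵒᵖ P]

/-! ### The left `U`-module `Hom(P, N)` -/

section Hom

variable {N : Type*} [AddCommGroup N] [Module Uᵐᵒᵖ N] [Module (PowerSeries k) N]
  [IsScalarTower (PowerSeries k) Uᵐᵒᵖ N]

/-- The map `v ⊗ w ↦ φ(p v) w`. -/
def hact (φ : B.homAop P N) (p : P) : U ⊗[PowerSeries k] U →ₗ[PowerSeries k] N :=
  TensorProduct.lift (LinearMap.mk₂ (PowerSeries k)
    (fun v w => op w • (φ : P →+ N) (op v • p))
    (fun v v' w => by rw [MulOpposite.op_add, add_smul, map_add, smul_add])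
    (fun r v w => by rw [op_smul, smul_assoc, homAop_map_smul, smul_comm])
    (fun v w w' => by rw [MulOpposite.op_add, add_smul])
    (fun r v w => by rw [op_smul, smul_assoc]))

theorem hact_tmul (φ : B.homAop P N) (p : P) (v w : U) :
    hact φ p (v ⊗ₜ w) = op w • (φ : P →+ N) (op v • p) := rfl

theorem hact_rightRel (φ : B.homAop P N) (p : P) : ∀ x ∈ B.rightRel, hact φ p x = 0 := by
  intro x hx
  rw [← LinearMap.mem_ker]
  revert x
  refine Submodule.span_le.2 ?_
  rintro _ ⟨a, u, v, rfl⟩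
  rw [SetLike.mem_coe, LinearMap.mem_ker, map_sub, hact_tmul, hact_tmul, op_mul, mul_smul,
    homAop_smul, op_mul, mul_smul, sub_self]

theorem hact_mul (φ : B.homAop P N) (p : P) (v w : U) (x : U ⊗[PowerSeries k] U) :
    hact φ p ((v ⊗ₜ 1) * x * (1 ⊗ₜ w)) = op w • hact φ (op v • p) x := by
  induction x with
  | zero => simp
  | tmul v' w' => simp [Algebra.TensorProduct.tmul_mul_tmul, hact_tmul, mul_smul]
  | add x y hx hy => rw [mul_add, add_mul, map_add, hx, hy, map_add, smul_add]

theorem hact_add_left (φ ψ : B.homAop P N) (p : P) (x : U ⊗[PowerSeries k] U) :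
    hact (φ + ψ) p x = hact φ p x + hact ψ p x := by
  induction x with
  | zero => simp
  | tmul v w => simp [hact_tmul]
  | add x y hx hy => rw [map_add, hx, hy, map_add, map_add]; abel

theorem hact_add_right (φ : B.homAop P N) (p q : P) (x : U ⊗[PowerSeries k] U) :
    hact φ (p + q) x = hact φ p x + hact φ q x := by
  induction x with
  | zero => simp
  | tmul v w => simp [hact_tmul]
  | add x y hx hy => rw [map_add, hx, hy, map_add, map_add]; abel

variable (Hr : B.RightHopf) (hN : PowComplete (PowerSeries.X : PowerSeries k) N)

/-- `(u φ)(p)`, as a limit. -/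
def hlim (u : U) (φ : B.homAop P N) (p : P) : N :=
  complLift hN (hact φ p) (hact_rightRel φ p) (Hr.translation u)

theorem hlim_sub_mem {n : ℕ} {u : U} {x : U ⊗[PowerSeries k] U}
    (hx : RepMod k B.rightRel n (Hr.translation u) x) (φ : B.homAop P N) (p : P) :
    hlim Hr hN u φ p - hact φ p x ∈ hpow (PowerSeries.X : PowerSeries k) _ n :=
  complLift_sub_mem hN _ _ hx

theorem hlim_unique {u : U} {φ : B.homAop P N} {p : P} {y : N}
    (hy : ∀ n, ∃ x, RepMod k B.rightRel n (Hr.translation u) x ∧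
      y - hact φ p x ∈ hpow (PowerSeries.X : PowerSeries k) _ n) : hlim Hr hN u φ p = y :=
  complLift_unique hN _ _ hy

/-- The action of `u` on `Hom(P, N)`. -/
def homLim (u : U) (φ : B.homAop P N) : B.homAop P N :=
  ⟨AddMonoidHom.mk' (hlim Hr hN u φ) fun p q => hlim_unique Hr hN fun n => by
    obtain ⟨x, hx⟩ := RepMod.exists_rep B.rightRel n (Hr.translation u)
    refine ⟨x, hx, ?_⟩
    rw [hact_add_right, add_sub_add_comm]
    exact add_mem (hlim_sub_mem Hr hN hx φ p) (hlim_sub_mem Hr hN hx φ q), fun a p =>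
  hlim_unique Hr hN fun n => by
    obtain ⟨x, hx⟩ := RepMod.exists_rep B.rightRel n (Hr.translation u)
    refine ⟨x, hx, ?_⟩
    have h1 := map_supPow_mem_hpow _ (hact_rightRel φ p) (Hr.rep_translation_balanced hx a)
    have h2 := hact_mul φ p (B.s a) 1 x
    have h3 := hact_mul φ p 1 (B.s a) x
    rw [← Algebra.TensorProduct.one_def, mul_one, op_one, one_smul] at h2
    rw [← Algebra.TensorProduct.one_def, one_mul, op_one, one_smul] at h3
    rw [map_sub, h2, h3] at h1
    rw [← sub_sub_sub_cancel_right _ _ (op (B.s a) • hact φ p x)]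
    refine sub_mem ?_ h1
    rw [← smul_sub]
    exact (hpowV _ Uᵐᵒᵖ N n).smul_mem _ (hlim_sub_mem Hr hN hx φ p)⟩

theorem homLim_apply (u : U) (φ : B.homAop P N) (p : P) :
    (homLim Hr hN u φ : P →+ N) p = hlim Hr hN u φ p := rfl

theorem homLim_add_right (u : U) (φ ψ : B.homAop P N) :
    homLim Hr hN u (φ + ψ) = homLim Hr hN u φ + homLim Hr hN u ψ :=
  B.homAop_ext fun p => hlim_unique Hr hN fun n => by
    obtain ⟨x, hx⟩ := RepMod.exists_rep B.rightRel n (Hr.translation u)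
    refine ⟨x, hx, ?_⟩
    have := add_mem (hlim_sub_mem Hr hN hx φ p) (hlim_sub_mem Hr hN hx ψ p)
    rwa [← add_sub_add_comm, ← hact_add_left] at this

theorem homLim_add_left (u v : U) (φ : B.homAop P N) :
    homLim Hr hN (u + v) φ = homLim Hr hN u φ + homLim Hr hN v φ :=
  B.homAop_ext fun p => by
    change hlim Hr hN (u + v) φ p = hlim Hr hN u φ p + hlim Hr hN v φ p
    rw [hlim, hlim, hlim, ← map_add, ← Hr.translationₗ_apply, map_add]
    rfl

/-- The translation map sends t(a) to t(a) ⊗ 1. Hence the action of t(A) on Hom(P, N) is the one in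
the source of the evaluation map. -/
theorem homLim_t (a : A) (φ : B.homAop P N) :
    homLim Hr hN (B.t (op a)) φ = B.homAct P N a φ :=
  B.homAop_ext fun p => hlim_unique Hr hN fun n => by
    refine ⟨_, Hr.rep_translation_t a, ?_⟩
    rw [hact_tmul, op_one, one_smul, homAct_apply, sub_self]
    exact zero_mem _

theorem homLim_one (φ : B.homAop P N) : homLim Hr hN 1 φ = φ := by
  rw [← map_one B.t, ← op_one, homLim_t]
  exact B.homAop_ext fun p => by rw [homAct_apply, op_one, map_one, op_one, one_smul]

theorem homLim_mul (u u' : U) (φ : B.homAop P N) :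
    homLim Hr hN (u * u') φ = homLim Hr hN u (homLim Hr hN u' φ) :=
  B.homAop_ext fun p => hlim_unique Hr hN fun n => by
    obtain ⟨x, hx⟩ := RepMod.exists_rep B.rightRel n (Hr.translation u)
    obtain ⟨x', hx'⟩ := RepMod.exists_rep B.rightRel n (Hr.translation u')
    obtain ⟨r, v, w, rfl⟩ := exists_fin_sum x
    refine ⟨_, Hr.rep_translation_mul hx hx', ?_⟩
    have h1 := hlim_sub_mem Hr hN hx (homLim Hr hN u' φ) p
    have h2 := Submodule.sum_mem _ fun i (_ : i ∈ Finset.univ) =>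
      (hpowV PowerSeries.X Uᵐᵒᵖ N n).smul_mem (op (w i))
        (hlim_sub_mem Hr hN hx' φ (op (v i) • p))
    simp only [smul_sub] at h2
    rw [Finset.sum_sub_distrib] at h2
    simp only [map_sum, hact_tmul, homLim_apply] at h1
    simp only [map_sum, hact_mul]
    have := add_mem h1 h2
    rwa [sub_add_sub_cancel] at this

/-- `Hom(P, N)` as a left `U`-module. -/
abbrev homModule : Module U (B.homAop P N) where
  smul u φ := homLim Hr hN u φ
  one_smul := homLim_one Hr hN
  mul_smul := homLim_mul Hr hN
  smul_zero u := by
    have := homLim_add_right Hr hN u (0 : B.homAop P N) 0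
    rw [add_zero] at this
    exact left_eq_add.1 this
  smul_add := homLim_add_right Hr hN
  add_smul := homLim_add_left Hr hN
  zero_smul φ := by
    have := homLim_add_left Hr hN 0 0 φ
    rw [add_zero] at this
    exact left_eq_add.1 this

theorem homLim_algebraMap (r : PowerSeries k) (φ : B.homAop P N) :
    homLim Hr hN (algebraMap (PowerSeries k) U r) φ = r • φ := by
  rw [← AlgHom.commutes B.t, show algebraMap (PowerSeries k) Aᵐᵒᵖ r =
    op (algebraMap (PowerSeries k) A r) from rfl, homLim_t]
  exact B.homAop_ext fun p => by
    rw [homAct_apply, t_algebraMap_smul, homAop_map_smul, homAop_smul_apply]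

theorem isScalarTower_homModule :
    letI := homModule (P := P) (N := N) Hr hN
    IsScalarTower (PowerSeries k) U (B.homAop P N) :=
  letI := homModule (P := P) (N := N) Hr hN
  ⟨fun r u φ => by
    change homLim Hr hN (r • u) φ = r • homLim Hr hN u φ
    rw [Algebra.smul_def, homLim_mul, homLim_algebraMap]⟩

end Hom

/-! ### The unit of the adjunction -/

section Coev

-- The rank one endomorphism q ↦ p ◂ c_i(q) is right linear over the base, hence it is left
-- multiplication by a unique element a_i(p) of A.
omit [Module (PowerSeries k) P] [IsScalarTower (PowerSeries k) Uᵐᵒᵖ P] in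
theorem exists_endCoord (X : RightBasis B.toCounitalAeRing P)
    (hB : Function.Bijective (B.baseToEnd P)) :
    ∃ a : Fin X.n → P →+ A, ∀ i p q, op (B.t (op (a i p))) • q = op (B.s (X.c i q)) • p := by
  choose a ha using fun i p => hB.2 (X.ofVec P (Pi.single i p))
  have ha' : ∀ i p q, op (B.t (op (a i p))) • q = op (B.s (X.c i q)) • p := fun i p q => by
    rw [← baseToEnd_apply, ha, RightBasis.ofVec_apply, Finset.sum_eq_single i]
    · rw [Pi.single_eq_same]
    · intro j _ hj
      rw [Pi.single_eq_of_ne hj, smul_zero]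
    · simp
  exact ⟨fun i => AddMonoidHom.mk' (a i) fun p p' => hB.1 <| B.homAop_ext fun q => by
    rw [baseToEnd_apply, baseToEnd_apply, ha', MulOpposite.op_add, map_add, MulOpposite.op_add,
      add_smul, ha', ha', smul_add], ha'⟩

variable {M : Type*} [AddCommGroup M] [Module U M] [Module (PowerSeries k) M]
  [IsScalarTower (PowerSeries k) U M] (Hl : B.LeftHopf)
  (hF : PowComplete (PowerSeries.X : PowerSeries k) (B.ModTensor P M))

/-- The map `M → Hom(P, P ⊗ M)`. -/
def coev : letI := tensorModule Hl hF; M →+ B.homAop P (B.ModTensor P M) :=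
  letI := tensorModule Hl hF
  AddMonoidHom.mk' (fun m => ⟨(B.tmk P M).flip m, fun b p => (tensorAct_s Hl hF b p m).symm⟩)
    (fun m m' => B.homAop_ext fun p => map_add (B.tmk P M p) m m')

/-- The functionals a_i of `exists_endCoord` are left linear with ∑ a_i(e_i) = 1. With κ_i(p ⊗ m) =
m · a_i(p), where A acts on M through t, the inverse is φ ↦ ∑ κ_i(φ(e_i)). -/
theorem coev_bijective (X : RightBasis B.toCounitalAeRing P)
    (hB : Function.Bijective (B.baseToEnd P)) : Function.Bijective (coev Hl hF) := by
  let _ := tensorModule Hl hF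
  have coev_apply : ∀ (m : M) (p : P), (coev Hl hF m : P →+ B.ModTensor P M) p = B.tmk P M p m :=
    fun _ _ => rfl
  obtain ⟨a, ha⟩ := exists_endCoord X hB
  have ha_t : ∀ i b p, a i (op (B.t (op b)) • p) = b * a i p := fun i b p => hB.1 <|
    B.homAop_ext fun q => by
      rw [baseToEnd_apply, baseToEnd_apply, ha, op_mul, map_mul, op_mul, mul_smul, ha, s_t_smul]
  have ha_one : ∑ i, a i (X.e i) = 1 := hB.1 <| B.homAop_ext fun q => by
    rw [baseToEnd_apply, baseToEnd_apply, op_one, map_one, op_one, one_smul]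
    conv_rhs => rw [← X.sum_smul q]
    rw [Finset.op_sum, map_sum, Finset.op_sum, Finset.sum_smul]
    exact Finset.sum_congr rfl fun i _ => ha i _ q
  let κ : Fin X.n → B.ModTensor P M →+ M := fun i => balLift
    (AddMonoidHom.mk' (fun p => AddMonoidHom.mk' (fun m => B.t (op (a i p)) • m) (smul_add _))
      (fun p q => by ext m; simp [add_smul]))
    (fun b p m => by
      change B.t (op (a i (op (B.t (op b)) • p))) • m = B.t (op (a i p)) • B.t (op b) • m
      rw [ha_t, op_mul, map_mul, mul_smul])
  have hκ : ∀ i p m, κ i (B.tmk P M p m) = B.t (op (a i p)) • m :=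
    fun i p m => balLift_balMk _ _ _ _
  constructor
  · have hinv : ∀ m, ∑ i, κ i ((coev Hl hF m : P →+ B.ModTensor P M) (X.e i)) = m := fun m => by
      simp only [coev_apply, hκ]
      rw [← Finset.sum_smul, ← map_sum, ← Finset.op_sum, ha_one, op_one, map_one, one_smul]
    intro m m' hm
    rw [← hinv m, hm, hinv]
  · intro φ
    refine ⟨∑ i, κ i ((φ : P →+ B.ModTensor P M) (X.e i)), B.homAop_ext fun q => ?_⟩
    -- On z = p ⊗ m balancedness turns the left side into (a_i(p) ▸ q) ⊗ m, which is (p ◂ c_i(q)) ⊗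
    -- m by the choice of a_i.
    have key : ∀ i z, B.tmk P M q (κ i z) = op (B.s (X.c i q)) • z := fun i =>
      DFunLike.congr_fun (tmk_hom_ext (φ := (B.tmk P M q).comp (κ i))
        (ψ := DistribSMul.toAddMonoidHom _ (op (B.s (X.c i q)))) fun p m => by
          rw [AddMonoidHom.comp_apply, hκ, ← tmk_balanced, ha]
          exact (tensorAct_s Hl hF _ p m).symm)
    rw [coev_apply, map_sum]
    conv_rhs => rw [← X.sum_smul q, map_sum]
    exact Finset.sum_congr rfl fun i _ => by rw [key, homAop_smul]

/-- Linearity of the unit over U modulo h^n, from the cross relation: (p v_i ⊗ m)w_i is p v_i x_i ⊗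
m in the limit, with x_i the translation of w_i, and ∑ (v_i ⊗ 1)x_i is congruent to 1 ⊗ u. -/
theorem exists_coev_approx (Hr : B.RightHopf) (u : U) (p : P) (m : M) (n : ℕ) :
    ∃ (r : ℕ) (v w : Fin r → U), RepMod k B.rightRel n (Hr.translation u) (∑ i, v i ⊗ₜ w i) ∧
      ∃ y, B.tmk P M p (u • m) - ∑ i, tensorAct Hl hF (w i) (B.tmk P M (op (v i) • p) m) =
        (PowerSeries.X : PowerSeries k) ^ n • y := by
  obtain ⟨x, hx⟩ := RepMod.exists_rep B.rightRel n (Hr.translation u)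
  obtain ⟨r, v, w, rfl⟩ := exists_fin_sum x
  refine ⟨r, v, w, hx, (mem_hpow _).1 ?_⟩
  choose x hx' using fun i => RepMod.exists_rep B.leftRel n (Hl.translation (w i))
  have h1 := map_supPow_mem_hpow _ (tact_leftRel p m) (translation_cross_left Hl Hr hx hx')
  have h2 := Submodule.sum_mem _ fun i (_ : i ∈ Finset.univ) =>
    tlim_sub_mem Hl hF (hx' i) (op (v i) • p) m
  have h3 : ∀ i, B.tact p m ((v i ⊗ₜ 1) * x i) = B.tact (op (v i) • p) m (x i) := fun i => by
    have := tact_mul (B := B) p m (v i) 1 (x i)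
    rwa [← Algebra.TensorProduct.one_def, mul_one, one_smul] at this
  rw [map_sub, map_sum, tact_tmul, op_one, one_smul] at h1
  simp only [h3] at h1
  rw [Finset.sum_sub_distrib] at h2
  have := neg_mem (add_mem h2 h1)
  rwa [sub_add_sub_cancel, neg_sub] at this

end Coev

end TopLeftBialgebroid


/-! ### Part three: the equivalence of categories -/

section CompleteModuleCat

variable {k : Type v} [CommRing k] {S : Type u} [Ring S] [Algebra (PowerSeries k) S]

instance completeModule (M : CompleteModuleCat k S) : Module (PowerSeries k) M.obj :=
  Module.compHom M.obj (algebraMap (PowerSeries k) S)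

instance isScalarTower_completeModule (M : CompleteModuleCat k S) :
    IsScalarTower (PowerSeries k) S M.obj :=
  isScalarTower_compHom k M.obj

theorem powComplete_obj (M : CompleteModuleCat k S) :
    PowComplete (PowerSeries.X : PowerSeries k) M.obj :=
  isHComplete_iff.1 M.property

/-- A morphism of complete modules. -/
def completeHom {M N : CompleteModuleCat k S} (f : M.obj →ₗ[S] N.obj) : M ⟶ N :=
  ObjectProperty.homMk (ModuleCat.ofHom f)

/-- An isomorphism of complete modules. -/
def completeIso {M N : CompleteModuleCat k S} (f : M.obj →ₗ[S] N.obj)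
    (hf : Function.Bijective f) : M ≅ N :=
  ObjectProperty.isoMk _ (LinearEquiv.ofBijective f hf).toModuleIso

theorem completeHom_ext {M N : CompleteModuleCat k S} {f g : M ⟶ N}
    (hfg : ∀ x, f.hom.hom x = g.hom.hom x) : f = g :=
  ObjectProperty.hom_ext _ (ModuleCat.hom_ext (LinearMap.ext hfg))

end CompleteModuleCat

namespace TopLeftBialgebroid

open CounitalAeRing

variable {k : Type v} {A U : Type u} [CommRing k] [Ring A] [Ring U]
  [Algebra (PowerSeries k) A] [Algebra (PowerSeries k) U] {B : TopLeftBialgebroid k A U}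
  {P : Type u} [AddCommGroup P] [Module Uᵐᵒᵖ P] [Module (PowerSeries k) P]
  [IsScalarTower (PowerSeries k) Uᵐᵒᵖ P]

/-! ### The functor given by the tensor product with P -/

section Tensor

variable (Hl : B.LeftHopf) (Y : LeftBasis B.toCounitalAeRing P)

omit [Module (PowerSeries k) P] [IsScalarTower (PowerSeries k) Uᵐᵒᵖ P] in
include Y in
theorem powComplete_modTensor_obj (M : CompleteModuleCat k U) :
    PowComplete (PowerSeries.X : PowerSeries k) (B.ModTensor P M.obj) :=
  powComplete_modTensor Y (powComplete_obj M)

/-- The complete right `U`-module `P ⊗ M`. -/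
def tensorObj (M : CompleteModuleCat k U) : CompleteModuleCat k Uᵐᵒᵖ :=
  letI := tensorModule Hl (powComplete_modTensor_obj Y M)
  haveI := isScalarTower_tensorModule Hl (powComplete_modTensor_obj Y M)
  ⟨ModuleCat.of Uᵐᵒᵖ (B.ModTensor P M.obj), isHComplete_iff.2 (powComplete_modTensor_obj Y M)⟩

omit [Module (PowerSeries k) P] [IsScalarTower (PowerSeries k) Uᵐᵒᵖ P] in
theorem tmk_map_smul {M M' : CompleteModuleCat k U} (f : M ⟶ M') (r : PowerSeries k) (m : M.obj) :
    f.hom.hom (r • m) = r • f.hom.hom m := (f.hom.hom.restrictScalars (PowerSeries k)).map_smul r m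

variable (B P) in
/-- The map `P ⊗ M → P ⊗ M'` induced by a morphism. -/
def tensorMapₗ {M M' : CompleteModuleCat k U} (f : M ⟶ M') :
    B.ModTensor P M.obj →ₗ[PowerSeries k] B.ModTensor P M'.obj :=
  let g : B.ModTensor P M.obj →+ B.ModTensor P M'.obj :=
    balLift (AddMonoidHom.mk' (fun p => (B.tmk P M'.obj p).comp f.hom.hom.toAddMonoidHom)
      (fun p q => by ext m; simp)) (fun a p m => by
        change B.tmk P M'.obj (op (B.t (op a)) • p) (f.hom.hom m) =
          B.tmk P M'.obj p (f.hom.hom (B.t (op a) • m))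
        rw [tmk_balanced, f.hom.hom.map_smul])
  { g with
    map_smul' := fun r => DFunLike.congr_fun (tmk_hom_ext (φ := g.comp (B.tensorSmul P M.obj r))
      (ψ := (B.tensorSmul P M'.obj r).comp g) fun p m => by
        rw [AddMonoidHom.comp_apply, tensorSmul_tmk]
        refine (congrArg (B.tmk P M'.obj p) (tmk_map_smul f r m)).trans ?_
        exact (B.tensorSmul_tmk P M'.obj r p _).symm) }

omit [Module (PowerSeries k) P] [IsScalarTower (PowerSeries k) Uᵐᵒᵖ P] in
theorem tensorMapₗ_tmk {M M' : CompleteModuleCat k U} (f : M ⟶ M') (p : P) (m : M.obj) :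
    tensorMapₗ B P f (B.tmk P M.obj p m) = B.tmk P M'.obj p (f.hom.hom m) := rfl

theorem tensorMapₗ_tensorAct {M M' : CompleteModuleCat k U} (f : M ⟶ M') (u : U)
    (z : B.ModTensor P M.obj) :
    tensorMapₗ B P f (tensorAct Hl (powComplete_modTensor_obj Y M) u z) =
      tensorAct Hl (powComplete_modTensor_obj Y M') u (tensorMapₗ B P f z) := by
  refine DFunLike.congr_fun (tmk_hom_ext (φ := ((tensorMapₗ B P f).comp
      (tensorAct Hl (powComplete_modTensor_obj Y M) u)).toAddMonoidHom)
    (ψ := ((tensorAct Hl (powComplete_modTensor_obj Y M') u).comp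
      (tensorMapₗ B P f)).toAddMonoidHom) fun p m => ?_) z
  refine Eq.symm (tlim_unique Hl _ fun n => ?_)
  obtain ⟨x, hx⟩ := RepMod.exists_rep B.leftRel n (Hl.translation u)
  refine ⟨x, hx, ?_⟩
  have h1 : tensorMapₗ B P f (B.tact p m x) = B.tact p (f.hom.hom m) x := by
    clear hx
    induction x with
    | zero => simp
    | tmul v w => rw [tact_tmul, tact_tmul, tensorMapₗ_tmk, f.hom.hom.map_smul]
    | add x y hx hy => rw [map_add, map_add, map_add, hx, hy]
  change _ - B.tact p (f.hom.hom m) x ∈ _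
  rw [← h1]
  have h2 := map_mem_hpow _ (tensorMapₗ B P f)
    (tlim_sub_mem Hl (powComplete_modTensor_obj Y M) hx p m)
  rw [map_sub] at h2
  exact h2

/-- The functor `M ↦ P ⊗ M`. -/
def tensorFunctor : CompleteModuleCat k U ⥤ CompleteModuleCat k Uᵐᵒᵖ where
  obj := tensorObj Hl Y
  map {M M'} f := completeHom (M := tensorObj Hl Y M) (N := tensorObj Hl Y M')
    { toFun := tensorMapₗ B P f
      map_add' := map_add (tensorMapₗ B P f)
      map_smul' := fun u z => tensorMapₗ_tensorAct Hl Y f (unop u) z }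
  map_id M := completeHom_ext fun z => DFunLike.congr_fun (tmk_hom_ext
    (φ := (tensorMapₗ B P (𝟙 M)).toAddMonoidHom) (ψ := .id _) fun _ _ => rfl) z
  map_comp f g := completeHom_ext fun z => DFunLike.congr_fun (tmk_hom_ext
    (φ := (tensorMapₗ B P (f ≫ g)).toAddMonoidHom)
    (ψ := ((tensorMapₗ B P g).comp (tensorMapₗ B P f)).toAddMonoidHom) fun _ _ => rfl) z

theorem nonempty_isTensorFunctor : Nonempty (IsTensorFunctor Hl P (tensorFunctor Hl Y)) :=
  ⟨{ iso := fun M => AddEquiv.refl (B.ModTensor P M.obj)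
     naturality := fun _ _ _ => rfl
     action := fun M u p m n r v w hx => by
      obtain ⟨y, hy⟩ := (mem_hpow _).1 (tlim_sub_mem Hl (powComplete_modTensor_obj Y M) hx p m)
      refine ⟨y, ?_⟩
      have h1 : (algebraMap (PowerSeries k) Uᵐᵒᵖ (PowerSeries.X ^ n) •
          (show (tensorObj Hl Y M).obj from y)) = (PowerSeries.X : PowerSeries k) ^ n • y :=
        tensorAct_algebraMap Hl _ _ _
      refine .trans ?_ (hy.trans h1.symm)
      have h2 : (Submodule.Quotient.mk (∑ i, (op (v i) • p) ⊗ₜ (w i • m)) : B.ModTensor P M.obj) =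
          B.tact p m (∑ i, v i ⊗ₜ w i) := by
        rw [map_sum]
        exact map_sum (Submodule.mkQ _) _ _
      exact congrArg (tlim Hl (powComplete_modTensor_obj Y M) u p m - ·) h2 }⟩

end Tensor

/-! ### The functor of homomorphisms from P -/

section Hom

variable (Hr : B.RightHopf) (X : RightBasis B.toCounitalAeRing P)

/-- The complete left `U`-module `Hom(P, N)`. -/
def homObj (N : CompleteModuleCat k Uᵐᵒᵖ) : CompleteModuleCat k U :=
  letI := homModule (P := P) Hr (powComplete_obj N)
  haveI := isScalarTower_homModule (P := P) Hr (powComplete_obj N)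
  ⟨ModuleCat.of U (B.homAop P N.obj), isHComplete_iff.2 (X.powComplete (powComplete_obj N))⟩

variable (B P) in
omit [Module (PowerSeries k) P] [IsScalarTower (PowerSeries k) Uᵐᵒᵖ P] in
/-- The map `Hom(P, N) → Hom(P, N')` induced by a morphism. -/
def homMap {N N' : CompleteModuleCat k Uᵐᵒᵖ} (f : N ⟶ N') (φ : B.homAop P N.obj) :
    B.homAop P N'.obj :=
  ⟨f.hom.hom.toAddMonoidHom.comp (φ : P →+ N.obj), fun b p => by
    change f.hom.hom ((φ : P →+ N.obj) _) = op (B.s b) • f.hom.hom ((φ : P →+ N.obj) p)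
    rw [homAop_smul, map_smul]⟩

omit [Module (PowerSeries k) P] [IsScalarTower (PowerSeries k) Uᵐᵒᵖ P] in
theorem homMap_apply {N N' : CompleteModuleCat k Uᵐᵒᵖ} (f : N ⟶ N') (φ : B.homAop P N.obj) (p : P) :
    (homMap B P f φ : P →+ N'.obj) p = f.hom.hom ((φ : P →+ N.obj) p) := rfl

theorem homMap_homLim {N N' : CompleteModuleCat k Uᵐᵒᵖ} (f : N ⟶ N') (u : U)
    (φ : B.homAop P N.obj) :
    homMap B P f (homLim Hr (powComplete_obj N) u φ) =
      homLim Hr (powComplete_obj N') u (homMap B P f φ) := by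
  refine B.homAop_ext fun p => Eq.symm (hlim_unique Hr _ fun n => ?_)
  obtain ⟨x, hx⟩ := RepMod.exists_rep B.rightRel n (Hr.translation u)
  refine ⟨x, hx, ?_⟩
  have h1 : f.hom.hom (hact φ p x) = hact (homMap B P f φ) p x := by
    clear hx
    induction x with
    | zero => simp
    | tmul v w => rw [hact_tmul, hact_tmul, homMap_apply, map_smul]
    | add x y hx hy => rw [map_add, map_add, map_add, hx, hy]
  rw [← h1]
  have h2 := map_mem_hpow _ (f.hom.hom.restrictScalars (PowerSeries k))
    (hlim_sub_mem Hr (powComplete_obj N) hx φ p)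
  rw [map_sub] at h2
  exact h2

/-- The functor `N ↦ Hom(P, N)`. -/
def homFunctor : CompleteModuleCat k Uᵐᵒᵖ ⥤ CompleteModuleCat k U where
  obj := homObj Hr X
  map {N N'} f := completeHom (M := homObj Hr X N) (N := homObj Hr X N')
    { toFun := homMap B P f
      map_add' := fun _ _ => B.homAop_ext fun _ => map_add f.hom.hom _ _
      map_smul' := fun u φ => homMap_homLim Hr f u φ }
  map_id _ := completeHom_ext fun _ => rfl
  map_comp _ _ := completeHom_ext fun _ => rfl

theorem nonempty_isHomFunctor : Nonempty (IsHomFunctor Hr P (homFunctor Hr X)) :=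
  ⟨{ iso := fun N => AddEquiv.refl (B.homAop P N.obj)
     naturality := fun _ _ _ => rfl
     action := fun N u φ p n r v w hx => by
      obtain ⟨y, hy⟩ := (mem_hpow _).1 (hlim_sub_mem Hr (powComplete_obj N) hx φ p)
      refine ⟨y, ?_⟩
      refine .trans ?_ hy
      rw [map_sum]
      rfl }⟩

end Hom

/-! ### Unit, counit and the equivalence -/

section Equivalence

variable (Hl : B.LeftHopf) (Hr : B.RightHopf) (X : RightBasis B.toCounitalAeRing P)
  (Y : LeftBasis B.toCounitalAeRing P)

/-- The unit `M → Hom(P, P ⊗ M)`. -/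
def unitHom (M : CompleteModuleCat k U) :
    M.obj →ₗ[U] (homObj Hr X (tensorObj Hl Y M)).obj where
  toFun := coev Hl (powComplete_modTensor_obj Y M)
  map_add' := map_add (coev Hl (powComplete_modTensor_obj Y M))
  map_smul' u m := by
    refine B.homAop_ext (N := (tensorObj Hl Y M).obj) fun p => Eq.symm (hlim_unique Hr
      (powComplete_obj (tensorObj Hl Y M)) fun n => ?_)
    obtain ⟨r, v, w, hx, y, hy⟩ :=
      exists_coev_approx Hl (powComplete_modTensor_obj Y M) Hr u p m n
    refine ⟨_, hx, (mem_hpow _).2 ⟨(show (tensorObj Hl Y M).obj from y), ?_⟩⟩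
    rw [map_sum]
    refine .trans hy ?_
    exact (tensorAct_algebraMap Hl (powComplete_modTensor_obj Y M) _ y).symm

variable (B P) in
omit [Module (PowerSeries k) P] [IsScalarTower (PowerSeries k) Uᵐᵒᵖ P] in
/-- The evaluation pairing. -/
def evalPairing (N : Type*) [AddCommGroup N] [Module Uᵐᵒᵖ N] : P →+ B.homAop P N →+ N :=
  AddMonoidHom.mk' (fun p => AddMonoidHom.mk' (fun φ => (φ : P →+ N) p) (fun _ _ => rfl))
    (fun p q => by ext φ; exact map_add (φ : P →+ N) p q)

-- The action of t(a) on the object Hom(P, N) equals `homAct` by a theorem, not by definition. A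
-- general g with a proof of equality lets one pass between the two balanced quotients.
omit [Module (PowerSeries k) P] [IsScalarTower (PowerSeries k) Uᵐᵒᵖ P] in
theorem balLift_evalPairing_bijective {N : Type*} [AddCommGroup N] [Module Uᵐᵒᵖ N]
    (hN : Function.Bijective (B.evalMap P N)) {g : A → B.homAop P N → B.homAop P N}
    (hg : g = B.homAct P N)
    (hb : ∀ (a : A) (p : P) φ, evalPairing B P N (op (B.t (op a)) • p) φ =
      evalPairing B P N p (g a φ)) :
    Function.Bijective (balLift (f := fun (a : A) (p : P) => op (B.t (op a)) • p)
      (evalPairing B P N) hb) := by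
  subst hg
  convert hN using 2
  exact bal_hom_ext fun p φ => by rw [balLift_balMk, evalMap_balMk]; rfl

variable (N : CompleteModuleCat k Uᵐᵒᵖ)

theorem homObj_t_smul (a : A) (φ : (homObj Hr X N).obj) :
    B.t (op a) • φ = (B.homAct P N.obj a φ : B.homAop P N.obj) :=
  homLim_t Hr (powComplete_obj N) a φ

theorem homObj_smul (r : PowerSeries k) (φ : (homObj Hr X N).obj) (p : P) :
    ((r • φ : (homObj Hr X N).obj) : B.homAop P N.obj).1 p =
      r • (φ : B.homAop P N.obj).1 p :=
  congrArg (fun ψ : B.homAop P N.obj => ψ.1 p) (homLim_algebraMap Hr (powComplete_obj N) r φ)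

theorem evalPairing_balanced (a : A) (p : P) (φ : (homObj Hr X N).obj) :
    evalPairing B P N.obj (op (B.t (op a)) • p) φ =
      evalPairing B P N.obj p (B.t (op a) • φ : (homObj Hr X N).obj) :=
  congrArg (fun ψ : B.homAop P N.obj => ψ.1 p) (homObj_t_smul Hr X N a φ).symm

/-- The evaluation map on `P ⊗ Hom(P, N)`. -/
def counitAdd : B.ModTensor P (homObj Hr X N).obj →+ N.obj :=
  balLift (evalPairing B P N.obj) (evalPairing_balanced Hr X N)

theorem counitAdd_tmk (p : P) (φ : (homObj Hr X N).obj) :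
    counitAdd Hr X N (B.tmk P _ p φ) = (φ : B.homAop P N.obj).1 p := balLift_balMk _ _ _ _

/-- The evaluation map as a linear map over the ground ring. -/
def counitₗ : B.ModTensor P (homObj Hr X N).obj →ₗ[PowerSeries k] N.obj :=
  { counitAdd Hr X N with
    map_smul' := fun r => DFunLike.congr_fun (tmk_hom_ext
      (φ := (counitAdd Hr X N).comp (B.tensorSmul P _ r))
      (ψ := (DistribSMul.toAddMonoidHom _ r).comp (counitAdd Hr X N)) fun p φ => by
        rw [AddMonoidHom.comp_apply, tensorSmul_tmk, counitAdd_tmk]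
        refine (homObj_smul Hr X N r φ p).trans ?_
        exact congrArg (r • ·) (counitAdd_tmk Hr X N p φ).symm) }

theorem counitₗ_tact (p : P) (φ : (homObj Hr X N).obj) {r : ℕ} (v w : Fin r → U) :
    counitₗ Hr X N (B.tact p φ (∑ i, v i ⊗ₜ w i)) =
      ∑ i, hlim Hr (powComplete_obj N) (w i) φ (op (v i) • p) := by
  rw [map_sum, map_sum]
  exact Finset.sum_congr rfl fun i _ => counitAdd_tmk Hr X N _ _

/-- Linearity of the evaluation over U modulo h^n: the terms (w_i φ)(p v_i) are expanded by the
translation of w_i, and the cross relation collapses the sum to φ(p)u. -/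
theorem sum_hlim_sub_mem {n r : ℕ} {u : U} {v w : Fin r → U}
    (hx : RepMod k B.leftRel n (Hl.translation u) (∑ i, v i ⊗ₜ w i)) (φ : B.homAop P N.obj)
    (p : P) :
    ∑ i, hlim Hr (powComplete_obj N) (w i) φ (op (v i) • p) - op u • (φ : P →+ N.obj) p ∈
      hpow (PowerSeries.X : PowerSeries k) N.obj n := by
  choose x hx' using fun i => RepMod.exists_rep B.rightRel n (Hr.translation (w i))
  have h2 := map_supPow_mem_hpow _ (hact_rightRel φ p) (translation_cross_right Hl Hr hx hx')
  have h3 : ∀ i, hact φ p ((v i ⊗ₜ 1) * x i) = hact φ (op (v i) • p) (x i) := fun i => by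
    have := hact_mul φ p (v i) 1 (x i)
    rwa [← Algebra.TensorProduct.one_def, mul_one, op_one, one_smul] at this
  rw [map_sub, map_sum, hact_tmul, op_one, one_smul] at h2
  simp only [h3] at h2
  have h4 := Submodule.sum_mem _ fun i (_ : i ∈ Finset.univ) =>
    hlim_sub_mem Hr (powComplete_obj N) (hx' i) φ (op (v i) • p)
  rw [Finset.sum_sub_distrib] at h4
  have := add_mem h4 h2
  rwa [sub_add_sub_cancel] at this

/-- The counit `P ⊗ Hom(P, N) → N`. -/
def counitHom : (tensorObj Hl Y (homObj Hr X N)).obj →ₗ[Uᵐᵒᵖ] N.obj where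
  toFun := counitₗ Hr X N
  map_add' := map_add (counitₗ Hr X N)
  map_smul' u := DFunLike.congr_fun (tmk_hom_ext
    (φ := ((counitₗ Hr X N).comp (tensorAct Hl (powComplete_modTensor_obj Y _)
      (unop u))).toAddMonoidHom)
    (ψ := (DistribSMul.toAddMonoidHom _ u).comp (counitₗ Hr X N).toAddMonoidHom) fun p φ => by
      refine (powComplete_obj N).sep.eq fun n => ?_
      change counitₗ Hr X N (tlim Hl _ (unop u) p φ) -
        u • counitAdd Hr X N (B.tmk P _ p φ) ∈ _
      rw [counitAdd_tmk]
      obtain ⟨x, hx⟩ := RepMod.exists_rep B.leftRel n (Hl.translation (unop u))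
      obtain ⟨r, v, w, rfl⟩ := exists_fin_sum x
      have h1 := map_mem_hpow _ (counitₗ Hr X N)
        (tlim_sub_mem Hl (powComplete_modTensor_obj Y (homObj Hr X N)) hx p φ)
      rw [map_sub, counitₗ_tact] at h1
      have := add_mem h1 (sum_hlim_sub_mem Hl Hr N hx φ p)
      rwa [sub_add_sub_cancel] at this)

variable (hB : Function.Bijective (B.baseToEnd P))
  (hev : ∀ N : CompleteModuleCat k Uᵐᵒᵖ, Function.Bijective (B.evalMap P N.obj))

theorem counit_naturality {N N' : CompleteModuleCat k Uᵐᵒᵖ} (f : N ⟶ N') :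
    (tensorFunctor Hl Y).map ((homFunctor Hr X).map f) ≫
        completeHom (M := tensorObj Hl Y (homObj Hr X N')) (counitHom Hl Hr X Y N') =
      completeHom (M := tensorObj Hl Y (homObj Hr X N)) (counitHom Hl Hr X Y N) ≫ f :=
  completeHom_ext fun z => DFunLike.congr_fun (tmk_hom_ext
    (φ := (counitAdd Hr X N').comp
      (tensorMapₗ B P ((homFunctor Hr X).map f)).toAddMonoidHom)
    (ψ := f.hom.hom.toAddMonoidHom.comp (counitAdd Hr X N)) fun _ _ => rfl) z

/-- The equivalence of categories given by `P ⊗ -` and `Hom(P, -)`. -/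
def tensorHomEquivalence : CompleteModuleCat k U ≌ CompleteModuleCat k Uᵐᵒᵖ :=
  -- Natural isomorphisms in both directions suffice here; the triangle identities need not be
  -- verified.
  CategoryTheory.Equivalence.mk (tensorFunctor Hl Y) (homFunctor Hr X)
    (NatIso.ofComponents
      (fun M => completeIso (N := homObj Hr X (tensorObj Hl Y M)) (unitHom Hl Hr X Y M)
        (coev_bijective Hl (powComplete_modTensor_obj Y M) X hB))
      (fun _ => completeHom_ext fun _ => rfl))
    (NatIso.ofComponents
      (fun N => completeIso (M := tensorObj Hl Y (homObj Hr X N)) (counitHom Hl Hr X Y N)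
        (balLift_evalPairing_bijective (hev N)
          (funext fun a => funext fun φ => homObj_t_smul Hr X N a φ)
          (evalPairing_balanced Hr X N)))
      (counit_naturality Hl Hr X Y))

end Equivalence

end TopLeftBialgebroid

end
end Bialgd

theorem mainTheorem8 {k : Type v} {A U Ah Uh : Type u} [CommRing k] [Ring A] [Ring U]
    [Algebra k A] [Algebra k U] [Ring Ah] [Ring Uh] [Algebra (PowerSeries k) Ah]
    [Algebra (PowerSeries k) Uh]
    (B : Bialgd.LeftBialgebroid k A U) (Bh : Bialgd.TopLeftBialgebroid k Ah Uh)
    (Q : Bialgd.Quantisation B Bh)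
    (hHopf : B.IsLeftHopf ∧ B.IsRightHopf)
    (hU : IsNoetherianRing U ∧ IsNoetherianRing Uᵐᵒᵖ)
    (hA : IsNoetherianRing A ∧ IsNoetherianRing Aᵐᵒᵖ)
    (d : ℕ) (hExt : ∀ i : ℕ, i ≠ d → Subsingleton (B.ExtBase i))
    (hdual : B.IsDualising (B.ExtBase d))
    (hproj : Bialgd.IsFGProjective B.tRight (B.ExtBase d)) :
    Bh.IsTopDualising (Bh.ExtBase d) ∧
    ((∀ z : Bh.TakCompl, (PowerSeries.X : PowerSeries k) • z = 0 → z = 0) →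
      Nonempty Bh.LeftHopf ∧ Nonempty Bh.RightHopf) ∧
    ∀ (Hl : Bh.LeftHopf) (Hr : Bh.RightHopf),
      ∃ E : Bialgd.CompleteModuleCat k Uh ≌ Bialgd.CompleteModuleCat k Uhᵐᵒᵖ,
        Nonempty (Bialgd.TopLeftBialgebroid.IsTensorFunctor Hl (Bh.ExtBase d) E.functor) ∧
        Nonempty (Bialgd.TopLeftBialgebroid.IsHomFunctor Hr (Bh.ExtBase d) E.inverse) := by
  have := hU.1
  have hP := Q.isTopDualising_extBase d hExt hdual hproj
  refine ⟨hP, fun tors => ⟨Q.nonempty_leftHopf hHopf.1 tors, Q.nonempty_rightHopf hHopf.2 tors⟩,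
    fun Hl Hr => ?_⟩
  let _ : Module (PowerSeries k) (Bh.ExtBase d) :=
    Module.compHom _ (algebraMap (PowerSeries k) Uhᵐᵒᵖ)
  have := Bialgd.isScalarTower_compHom k (S := Uhᵐᵒᵖ) (Bh.ExtBase d)
  obtain ⟨X⟩ := Bialgd.CounitalAeRing.nonempty_rightBasis
    ((Bialgd.isFGProjective_iff_hasDualBasis _ _).1 hP.fgProjective_right)
  obtain ⟨Y⟩ := Bialgd.CounitalAeRing.nonempty_leftBasis
    ((Bialgd.isFGProjective_iff_hasDualBasis _ _).1 hP.fgProjective_left)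
  -- The endomorphism property of P_h inverts the unit, and the evaluation property on complete
  -- modules inverts the counit.
  exact ⟨Bialgd.TopLeftBialgebroid.tensorHomEquivalence Hl Hr X Y hP.baseToEnd_bijective
      fun N => hP.evalMap_bijective N.obj N.property,
    Bialgd.TopLeftBialgebroid.nonempty_isTensorFunctor Hl Y,
    Bialgd.TopLeftBialgebroid.nonempty_isHomFunctor Hr X⟩
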